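/- Let $d\ge 1$ be an integer, $0<\alpha\le 2$, $0<\beta<1$, and assume $$\frac{\alpha}{\beta}<d<\frac{\alpha(1+\beta)}{\beta}.$$ Let $p_t(x)$ $(t>0,\ x\in\mathbb{R}^d)$ be the transition density of the standard symmetric $\alpha$-stable Lévy process in $\mathbb{R}^d$, i.e. the continuous density with characteristic function $e^{-t|\theta|^{\alpha}}$. Let $M$ be an independently scattered $(1+\beta)$-stable random measure on $\mathbb{R}^{d+1}$ with control measure Lebesgue measure $\lambda_{d+1}$ and skewness intensity $1$: for every Borel set $A$ with $\lambda_{d+1}(A)<\infty$, $$E e^{izM(A)}=\exp\Big\{-\lambda_{d+1}(A)|z|^{1+\beta}\Big(1-i(\operatorname{sgn}z)\tan\tfrac{\pi}{2}(1+\beta)\Big)\Big\},\qquad z\in\mathbb{R},$$ the values of $M$ on disjoint sets are independent, and $M$ is $\sigma$-additive a.s. Define $$\xi_t=\int_{\mathbb{R}^{d+1}}\Big(\mathbb{1}_{[0,t]}(r)\int_r^t p_{u-r}(x)\,du\Big)M(dr\,dx),\qquad t\ge 0,$$ where the stochastic integral of a function $f\in L^{1+\beta}(\mathbb{R}^{d+1})$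 is the limit in probability of the integrals of simple functions converging to $f$ in $L^{1+\beta}$. For $0\le u<v<s<t$, $T>0$ and $z_1,z_2\in\mathbb{R}$ let $$D_T(z_1,z_2;u,v,s,t)=\Big|\log E e^{i(z_1(\xi_v-\xi_u)+z_2(\xi_{T+t}-\xi_{T+s}))}-\log E e^{iz_1(\xi_v-\xi_u)}-\log E e^{iz_2(\xi_{T+t}-\xi_{T+s})}\Big|,$$ where $\log E e^{iW}$ denotes the value at $z=1$ of the continuous logarithm of $z\mapsto E e^{izW}$ that vanishes at $z=0$, and let $$\kappa=\inf_{z_1,z_2\in\mathbb{R}}\ \inf_{0\le u<v<s<t}\ \sup\{\gamma>0:\ D_T(z_1,z_2;u,v,s,t)=o(T^{-\gamma})\text{ as }T\to\infty\}\in[0,\infty]$$ be the dependence exponent of $\xi$ (with $\sup\emptyset=0$). Then $$\kappa=\begin{cases}\dfrac{d}{\alpha}, & \text{if either }\alpha=2,\text{ or }\alpha<2\text{ and }\beta>\dfrac{d}{d+\alpha},\\[2ex] \dfrac{d}{\alpha}\Big(1+\beta-\dfrac{d}{d+\alpha}\Big), & \text{if }\alpha<2\text{ and }\beta\le\dfrac{d}{d+\alpha}.\end{cases}$$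 -/

import Mathlib

open MeasureTheory ProbabilityTheory Filter Topology Asymptotics
open scoped ENNReal RealInnerProductSpace

namespace SubfractionalStable

noncomputable section

/-- The distinguished logarithm of a characteristic function: `ψ` is the continuous function with
`ψ 0 = 0` and `exp (ψ z) = ∫ exp (i z x) μ(dx)` for all `z`. It exists whenever the characteristic
function has no zeros, in particular for every infinitely divisible law `μ`. -/
def IsLogCharFun (μ : Measure ℝ) (ψ : ℝ → ℂ) : Prop :=
  Continuous ψ ∧ ψ 0 = 0 ∧ ∀ z : ℝ, charFun μ z = Complex.exp (ψ z)

/-- The distinguished logarithm is unique. -/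
theorem IsLogCharFun.unique {μ : Measure ℝ} {ψ φ : ℝ → ℂ}
    (hψ : IsLogCharFun μ ψ) (hφ : IsLogCharFun μ φ) : ψ = φ := by
  have hpi : (2 * (Real.pi : ℂ) * Complex.I) ≠ 0 := Complex.two_pi_I_ne_zero
  have hint : ∀ z, ∃ n : ℤ, ψ z - φ z = n * (2 * Real.pi * Complex.I) := by
    intro z
    have h : Complex.exp (ψ z) = Complex.exp (φ z) := by rw [← hψ.2.2 z, ← hφ.2.2 z]
    obtain ⟨n, hn⟩ := Complex.exp_eq_exp_iff_exists_int.1 h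
    exact ⟨n, by rw [hn]; ring⟩
  choose n hn using hint
  have hdiv : ∀ z, (n z : ℂ) = (ψ z - φ z) / (2 * Real.pi * Complex.I) := by
    intro z
    rw [hn z, mul_div_cancel_right₀ _ hpi]
  have hcont : Continuous n := by
    have h1 : Continuous fun z => (n z : ℂ) := by
      simp_rw [hdiv]
      exact (hψ.1.sub hφ.1).div_const _
    have h2 : Continuous fun z => ((n z : ℝ)) := by
      have := Complex.continuous_re.comp h1
      simpa [Function.comp_def] using this
    exact Int.isClosedEmbedding_coe_real.isEmbedding.continuous_iff.2 h2
  funext z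
  have hz : n z = n 0 := PreconnectedSpace.constant inferInstance hcont
  have h0 : n 0 = 0 := by
    have := hdiv 0
    rw [hψ.2.1, hφ.2.1] at this
    simpa using this
  have := hn z
  rw [hz, h0] at this
  simpa [sub_eq_zero] using this

open Classical in
/-- The distinguished logarithm of the characteristic function of `μ` (junk value `0` if there
is none). -/
def logCharFun (μ : Measure ℝ) : ℝ → ℂ :=
  if h : ∃ ψ, IsLogCharFun μ ψ then h.choose else 0

theorem IsLogCharFun.logCharFun_eq {μ : Measure ℝ} {ψ : ℝ → ℂ} (h : IsLogCharFun μ ψ) :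
    logCharFun μ = ψ := by
  have h' : ∃ ψ, IsLogCharFun μ ψ := ⟨ψ, h⟩
  unfold logCharFun
  rw [dif_pos h']
  exact h'.choose_spec.unique h

/-- `log E exp (i W)` for a real random variable `W`: the distinguished logarithm of
`z ↦ E exp (i z W)`, taken at `z = 1`. -/
def logE {Ω : Type*} [MeasurableSpace Ω] (P : Measure Ω) (W : Ω → ℝ) : ℂ :=
  logCharFun (P.map W) 1

/-- The modulus `D_T(z₁, z₂; u, v, s, t)` of the codifference of increments of `η` (a process
indexed by `[0, ∞)`; its values at negative times are not used). -/
def codiff {Ω : Type*} [MeasurableSpace Ω] (P : Measure Ω) (η : ℝ → Ω → ℝ)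
    (z₁ z₂ u v s t T : ℝ) : ℝ :=
  ‖logE P (fun ω => z₁ * (η v ω - η u ω) + z₂ * (η (T + t) ω - η (T + s) ω))
    - logE P (fun ω => z₁ * (η v ω - η u ω))
    - logE P (fun ω => z₂ * (η (T + t) ω - η (T + s) ω))‖

/-- The dependence exponent, with values in `[0, ∞]`. (The supremum of the empty set is `0`,
that of an unbounded set is `∞`.) -/
def dependenceExponent {Ω : Type*} [MeasurableSpace Ω] (P : Measure Ω) (η : ℝ → Ω → ℝ) : ℝ≥0∞ :=
  ⨅ (z₁ : ℝ) (z₂ : ℝ),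
    ⨅ (u : ℝ) (v : ℝ) (s : ℝ) (t : ℝ) (_ : 0 ≤ u ∧ u < v ∧ v < s ∧ s < t),
      sSup (ENNReal.ofReal '' {γ : ℝ | 0 < γ ∧
        (fun T : ℝ => codiff P η z₁ z₂ u v s t T) =o[atTop] fun T : ℝ => T ^ (-γ)})

/-- `M` is an independently scattered `a`-stable random measure (`1 < a < 2`) on `E` with control
measure `m` and skewness intensity `1`, defined on the sets of finite `m`-measure. The series in
the `σ`-additivity is summed in the given order. -/
structure IsStableRandomMeasure {Ω E : Type*} [MeasurableSpace Ω] [MeasurableSpace E]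
    (P : Measure Ω) (m : Measure E) (a : ℝ) (M : Set E → Ω → ℝ) : Prop where
  measurable : ∀ A, MeasurableSet A → m A < ∞ → Measurable (M A)
  charFun_eq : ∀ A, MeasurableSet A → m A < ∞ → ∀ z : ℝ,
    charFun (P.map (M A)) z =
      Complex.exp (-((m.real A * |z| ^ a : ℝ) : ℂ) *
        (1 - Complex.I * ((Real.sign z * Real.tan (Real.pi / 2 * a) : ℝ) : ℂ)))
  indep : ∀ (n : ℕ) (A : Fin n → Set E), (∀ i, MeasurableSet (A i)) → (∀ i, m (A i) < ∞) →
    Pairwise (fun i j => Disjoint (A i) (A j)) → iIndepFun (fun i => M (A i)) P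
  sigma_additive : ∀ A : ℕ → Set E, (∀ i, MeasurableSet (A i)) →
    Pairwise (fun i j => Disjoint (A i) (A j)) → m (⋃ i, A i) < ∞ →
    ∀ᵐ ω ∂P, Tendsto (fun n => ∑ i ∈ Finset.range n, M (A i) ω) atTop (𝓝 (M (⋃ i, A i) ω))

/-- The integral `∑ y, y M({f = y})` of a simple function. (The value `y = 0` contributes `0`.) -/
def simpleIntegral {Ω E : Type*} [MeasurableSpace E] (M : Set E → Ω → ℝ) (f : SimpleFunc E ℝ) :
    Ω → ℝ :=
  fun ω => ∑ y ∈ f.range, y * M (f ⁻¹' {y}) ω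

/-- `X` is (a version of) the stochastic integral `∫ f dM` of `f ∈ L^a(m)`: the limit in
probability of the integrals of simple functions that approximate `f` in `L^a(m)`. The limit does
not depend on the approximating sequence, up to equality almost surely. -/
def IsStableIntegral {Ω E : Type*} [MeasurableSpace Ω] [MeasurableSpace E]
    (P : Measure Ω) (m : Measure E) (a : ℝ) (M : Set E → Ω → ℝ) (f : E → ℝ) (X : Ω → ℝ) : Prop :=
  MemLp f (ENNReal.ofReal a) m ∧ Measurable X ∧
    ∃ F : ℕ → SimpleFunc E ℝ, (∀ n, (F n).FinMeasSupp m) ∧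
      Tendsto (fun n => eLpNorm (fun x => F n x - f x) (ENNReal.ofReal a) m) atTop (𝓝 0) ∧
      TendstoInMeasure P (fun n => simpleIntegral M (F n)) atTop X

open Classical in
/-- The stochastic integral `∫ f dM` (junk value `0` if it does not exist). -/
def stableIntegral {Ω E : Type*} [MeasurableSpace Ω] [MeasurableSpace E]
    (P : Measure Ω) (m : Measure E) (a : ℝ) (M : Set E → Ω → ℝ) (f : E → ℝ) : Ω → ℝ :=
  if h : ∃ X, IsStableIntegral P m a M f X then h.choose else 0

/-- The continuous transition density `p_t(x)`, `t > 0`, of the standard symmetric `α`-stable Lévy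
process in `ℝ^d`, whose law at time `t` has characteristic function `exp (-t |θ|^α)`:
`p_t(x) = (2π)^{-d} ∫ exp (-i ⟨x, θ⟩) exp (-t |θ|^α) dθ`
(the imaginary part of the integral is zero by symmetry). -/
def stableDensity (d : ℕ) (α t : ℝ) (x : EuclideanSpace ℝ (Fin d)) : ℝ :=
  ((2 * Real.pi) ^ d)⁻¹ *
    ∫ θ : EuclideanSpace ℝ (Fin d), Real.cos ⟪x, θ⟫ * Real.exp (-t * ‖θ‖ ^ α)

/-- The integrand `(r, x) ↦ 1_{[0,t]}(r) ∫_r^t p_{u-r}(x) du` on `ℝ × ℝ^d = ℝ^{d+1}`. -/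
def kernel (d : ℕ) (α t : ℝ) (y : ℝ × EuclideanSpace ℝ (Fin d)) : ℝ :=
  (Set.Icc 0 t).indicator (fun r => ∫ u in r..t, stableDensity d α (u - r) y.2) y.1

/-- The sub-fractional stable process `ξ_t = ∫ 1_{[0,t]}(r) (∫_r^t p_{u-r}(x) du) M(dr dx)`. -/
def subfracStable {Ω : Type*} [MeasurableSpace Ω] (P : Measure Ω) (d : ℕ) (α β : ℝ)
    (M : Set (ℝ × EuclideanSpace ℝ (Fin d)) → Ω → ℝ) (t : ℝ) : Ω → ℝ :=
  stableIntegral P volume (1 + β) M (kernel d α t)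

end

end SubfractionalStable

/-!
Write `a = 1 + β`, `g` for the exponent of the `a`-stable law, so that `log E exp (i ∫ f dM)` is
`-∫ g(f)`, and `Δ(x, y) = g(x + y) - g(x) - g(y)` (`exponentDefect`). The codifference of two
increments of the process is then the modulus of `∫ Δ(z₁ f, z₂ h)`, where `f` and `h` are the
kernels of the two increments (`codiff_subfracStable`). So the dependence exponent is the rate of
decay of an integral over `ℝ × ℝ^d`, and the theorem compares the sizes of `f` and `h`.

*Decay.* Since `|Δ(x, y)| ≤ K |x|^δ |y|^(a - δ)` for every `δ ∈ [β, 1]` (`norm_exponentDefect_le`),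
and `|h| ≤ C T^(-d/α)` uniformly on the support of `f`, the codifference is at most
`C T^(-(d/α)(a - δ))` as soon as `|f|^δ` is integrable (`exists_codiff_le`). The kernel `f` is
dominated by the potential `∫₀^t p_w(x) dw`, whose tail at infinity is `‖x‖^(-(d + α))` if `α < 2`
and smaller than any power if `α = 2`. Hence `δ` may be any number in `[β, 1)` that
exceeds `d / (d + α)`, or any number in `[β, 1)` if `α = 2`, and letting `δ` decrease to the
infimum of this range gives the exponent in the theorem as a lower bound.

*Sharpness.* For `x, y ≥ 0` the real part of `Δ(x, y)` is nonnegative, and at least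
`β m₂ m₁^β` if `x ≥ m₁ ≥ m₂` and `y ≥ m₂` (`le_exponentDefect_re`). Both kernels are nonnegative,
so restricting the integral to a set of points `(r, x)` gives a lower bound for the codifference
(`le_codiff`). A fixed ball yields `T^(-d/α)`, while, if `α < 2`, the annulus `‖x‖ ≈ R` with
`R^(d + α) = T^(d/α)` yields `R^d T^(-(d/α) a)`, which is the second value in the theorem.

Three bodies of theory carry this. The stochastic integral exists, is linear, and has the expected
characteristic function; the point is that the law of the integral of a simple function tends to
the point mass at `0` as its `L^a` norm tends to `0`. The density `p_t`, given by Fourier inversion,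
is nonnegative because `exp (-‖θ‖^α)` is a limit of functions whose cosine transforms are visibly
nonnegative, which rests on the Lévy–Khintchine representation of `‖θ‖^α`; the same representation,
with the large jumps split off, gives the lower bound for the tail of `p_t`. Instead of an upper
bound for the tail, moments of `p_t` give the integrability of the potential. All of these are first proved at time `1` and then transferred by scaling.
-/

namespace SubfractionalStable

/-! ### The exponent of a totally skewed stable law -/

/-- The exponent `g(y) = |y|^a (1 - i sgn(y) tan(πa/2))` of the `a`-stable law of unit scale and
skewness `1`: its characteristic function is `z ↦ exp (-g(z))`. -/
noncomputable def stableExponent (a y : ℝ) : ℂ :=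
  ((|y| ^ a : ℝ) : ℂ) *
    (1 - Complex.I * ((Real.sign y * Real.tan (Real.pi / 2 * a) : ℝ) : ℂ))

/-- The defect of additivity `g(x + y) - g(x) - g(y)` of the stable exponent; integrated along two
integrands it gives the codifference of their stochastic integrals. -/
noncomputable def exponentDefect (a x y : ℝ) : ℂ :=
  stableExponent a (x + y) - stableExponent a x - stableExponent a y

variable {a : ℝ}

theorem stableExponent_eq (ha : 0 < a) (y : ℝ) :
    stableExponent a y =
      (1 - Complex.I * (Real.tan (Real.pi / 2 * a) : ℂ)) * ((max y 0 ^ a : ℝ) : ℂ) +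
      (1 + Complex.I * (Real.tan (Real.pi / 2 * a) : ℂ)) * ((max (-y) 0 ^ a : ℝ) : ℂ) := by
  unfold stableExponent
  rcases lt_trichotomy y 0 with h | h | h
  · rw [Real.sign_of_neg h, max_eq_right h.le, max_eq_left (by linarith), abs_of_neg h,
      Real.zero_rpow ha.ne']
    push_cast; ring
  · subst h; simp [Real.zero_rpow ha.ne']
  · rw [Real.sign_of_pos h, max_eq_left h.le, max_eq_right (by linarith), abs_of_pos h,
      Real.zero_rpow ha.ne']
    push_cast; ring

theorem continuous_stableExponent (ha : 0 < a) : Continuous (stableExponent a) := by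
  rw [funext (stableExponent_eq ha)]
  have h1 : Continuous fun y : ℝ => max y 0 ^ a :=
    (continuous_id.max continuous_const).rpow_const fun _ => Or.inr ha.le
  have h2 : Continuous fun y : ℝ => max (-y) 0 ^ a :=
    (continuous_neg.max continuous_const).rpow_const fun _ => Or.inr ha.le
  fun_prop

theorem stableExponent_zero (ha : 0 < a) : stableExponent a 0 = 0 := by
  simp [stableExponent, Real.zero_rpow ha.ne']

theorem stableExponent_of_nonneg {y : ℝ} (ha : 0 < a) (hy : 0 ≤ y) :
    stableExponent a y = (1 - Complex.I * (Real.tan (Real.pi / 2 * a) : ℂ)) * ((y ^ a : ℝ) : ℂ) := by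
  rw [stableExponent_eq ha, max_eq_left hy, max_eq_right (by linarith), Real.zero_rpow ha.ne']
  simp

theorem stableExponent_re_nonneg (y : ℝ) : 0 ≤ (stableExponent a y).re := by
  rw [stableExponent, Complex.re_ofReal_mul]
  have : (1 - Complex.I * ((Real.sign y * Real.tan (Real.pi / 2 * a) : ℝ) : ℂ)).re = 1 := by
    rw [Complex.sub_re, Complex.re_mul_ofReal]; simp
  rw [this]
  positivity

theorem sign_mul_of_pos {z : ℝ} (hz : 0 < z) (y : ℝ) : Real.sign (z * y) = Real.sign y := by
  rcases lt_trichotomy y 0 with h | h | h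
  · rw [Real.sign_of_neg h, Real.sign_of_neg (mul_neg_of_pos_of_neg hz h)]
  · simp [h]
  · rw [Real.sign_of_pos h, Real.sign_of_pos (mul_pos hz h)]

/-- Homogeneity of the stable exponent, including negative factors. -/
theorem stableExponent_mul (ha : 0 < a) (z y : ℝ) :
    stableExponent a (z * y) =
      ((max z 0 ^ a : ℝ) : ℂ) * stableExponent a y +
      ((max (-z) 0 ^ a : ℝ) : ℂ) * stableExponent a (-y) := by
  rcases lt_trichotomy z 0 with h | h | h
  · have h1 : Real.sign (z * y) = Real.sign (-y) := by
      rw [← neg_mul_neg z y, sign_mul_of_pos (by linarith)]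
    rw [max_eq_right h.le, max_eq_left (by linarith), Real.zero_rpow ha.ne']
    simp only [stableExponent, h1, abs_mul, abs_of_neg h, abs_neg]
    rw [Real.mul_rpow (by linarith) (abs_nonneg _)]
    push_cast; ring
  · subst h; simp [Real.zero_rpow ha.ne', stableExponent_zero ha]
  · have h1 : Real.sign (z * y) = Real.sign y := sign_mul_of_pos h y
    rw [max_eq_right (show -z ≤ 0 by linarith), max_eq_left h.le, Real.zero_rpow ha.ne']
    simp only [stableExponent, h1, abs_mul, abs_of_pos h]
    rw [Real.mul_rpow h.le (abs_nonneg _)]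
    push_cast; ring

theorem norm_stableExponent_le (y : ℝ) :
    ‖stableExponent a y‖ ≤ (1 + |Real.tan (Real.pi / 2 * a)|) * |y| ^ a := by
  have h0 : (0:ℝ) ≤ |y| ^ a := by positivity
  rw [stableExponent, norm_mul, Complex.norm_real, Real.norm_of_nonneg h0, mul_comm]
  refine mul_le_mul_of_nonneg_right ?_ h0
  refine (norm_sub_le _ _).trans ?_
  rw [norm_one, norm_mul, Complex.norm_I, one_mul, Complex.norm_real, Real.norm_eq_abs, abs_mul]
  have : |Real.sign y| ≤ 1 := by
    rcases Real.sign_apply_eq y with h | h | h <;> rw [h] <;> simp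
  nlinarith [abs_nonneg (Real.tan (Real.pi / 2 * a))]

theorem rpow_sub_rpow_le (ha : 1 ≤ a) {x y : ℝ} (hy : 0 ≤ y) (hyx : y ≤ x) :
    x ^ a - y ^ a ≤ a * (x - y) * x ^ (a - 1) := by
  rcases (hy.trans hyx).eq_or_lt with h | hx
  · have : y = x := le_antisymm hyx (by linarith)
    subst this; simp
  have h1 := one_add_mul_self_le_rpow_one_add (s := (y - x) / x) (by
    rw [le_div_iff₀ hx]; linarith) ha
  have h2 : 1 + (y - x) / x = y / x := by field_simp; ring
  rw [h2, Real.div_rpow hy hx.le, le_div_iff₀ (by positivity)] at h1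
  have h3 : x ^ a = x ^ (a - 1) * x := by
    rw [← Real.rpow_add_one hx.ne']; ring_nf
  have h4 : (1 + a * ((y - x) / x)) * x ^ a = x ^ a + a * (y - x) * x ^ (a - 1) := by
    rw [h3]; field_simp
  linarith

theorem abs_max_rpow_sub_le (ha : 1 ≤ a) (x y : ℝ) :
    |max x 0 ^ a - max y 0 ^ a| ≤ a * |x - y| * max |x| |y| ^ (a - 1) := by
  wlog h : y ≤ x generalizing x y
  · rw [abs_sub_comm, abs_sub_comm x, max_comm |x|]
    exact this y x (le_of_not_ge h)
  have h1 : max y 0 ≤ max x 0 := max_le_max_right _ h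
  have h2 : max x 0 - max y 0 ≤ x - y := by
    rcases le_total x 0 with hx | hx <;> rcases le_total y 0 with hy | hy <;>
      simp [hx, hy] <;> linarith
  have h3 : max x 0 ≤ max |x| |y| := max_le (le_max_of_le_left (le_abs_self x)) (by positivity)
  rw [abs_of_nonneg (by
    have := Real.rpow_le_rpow (le_max_right y 0) h1 (by linarith : (0:ℝ) ≤ a); linarith),
    abs_of_nonneg (by linarith : (0:ℝ) ≤ x - y)]
  refine (rpow_sub_rpow_le ha (le_max_right _ _) h1).trans ?_
  have h4 : max x 0 ^ (a - 1) ≤ max |x| |y| ^ (a - 1) :=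
    Real.rpow_le_rpow (le_max_right _ _) h3 (by linarith)
  have h5 : 0 ≤ max x 0 ^ (a - 1) := by positivity
  have h6 : a * (max x 0 - max y 0) ≤ a * (x - y) := by nlinarith
  exact mul_le_mul h6 h4 h5 (by nlinarith)

theorem norm_stableExponent_sub_le (ha : 1 ≤ a) (x y : ℝ) :
    ‖stableExponent a x - stableExponent a y‖ ≤
      2 * (1 + |Real.tan (Real.pi / 2 * a)|) * a * (|x - y| * max |x| |y| ^ (a - 1)) := by
  rw [stableExponent_eq (by linarith), stableExponent_eq (by linarith)]
  set τ := Real.tan (Real.pi / 2 * a)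
  have e : ∀ p q r s : ℝ, (1 - Complex.I * (τ : ℂ)) * (p : ℂ) + (1 + Complex.I * (τ : ℂ)) * (q : ℂ)
      - ((1 - Complex.I * (τ : ℂ)) * (r : ℂ) + (1 + Complex.I * (τ : ℂ)) * (s : ℂ)) =
      (1 - Complex.I * (τ : ℂ)) * ((p - r : ℝ) : ℂ) +
      (1 + Complex.I * (τ : ℂ)) * ((q - s : ℝ) : ℂ) := by
    intros; push_cast; ring
  rw [e]
  have n1 : ‖(1 - Complex.I * (τ : ℂ))‖ ≤ 1 + |τ| := by
    refine (norm_sub_le _ _).trans ?_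
    simp
  have n2 : ‖(1 + Complex.I * (τ : ℂ))‖ ≤ 1 + |τ| := by
    refine (norm_add_le _ _).trans ?_
    simp
  have m1 := abs_max_rpow_sub_le ha x y
  have m2 := abs_max_rpow_sub_le ha (-x) (-y)
  rw [abs_neg, abs_neg, show -x - -y = -(x - y) by ring, abs_neg] at m2
  refine (norm_add_le _ _).trans ?_
  rw [norm_mul, norm_mul, Complex.norm_real, Complex.norm_real, Real.norm_eq_abs, Real.norm_eq_abs]
  have := mul_le_mul n1 m1 (abs_nonneg _) (by positivity)
  have := mul_le_mul n2 m2 (abs_nonneg _) (by positivity)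
  linarith

theorem exponentDefect_comm (x y : ℝ) : exponentDefect a x y = exponentDefect a y x := by
  unfold exponentDefect; rw [add_comm x y]; ring

/-- The defect of additivity is at most of order `|x|^δ |y|^(a-δ)` for every `δ ∈ [a-1, 1]`: the
choice of `δ` is what balances the integrability of one integrand against the decay of the
other. -/
theorem norm_exponentDefect_le (ha : 1 < a) (ha2 : a < 2) {δ : ℝ} (h1 : a - 1 ≤ δ) (h2 : δ ≤ 1)
    (x y : ℝ) :
    ‖exponentDefect a x y‖ ≤
      9 * (1 + |Real.tan (Real.pi / 2 * a)|) * a * (|x| ^ δ * |y| ^ (a - δ)) := by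
  have hδ : 0 < δ := by linarith
  set K := 1 + |Real.tan (Real.pi / 2 * a)| with hK
  have hK1 : 1 ≤ K := by simp [hK]
  -- the bound by `min (|x|, |y|) * max (|x|, |y|) ^ (a - 1)`
  have key : ∀ x y : ℝ, |y| ≤ |x| →
      ‖exponentDefect a x y‖ ≤ 9 * K * a * (|y| * |x| ^ (a - 1)) := by
    intro x y hyx
    have e1 : exponentDefect a x y =
        (stableExponent a (x + y) - stableExponent a x) - stableExponent a y := rfl
    rw [e1]
    refine (norm_sub_le _ _).trans ?_
    have b1 := norm_stableExponent_sub_le ha.le (x + y) x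
    have b2 := norm_stableExponent_le (a := a) y
    rw [← hK] at b1 b2
    rw [add_sub_cancel_left] at b1
    have b3 : max |x + y| |x| ^ (a - 1) ≤ 4 * |x| ^ (a - 1) := by
      have : max |x + y| |x| ≤ 2 * |x| :=
        max_le ((abs_add_le x y).trans (by linarith)) (by linarith [abs_nonneg x])
      refine (Real.rpow_le_rpow (by positivity) this (by linarith)).trans ?_
      rw [Real.mul_rpow (by norm_num) (abs_nonneg _)]
      refine mul_le_mul_of_nonneg_right ?_ (by positivity)
      calc (2:ℝ) ^ (a - 1) ≤ 2 ^ (2:ℝ) := Real.rpow_le_rpow_of_exponent_le (by norm_num) (by linarith)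
        _ = 4 := by norm_num
    have b4 : |y| ^ a ≤ |y| * |x| ^ (a - 1) := by
      rcases (abs_nonneg y).eq_or_lt with h | h
      · rw [← h, Real.zero_rpow (by linarith)]; simp
      · have : |y| ^ a = |y| * |y| ^ (a - 1) := by
          rw [mul_comm, ← Real.rpow_add_one h.ne']; ring_nf
        rw [this]
        exact mul_le_mul_of_nonneg_left (Real.rpow_le_rpow h.le hyx (by linarith)) h.le
    have p1 : 0 ≤ |y| * |x| ^ (a - 1) := by positivity
    have b5 : |y| * max |x + y| |x| ^ (a - 1) ≤ 4 * (|y| * |x| ^ (a - 1)) := by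
      nlinarith [abs_nonneg y]
    calc _ ≤ 2 * K * a * (4 * (|y| * |x| ^ (a - 1))) + K * (|y| * |x| ^ (a - 1)) := by
          refine add_le_add (b1.trans ?_) (b2.trans ?_)
          · exact mul_le_mul_of_nonneg_left b5 (by positivity)
          · exact mul_le_mul_of_nonneg_left b4 (by positivity)
      _ ≤ 2 * K * a * (4 * (|y| * |x| ^ (a - 1))) + K * a * (|y| * |x| ^ (a - 1)) := by
          gcongr
          nlinarith
      _ = _ := by ring
  have pw : ∀ {s t e f : ℝ}, 0 ≤ s → s ≤ t → 0 ≤ e → e + f = a → e ≤ 1 →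
      s * t ^ (a - 1) ≤ s ^ e * t ^ f := by
    intro s t e f hs hst he hef he1
    have ht0 : 0 ≤ t := hs.trans hst
    rcases hs.eq_or_lt with h | h
    · rw [← h, zero_mul]; positivity
    have ht : 0 < t := h.trans_le hst
    have e1 : s = s ^ e * s ^ (1 - e) := by rw [← Real.rpow_add h]; simp
    have e2 : t ^ f = t ^ (1 - e) * t ^ (a - 1) := by
      rw [← Real.rpow_add ht]; congr 1; linarith
    rw [e2, ← mul_assoc]
    refine mul_le_mul_of_nonneg_right ?_ (by positivity)
    conv_lhs => rw [e1]
    gcongr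
  have hC : 0 ≤ 9 * K * a := by positivity
  rcases le_total |y| |x| with h | h
  · refine (key x y h).trans (mul_le_mul_of_nonneg_left ?_ hC)
    rw [mul_comm (|x| ^ δ)]
    exact pw (abs_nonneg _) h (by linarith) (by ring) (by linarith)
  · rw [exponentDefect_comm]
    refine (key y x h).trans (mul_le_mul_of_nonneg_left ?_ hC)
    exact pw (abs_nonneg _) h hδ.le (by ring) h2

theorem exponentDefect_re {x y : ℝ} (ha : 0 < a) (hx : 0 ≤ x) (hy : 0 ≤ y) :
    (exponentDefect a x y).re = (x + y) ^ a - x ^ a - y ^ a := by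
  rw [exponentDefect, stableExponent_of_nonneg ha hx, stableExponent_of_nonneg ha hy,
    stableExponent_of_nonneg ha (add_nonneg hx hy)]
  simp only [Complex.sub_re, Complex.re_mul_ofReal]
  simp

theorem exponentDefect_re_nonneg {x y : ℝ} (ha : 1 ≤ a) (hx : 0 ≤ x) (hy : 0 ≤ y) :
    0 ≤ (exponentDefect a x y).re := by
  rw [exponentDefect_re (by linarith) hx hy]
  have := Real.add_rpow_le_rpow_add hx hy ha
  linarith

/-- On nonnegative arguments the real part of the defect is at least
`(a - 1) min (x, y) max (x, y)^(a-1)`, which is bounded below by `(a - 1) m₂ m₁^(a-1)`. -/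
theorem le_exponentDefect_re {x y m₁ m₂ : ℝ} (ha : 1 ≤ a) (hm₂ : 0 ≤ m₂) (hm : m₂ ≤ m₁)
    (hx : m₁ ≤ x) (hy : m₂ ≤ y) :
    (a - 1) * (m₂ * m₁ ^ (a - 1)) ≤ (exponentDefect a x y).re := by
  have key : ∀ {s t : ℝ}, m₂ ≤ s → s ≤ t → m₁ ≤ t →
      (a - 1) * (m₂ * m₁ ^ (a - 1)) ≤ (t + s) ^ a - t ^ a - s ^ a := by
    intro s t hs hst ht
    have hs0 : 0 ≤ s := by linarith
    rcases (hs0.trans hst).eq_or_lt with h | ht0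
    · have e1 : m₁ = 0 := by linarith
      have e2 : m₂ = 0 := by linarith
      have e3 : s = 0 := by linarith
      rw [e2, e3, ← h]
      rcases ha.eq_or_lt with h' | h'
      · simp [← h']
      · simp [Real.zero_rpow (show a ≠ 0 by linarith)]
    have h1 := one_add_mul_self_le_rpow_one_add (s := s / t)
      (by have : 0 ≤ s / t := by positivity
          linarith) ha
    have h2 : 1 + s / t = (t + s) / t := by field_simp
    rw [h2, Real.div_rpow (by positivity) ht0.le, le_div_iff₀ (by positivity)] at h1
    have h3 : t ^ a = t ^ (a - 1) * t := by
      rw [← Real.rpow_add_one ht0.ne']; ring_nf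
    have h4 : (1 + a * (s / t)) * t ^ a = t ^ a + a * (s * t ^ (a - 1)) := by
      rw [h3]; field_simp
    have h5 : s ^ a ≤ s * t ^ (a - 1) := by
      rcases hs0.eq_or_lt with h | h
      · rw [← h, Real.zero_rpow (by linarith)]; simp
      · have : s ^ a = s * s ^ (a - 1) := by
          rw [mul_comm, ← Real.rpow_add_one h.ne']; ring_nf
        rw [this]
        exact mul_le_mul_of_nonneg_left (Real.rpow_le_rpow h.le hst (by linarith)) h.le
    have h6 : m₂ * m₁ ^ (a - 1) ≤ s * t ^ (a - 1) :=
      mul_le_mul hs (Real.rpow_le_rpow (by linarith) ht (by linarith))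
        (Real.rpow_nonneg (by linarith) _) hs0
    nlinarith
  rw [exponentDefect_re (by linarith) (by linarith) (by linarith)]
  rcases le_total y x with h | h
  · exact key hy h hx
  · have := key (hm.trans hx) h (hx.trans h)
    rw [add_comm] at this; linarith

/-! ### Stochastic integrals of simple functions -/

theorem simpleIntegral_eq_sum_ne_zero {Ω E : Type*} [MeasurableSpace E] (M : Set E → Ω → ℝ)
    (F : SimpleFunc E ℝ) :
    simpleIntegral M F = fun ω => ∑ y ∈ F.range with y ≠ 0, y * M (F ⁻¹' {y}) ω := by
  funext ω
  unfold simpleIntegral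
  rw [Finset.sum_filter]
  refine Finset.sum_congr rfl fun y _ => ?_
  split_ifs with h
  · rfl
  · rw [not_not.1 h, zero_mul]

section RandomMeasure

variable {Ω E : Type*} [MeasurableSpace Ω] [MeasurableSpace E] {P : Measure Ω}
  {m : Measure E} {a : ℝ} {M : Set E → Ω → ℝ}

theorem IsStableRandomMeasure.ae_empty (hM : IsStableRandomMeasure P m a M) :
    ∀ᵐ ω ∂P, M ∅ ω = 0 := by
  have h := hM.sigma_additive (fun _ => ∅) (fun _ => MeasurableSet.empty) (fun _ _ _ => by simp)
    (by simp)
  filter_upwards [h] with ω hω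
  simp only [Set.iUnion_empty, Finset.sum_const, Finset.card_range, nsmul_eq_mul] at hω
  -- consecutive partial sums differ by `M ∅ ω`
  have h2 := ((tendsto_add_atTop_iff_nat 1).2 hω).sub hω
  have h3 : (fun n : ℕ => ((n + 1 : ℕ) : ℝ) * M ∅ ω - (n : ℝ) * M ∅ ω) = fun _ => M ∅ ω := by
    funext n; push_cast; ring
  rw [h3, sub_self] at h2
  exact tendsto_nhds_unique tendsto_const_nhds h2

theorem IsStableRandomMeasure.ae_union (hM : IsStableRandomMeasure P m a M) {A B : Set E}
    (hA : MeasurableSet A) (hB : MeasurableSet B) (hAB : Disjoint A B) (hmA : m A < ∞)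
    (hmB : m B < ∞) : ∀ᵐ ω ∂P, M (A ∪ B) ω = M A ω + M B ω := by
  set C : ℕ → Set E := fun n => if n = 0 then A else if n = 1 then B else ∅ with hC
  have hU : ⋃ n, C n = A ∪ B := by
    ext x
    simp only [Set.mem_iUnion, Set.mem_union, hC]
    constructor
    · rintro ⟨n, hn⟩
      split_ifs at hn
      · exact Or.inl hn
      · exact Or.inr hn
      · exact hn.elim
    · rintro (h | h)
      · exact ⟨0, by simpa using h⟩
      · exact ⟨1, by simpa using h⟩
  have h := hM.sigma_additive C
    (fun n => by simp only [hC]; split_ifs <;> first | assumption | exact MeasurableSet.empty)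
    (fun i j hij => by
      simp only [hC]
      split_ifs <;> first | (exact hAB) | (exact hAB.symm) | (simp; done) | (exfalso; omega))
    (by rw [hU]; exact (measure_union_le _ _).trans_lt (ENNReal.add_lt_top.2 ⟨hmA, hmB⟩))
  filter_upwards [h, hM.ae_empty] with ω h1 h2
  rw [hU] at h1
  refine tendsto_nhds_unique h1 (tendsto_const_nhds.congr' ?_)
  filter_upwards [eventually_ge_atTop 2] with n hn
  obtain ⟨k, rfl⟩ := Nat.exists_eq_add_of_le hn
  rw [Finset.sum_range_add]
  have h3 : ∀ x, M (C (2 + x)) ω = 0 := fun x => by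
    simp only [hC]
    rw [if_neg (by omega), if_neg (by omega), h2]
  simp [Finset.sum_range_succ, h3]
  simp [hC]

theorem IsStableRandomMeasure.ae_biUnion (hM : IsStableRandomMeasure P m a M) {ι : Type*}
    (s : Finset ι) (A : ι → Set E) (hA : ∀ i ∈ s, MeasurableSet (A i))
    (hd : Pairwise fun i j => Disjoint (A i) (A j)) (hmA : ∀ i ∈ s, m (A i) < ∞) :
    ∀ᵐ ω ∂P, M (⋃ i ∈ s, A i) ω = ∑ i ∈ s, M (A i) ω := by
  classical
  induction s using Finset.induction_on with
  | empty => simpa using hM.ae_empty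
  | insert i s his ih =>
    have hA' : ∀ j ∈ s, MeasurableSet (A j) := fun j hj => hA j (Finset.mem_insert_of_mem hj)
    have hmA' : ∀ j ∈ s, m (A j) < ∞ := fun j hj => hmA j (Finset.mem_insert_of_mem hj)
    have h1 := hM.ae_union (A := A i) (B := ⋃ j ∈ s, A j) (hA i (Finset.mem_insert_self _ _))
      (Finset.measurableSet_biUnion s hA')
      (Set.disjoint_iUnion₂_right.2 fun j hj => hd (fun h => his (h ▸ hj)))
      (hmA i (Finset.mem_insert_self _ _))
      ((measure_biUnion_finset_le _ _).trans_lt (ENNReal.sum_lt_top.2 hmA'))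
    filter_upwards [h1, ih hA' hmA'] with ω h1 h2
    rw [Finset.sum_insert his, ← h2, ← h1, Finset.set_biUnion_insert]

/-- The integral of a function of a simple function, computed over the level sets of the
latter. -/
theorem IsStableRandomMeasure.ae_simpleIntegral_map (hM : IsStableRandomMeasure P m a M)
    {V : Type*} [Zero V] (H : SimpleFunc E V) (hH : H.FinMeasSupp m) (φ : V → ℝ) (hφ : φ 0 = 0) :
    ∀ᵐ ω ∂P, simpleIntegral M (H.map φ) ω = ∑ c ∈ H.range, φ c * M (H ⁻¹' {c}) ω := by
  classical
  have h1 : ∀ y : ℝ, y ≠ 0 → ∀ᵐ ω ∂P, M (H.map φ ⁻¹' {y}) ω =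
      ∑ c ∈ H.range with φ c = y, M (H ⁻¹' {c}) ω := by
    intro y hy
    have h2 := hM.ae_biUnion (H.range.filter fun c => φ c = y) (fun c => H ⁻¹' {c})
      (fun c _ => H.measurableSet_fiber c)
      (fun c c' hcc => Set.disjoint_left.2 fun x hx hx' => hcc (by
        rw [← show H x = c from hx, ← show H x = c' from hx']))
      (fun c hc => hH.meas_preimage_singleton_ne_zero (by
        rintro rfl; exact hy ((Finset.mem_filter.1 hc).2.symm.trans hφ)))
    have h3 : H.map φ ⁻¹' {y} = ⋃ c ∈ H.range.filter fun c => φ c = y, H ⁻¹' {c} := by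
      ext x; simp
    rw [h3]; exact h2
  have h2 : ∀ᵐ ω ∂P, ∀ y ∈ (H.map φ).range, y ≠ 0 → M (H.map φ ⁻¹' {y}) ω =
      ∑ c ∈ H.range with φ c = y, M (H ⁻¹' {c}) ω := by
    rw [Finset.eventually_all]
    intro y _
    by_cases hy : y = 0
    · simp [hy]
    · filter_upwards [h1 y hy] with ω hω _ using hω
  filter_upwards [h2] with ω hω
  unfold simpleIntegral
  rw [← Finset.sum_fiberwise_of_maps_to (g := φ) (t := (H.map φ).range) (s := H.range)
    (fun c hc => by rw [SimpleFunc.range_map]; exact Finset.mem_image_of_mem _ hc)]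
  refine Finset.sum_congr rfl fun y hy => ?_
  by_cases hy0 : y = 0
  · subst hy0
    rw [zero_mul, Finset.sum_eq_zero]
    intro c hc
    rw [(Finset.mem_filter.1 hc).2, zero_mul]
  · rw [hω y hy hy0, Finset.mul_sum]
    refine Finset.sum_congr rfl fun c hc => ?_
    rw [(Finset.mem_filter.1 hc).2]

/-- The simple function `c₁ F + c₂ G`. -/
noncomputable def simpleLinComb (c₁ c₂ : ℝ) (F G : SimpleFunc E ℝ) : SimpleFunc E ℝ :=
  (F.pair G).map fun p => c₁ * p.1 + c₂ * p.2

@[simp] theorem simpleLinComb_apply (c₁ c₂ : ℝ) (F G : SimpleFunc E ℝ) (x : E) :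
    simpleLinComb c₁ c₂ F G x = c₁ * F x + c₂ * G x := rfl

theorem finMeasSupp_simpleLinComb (c₁ c₂ : ℝ) {F G : SimpleFunc E ℝ} (hF : F.FinMeasSupp m)
    (hG : G.FinMeasSupp m) : (simpleLinComb c₁ c₂ F G).FinMeasSupp m :=
  (hF.pair hG).map (by simp)

theorem IsStableRandomMeasure.ae_simpleIntegral_linComb (hM : IsStableRandomMeasure P m a M)
    (c₁ c₂ : ℝ) {F G : SimpleFunc E ℝ} (hF : F.FinMeasSupp m) (hG : G.FinMeasSupp m) :
    ∀ᵐ ω ∂P, simpleIntegral M (simpleLinComb c₁ c₂ F G) ω =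
      c₁ * simpleIntegral M F ω + c₂ * simpleIntegral M G ω := by
  have h1 := hM.ae_simpleIntegral_map (F.pair G) (hF.pair hG) (fun p => c₁ * p.1 + c₂ * p.2)
    (by simp)
  have h2 := hM.ae_simpleIntegral_map (F.pair G) (hF.pair hG) Prod.fst rfl
  have h3 := hM.ae_simpleIntegral_map (F.pair G) (hF.pair hG) Prod.snd rfl
  rw [SimpleFunc.map_fst_pair] at h2
  rw [SimpleFunc.map_snd_pair] at h3
  filter_upwards [h1, h2, h3] with ω h1 h2 h3
  rw [simpleLinComb, h1, h2, h3, Finset.mul_sum, Finset.mul_sum, ← Finset.sum_add_distrib]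
  exact Finset.sum_congr rfl fun c _ => by ring

theorem IsStableRandomMeasure.measurable_simpleIntegral (hM : IsStableRandomMeasure P m a M)
    {F : SimpleFunc E ℝ} (hF : F.FinMeasSupp m) : Measurable (simpleIntegral M F) := by
  rw [simpleIntegral_eq_sum_ne_zero]
  refine Finset.measurable_fun_sum _ fun y hy => ?_
  exact (hM.measurable _ (F.measurableSet_fiber y)
    (hF.meas_preimage_singleton_ne_zero (Finset.mem_filter.1 hy).2)).const_mul y

theorem IsStableRandomMeasure.charFun_map_const_mul (hM : IsStableRandomMeasure P m a M)
    {A : Set E} (hA : MeasurableSet A) (hmA : m A < ∞) (y z : ℝ) :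
    charFun (P.map fun ω => y * M A ω) z =
      Complex.exp (-(m.real A : ℂ) * stableExponent a (z * y)) := by
  rw [charFun_map_mul_comp (hM.measurable A hA hmA).aemeasurable, hM.charFun_eq A hA hmA,
    mul_comm y z]
  congr 1
  simp only [stableExponent]
  push_cast; ring

theorem IsStableRandomMeasure.charFun_simpleIntegral [IsProbabilityMeasure P]
    (hM : IsStableRandomMeasure P m a M) (ha : 0 < a) {F : SimpleFunc E ℝ}
    (hF : F.FinMeasSupp m) (z : ℝ) :
    charFun (P.map (simpleIntegral M F)) z =
      Complex.exp (-∫ x, stableExponent a (z * F x) ∂m) := by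
  classical
  have hint : ∫ x, stableExponent a (z * F x) ∂m =
      ∑ y ∈ F.range with y ≠ 0, (m.real (F ⁻¹' {y}) : ℂ) * stableExponent a (z * y) := by
    have hg : stableExponent a (z * 0) = 0 := by rw [mul_zero, stableExponent_zero ha]
    have h1 := SimpleFunc.map_integral F (fun y => stableExponent a (z * y)) hF.integrable hg
    have h2 := SimpleFunc.integral_eq_integral (F.map fun y => stableExponent a (z * y))
      (hF.map hg).integrable
    rw [show (∫ x, stableExponent a (z * F x) ∂m) =
      ∫ x, (F.map fun y => stableExponent a (z * y)) x ∂m from rfl, ← h2, h1, Finset.sum_filter]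
    refine Finset.sum_congr rfl fun y _ => ?_
    split_ifs with h
    · simp
    · rw [not_not.1 h, hg, smul_zero]
  set s := F.range.filter (fun y => y ≠ 0) with hs
  have hs0 : ∀ y ∈ s, y ≠ 0 := fun y hy => (Finset.mem_filter.1 hy).2
  let e := s.equivFin.symm
  have hind := hM.indep s.card (fun i => F ⁻¹' {(e i : ℝ)}) (fun i => F.measurableSet_fiber _)
    (fun i => hF.meas_preimage_singleton_ne_zero (hs0 _ (e i).2))
    (fun i j hij => Set.disjoint_left.2 fun x hx hx' => hij (by
      have : (e i : ℝ) = e j := by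
        rw [← show F x = e i from hx, ← show F x = e j from hx']
      exact e.injective (Subtype.ext this)))
  have hind2 := hind.comp (fun i t => (e i : ℝ) * t) (fun i => measurable_const_mul _)
  have hmeas : ∀ y ∈ s, Measurable (M (F ⁻¹' {y})) := fun y hy =>
    hM.measurable _ (F.measurableSet_fiber y) (hF.meas_preimage_singleton_ne_zero (hs0 y hy))
  have hsum : simpleIntegral M F =
      fun ω => ∑ i, ((fun t => (e i : ℝ) * t) ∘ M (F ⁻¹' {(e i : ℝ)})) ω := by
    rw [simpleIntegral_eq_sum_ne_zero]
    funext ω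
    rw [← hs, ← Finset.sum_coe_sort, ← e.sum_comp]
    rfl
  rw [hsum, iIndepFun.charFun_map_fun_sum_eq_prod
    (fun i => ((measurable_const_mul _).comp (hmeas _ (e i).2)).aemeasurable) hind2, hint,
    ← Finset.sum_neg_distrib, Complex.exp_sum, Finset.prod_apply, ← Finset.prod_coe_sort s,
    ← e.prod_comp]
  refine Finset.prod_congr rfl fun i _ => ?_
  have := hM.charFun_map_const_mul (F.measurableSet_fiber (e i : ℝ))
    (hF.meas_preimage_singleton_ne_zero (hs0 _ (e i).2)) (e i) z
  rw [neg_mul] at this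
  exact this

/-- Tail estimate for the integral of a simple function, obtained from its characteristic
function. -/
theorem IsStableRandomMeasure.measureReal_simpleIntegral_gt_le [IsProbabilityMeasure P]
    (hM : IsStableRandomMeasure P m a M) (ha : 0 < a) {F : SimpleFunc E ℝ}
    (hF : F.FinMeasSupp m) {r : ℝ} (hr : 0 < r) :
    P.real {ω | r < |simpleIntegral M F ω|} ≤
      4 * (1 + |Real.tan (Real.pi / 2 * a)|) * (2 * r⁻¹) ^ a * ∫ x, |F x| ^ a ∂m := by
  set K := 1 + |Real.tan (Real.pi / 2 * a)| with hK
  set N := ∫ x, |F x| ^ a ∂m with hN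
  have hN0 : 0 ≤ N := integral_nonneg fun x => by positivity
  have hmeas := hM.measurable_simpleIntegral hF
  have : IsProbabilityMeasure (P.map (simpleIntegral M F)) :=
    Measure.isProbabilityMeasure_map hmeas.aemeasurable
  have h1 := measureReal_abs_gt_le_integral_charFun (μ := P.map (simpleIntegral M F)) hr
  have hset : MeasurableSet {x : ℝ | r < |x|} :=
    measurableSet_lt measurable_const measurable_id.abs
  rw [map_measureReal_apply hmeas hset] at h1
  have hFint : Integrable (fun x => |F x| ^ a) m :=
    (hF.map (g := fun y : ℝ => |y| ^ a) (by simp [Real.zero_rpow ha.ne'])).integrable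
  have h2 : ∀ t : ℝ, ‖1 - charFun (P.map (simpleIntegral M F)) t‖ ≤ 2 * (K * |t| ^ a * N) := by
    intro t
    rw [hM.charFun_simpleIntegral ha hF]
    set w := ∫ x, stableExponent a (t * F x) ∂m with hw
    have hwn : ‖w‖ ≤ K * |t| ^ a * N := by
      rw [hN, ← integral_const_mul]
      refine norm_integral_le_of_norm_le (hFint.const_mul _) (ae_of_all _ fun x => ?_)
      refine (norm_stableExponent_le _).trans (le_of_eq ?_)
      rw [abs_mul, Real.mul_rpow (abs_nonneg _) (abs_nonneg _)]; ring
    have hwre : 0 ≤ w.re := by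
      have hi : Integrable (fun x => stableExponent a (t * F x)) m :=
        (hF.map (g := fun y : ℝ => stableExponent a (t * y))
          (by simp [stableExponent_zero ha])).integrable
      have := integral_re hi
      simp only [RCLike.re_eq_complex_re] at this
      rw [hw, ← this]
      exact integral_nonneg fun x => stableExponent_re_nonneg _
    refine le_trans ?_ (mul_le_mul_of_nonneg_left hwn zero_le_two)
    rcases le_total ‖w‖ 1 with h | h
    · rw [norm_sub_rev, ← norm_neg w]
      exact Complex.norm_exp_sub_one_le (by rwa [norm_neg])
    · refine (norm_sub_le _ _).trans ?_
      rw [norm_one, Complex.norm_exp, Complex.neg_re]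
      have : Real.exp (-w.re) ≤ 1 := Real.exp_le_one_iff.2 (by linarith)
      linarith
  have h3 := intervalIntegral.norm_integral_le_of_norm_le_const (a := -2 * r⁻¹) (b := 2 * r⁻¹)
    (f := fun t => 1 - charFun (P.map (simpleIntegral M F)) t)
    (C := 2 * (K * (2 * r⁻¹) ^ a * N)) (fun t ht => (h2 t).trans (by
      have ht2 : |t| ≤ 2 * r⁻¹ := by
        rw [Set.uIoc_of_le (by have : 0 < r⁻¹ := by positivity
                               linarith)] at ht
        exact abs_le.2 ⟨by linarith [ht.1], ht.2⟩
      have := Real.rpow_le_rpow (abs_nonneg t) ht2 ha.le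
      gcongr))
  have h4 : |2 * r⁻¹ - -2 * r⁻¹| = 4 * r⁻¹ := by
    rw [show 2 * r⁻¹ - -2 * r⁻¹ = 4 * r⁻¹ by ring, abs_of_pos (by positivity)]
  rw [h4] at h3
  refine h1.trans ?_
  calc 2⁻¹ * r * ‖∫ t in (-2 * r⁻¹)..(2 * r⁻¹), 1 - charFun (P.map (simpleIntegral M F)) t‖
      ≤ 2⁻¹ * r * (2 * (K * (2 * r⁻¹) ^ a * N) * (4 * r⁻¹)) := by gcongr
    _ = _ := by field_simp

end RandomMeasure

/-! ### Stochastic integrals of functions in `L^a` -/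

section StableIntegral

variable {E : Type*} [MeasurableSpace E] {m : Measure E} {a : ℝ}

theorem integrable_stableExponent (ha : 0 < a) {f : E → ℝ} (hf : MemLp f (ENNReal.ofReal a) m) :
    Integrable (fun x => stableExponent a (f x)) m := by
  have h1 := hf.integrable_norm_rpow (by simpa using ha) ENNReal.ofReal_ne_top
  rw [ENNReal.toReal_ofReal ha.le] at h1
  refine Integrable.mono' (h1.const_mul (1 + |Real.tan (Real.pi / 2 * a)|))
    ((continuous_stableExponent ha).comp_aestronglyMeasurable hf.1)
    (ae_of_all _ fun x => norm_stableExponent_le _)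

/-- The integral of the stable exponent is continuous along convergence in `L^a`. -/
theorem tendsto_integral_stableExponent (ha : 1 < a) {F : ℕ → E → ℝ} {f : E → ℝ}
    (hF : ∀ n, MemLp (F n) (ENNReal.ofReal a) m) (hf : MemLp f (ENNReal.ofReal a) m)
    (h : Tendsto (fun n => eLpNorm (fun x => F n x - f x) (ENNReal.ofReal a) m) atTop (𝓝 0)) :
    Tendsto (fun n => ∫ x, stableExponent a (F n x) ∂m) atTop
      (𝓝 (∫ x, stableExponent a (f x) ∂m)) := by
  have ha0 : 0 < a := by linarith
  have hp0 : ENNReal.ofReal a ≠ 0 := by simpa using ha0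
  have hpt : ENNReal.ofReal a ≠ ∞ := ENNReal.ofReal_ne_top
  have hp1 : 1 ≤ ENNReal.ofReal a := by simpa using ENNReal.ofReal_le_ofReal ha.le
  refine tendsto_integral_of_L1 _ (integrable_stableExponent ha0 hf).aestronglyMeasurable
    (Eventually.of_forall fun n => integrable_stableExponent ha0 (hF n)) ?_
  set K := 2 * (1 + |Real.tan (Real.pi / 2 * a)|) * a with hK
  have hK0 : 0 ≤ K := by positivity
  set N := eLpNorm f (ENNReal.ofReal a) m with hN
  have hNt : N ≠ ∞ := hf.2.ne
  set e : ℕ → ℝ≥0∞ := fun n => eLpNorm (fun x => F n x - f x) (ENNReal.ofReal a) m with he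
  have hq : a.HolderConjugate (a / (a - 1)) := Real.HolderConjugate.conjExponent ha
  have key : ∀ n, ∫⁻ x, ‖stableExponent a (F n x) - stableExponent a (f x)‖ₑ ∂m ≤
      ENNReal.ofReal K * (e n * (e n + N + N) ^ (a - 1)) := by
    intro n
    have hD : AEMeasurable (fun x => ‖F n x - f x‖ₑ) m :=
      ((hF n).1.sub hf.1).enorm
    have hW : MemLp (fun x => |F n x| + |f x|) (ENNReal.ofReal a) m := (hF n).abs.add hf.abs
    have hWm : AEMeasurable (fun x => ‖|F n x| + |f x|‖ₑ ^ (a - 1)) m :=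
      hW.1.enorm.pow_const _
    calc ∫⁻ x, ‖stableExponent a (F n x) - stableExponent a (f x)‖ₑ ∂m
        ≤ ∫⁻ x, ENNReal.ofReal K * ((fun x => ‖F n x - f x‖ₑ) *
            (fun x => ‖|F n x| + |f x|‖ₑ ^ (a - 1))) x ∂m := by
          refine lintegral_mono fun x => ?_
          have h1 : ‖stableExponent a (F n x) - stableExponent a (f x)‖ ≤
              K * (|F n x - f x| * (|F n x| + |f x|) ^ (a - 1)) := by
            refine (norm_stableExponent_sub_le ha.le _ _).trans ?_
            have : max |F n x| |f x| ^ (a - 1) ≤ (|F n x| + |f x|) ^ (a - 1) :=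
              Real.rpow_le_rpow (by positivity) (max_le_add_of_nonneg (abs_nonneg _)
                (abs_nonneg _)) (by linarith)
            gcongr
          rw [← ofReal_norm]
          refine (ENNReal.ofReal_le_ofReal h1).trans (le_of_eq ?_)
          rw [ENNReal.ofReal_mul hK0, ENNReal.ofReal_mul (abs_nonneg _), Pi.mul_apply,
            ← ENNReal.ofReal_rpow_of_nonneg (by positivity) (by linarith), Real.enorm_eq_ofReal_abs,
            Real.enorm_eq_ofReal_abs, abs_of_nonneg (by positivity : 0 ≤ |F n x| + |f x|)]
      _ = ENNReal.ofReal K * ∫⁻ x, ((fun x => ‖F n x - f x‖ₑ) *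
            (fun x => ‖|F n x| + |f x|‖ₑ ^ (a - 1))) x ∂m :=
          lintegral_const_mul' _ _ ENNReal.ofReal_ne_top
      _ ≤ ENNReal.ofReal K * (e n * (e n + N + N) ^ (a - 1)) := by
          gcongr
          refine (ENNReal.lintegral_mul_le_Lp_mul_Lq m hq hD hWm).trans ?_
          have e1 : e n = (∫⁻ x, ‖F n x - f x‖ₑ ^ a ∂m) ^ (1 / a) := by
            rw [he]
            simp only
            rw [eLpNorm_eq_lintegral_rpow_enorm_toReal hp0 hpt, ENNReal.toReal_ofReal ha0.le]
          have e2 : (∫⁻ x, (‖|F n x| + |f x|‖ₑ ^ (a - 1)) ^ (a / (a - 1)) ∂m) ^ (1 / (a / (a - 1)))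
              = eLpNorm (fun x => |F n x| + |f x|) (ENNReal.ofReal a) m ^ (a - 1) := by
            rw [eLpNorm_eq_lintegral_rpow_enorm_toReal hp0 hpt, ENNReal.toReal_ofReal ha0.le,
              ← ENNReal.rpow_mul]
            have ha1 : a - 1 ≠ 0 := by linarith
            congr 1
            · refine lintegral_congr fun x => ?_
              rw [← ENNReal.rpow_mul]
              congr 1
              field_simp
            · field_simp
          rw [← e1, e2]
          gcongr
          refine (eLpNorm_add_le (hF n).1.norm hf.1.norm hp1).trans ?_
          have e3 : eLpNorm (fun x => ‖F n x‖) (ENNReal.ofReal a) m ≤ e n + N := by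
            rw [eLpNorm_norm]
            calc eLpNorm (F n) (ENNReal.ofReal a) m
                = eLpNorm ((fun x => F n x - f x) + f) (ENNReal.ofReal a) m := by
                  congr 1; funext x; simp
              _ ≤ _ := eLpNorm_add_le ((hF n).1.sub hf.1) hf.1 hp1
          have e4 : eLpNorm (fun x => ‖f x‖) (ENNReal.ofReal a) m ≤ N := by rw [eLpNorm_norm]
          exact add_le_add e3 e4
  have hlim : Tendsto (fun n => ENNReal.ofReal K * (e n * (e n + N + N) ^ (a - 1))) atTop (𝓝 0) := by
    have hc : Tendsto (fun n => (e n + N + N) ^ (a - 1)) atTop (𝓝 ((0 + N + N) ^ (a - 1))) :=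
      (ENNReal.continuous_rpow_const.tendsto _).comp ((h.add_const N).add_const N)
    have hne : (0 + N + N) ^ (a - 1) ≠ ∞ :=
      ENNReal.rpow_ne_top_of_nonneg (by linarith) (by simp [hNt])
    have h2 := ENNReal.Tendsto.mul h (Or.inr hne) hc (Or.inr ENNReal.zero_ne_top)
    rw [zero_mul] at h2
    simpa using ENNReal.Tendsto.const_mul h2 (Or.inr ENNReal.ofReal_ne_top)
  exact tendsto_of_tendsto_of_tendsto_of_le_of_le tendsto_const_nhds hlim (fun _ => zero_le) key

variable {Ω : Type*} [MeasurableSpace Ω] {P : Measure Ω} {M : Set E → Ω → ℝ}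

/-- The approximating sequence of a stochastic integral may be chosen so that the integrals
converge almost surely. -/
theorem IsStableIntegral.exists_seq_tendsto_ae {f : E → ℝ} {X : Ω → ℝ}
    (h : IsStableIntegral P m a M f X) :
    ∃ F : ℕ → SimpleFunc E ℝ, (∀ n, (F n).FinMeasSupp m) ∧
      Tendsto (fun n => eLpNorm (fun x => F n x - f x) (ENNReal.ofReal a) m) atTop (𝓝 0) ∧
      ∀ᵐ ω ∂P, Tendsto (fun n => simpleIntegral M (F n) ω) atTop (𝓝 (X ω)) := by
  obtain ⟨_, _, F, hF, hlim, hX⟩ := h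
  obtain ⟨ns, hns, hae⟩ := hX.exists_seq_tendsto_ae
  exact ⟨fun n => F (ns n), fun n => hF _, hlim.comp hns.tendsto_atTop, hae⟩

theorem IsStableRandomMeasure.isStableIntegral_of_tendsto_ae [IsProbabilityMeasure P]
    (hM : IsStableRandomMeasure P m a M) {f : E → ℝ} {X : Ω → ℝ}
    (hf : MemLp f (ENNReal.ofReal a) m) (hX : Measurable X) (F : ℕ → SimpleFunc E ℝ)
    (hF : ∀ n, (F n).FinMeasSupp m)
    (hlim : Tendsto (fun n => eLpNorm (fun x => F n x - f x) (ENNReal.ofReal a) m) atTop (𝓝 0))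
    (hae : ∀ᵐ ω ∂P, Tendsto (fun n => simpleIntegral M (F n) ω) atTop (𝓝 (X ω))) :
    IsStableIntegral P m a M f X :=
  ⟨hf, hX, F, hF, hlim, tendstoInMeasure_of_tendsto_ae
    (fun n => (hM.measurable_simpleIntegral (hF n)).aestronglyMeasurable) hae⟩

theorem IsStableRandomMeasure.isStableIntegral_linComb [IsProbabilityMeasure P]
    (hM : IsStableRandomMeasure P m a M) (ha : 1 < a) {f g : E → ℝ} {X Y : Ω → ℝ}
    (hX : IsStableIntegral P m a M f X) (hY : IsStableIntegral P m a M g Y) (c₁ c₂ : ℝ) :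
    IsStableIntegral P m a M (fun x => c₁ * f x + c₂ * g x) (fun ω => c₁ * X ω + c₂ * Y ω) := by
  have hp1 : 1 ≤ ENNReal.ofReal a := by simpa using ENNReal.ofReal_le_ofReal ha.le
  obtain ⟨F, hF, hFl, hFae⟩ := hX.exists_seq_tendsto_ae
  obtain ⟨G, hG, hGl, hGae⟩ := hY.exists_seq_tendsto_ae
  refine hM.isStableIntegral_of_tendsto_ae ((hX.1.const_mul c₁).add (hY.1.const_mul c₂))
    ((hX.2.1.const_mul c₁).add (hY.2.1.const_mul c₂))
    (fun n => simpleLinComb c₁ c₂ (F n) (G n)) (fun n => finMeasSupp_simpleLinComb _ _ (hF n) (hG n))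
    ?_ ?_
  · have hb : ∀ n, eLpNorm (fun x => simpleLinComb c₁ c₂ (F n) (G n) x - (c₁ * f x + c₂ * g x))
        (ENNReal.ofReal a) m ≤ ‖c₁‖ₑ * eLpNorm (fun x => F n x - f x) (ENNReal.ofReal a) m +
          ‖c₂‖ₑ * eLpNorm (fun x => G n x - g x) (ENNReal.ofReal a) m := by
      intro n
      have e1 : (fun x => simpleLinComb c₁ c₂ (F n) (G n) x - (c₁ * f x + c₂ * g x)) =
          c₁ • (fun x => F n x - f x) + c₂ • (fun x => G n x - g x) := by
        funext x; simp; ring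
      rw [e1, ← eLpNorm_const_smul, ← eLpNorm_const_smul]
      exact eLpNorm_add_le
        (((F n).aestronglyMeasurable.sub hX.1.1).const_smul c₁)
        (((G n).aestronglyMeasurable.sub hY.1.1).const_smul c₂) hp1
    have hl : Tendsto (fun n => ‖c₁‖ₑ * eLpNorm (fun x => F n x - f x) (ENNReal.ofReal a) m +
          ‖c₂‖ₑ * eLpNorm (fun x => G n x - g x) (ENNReal.ofReal a) m) atTop (𝓝 0) := by
      simpa using (ENNReal.Tendsto.const_mul hFl (Or.inr enorm_ne_top)).add
        (ENNReal.Tendsto.const_mul hGl (Or.inr enorm_ne_top))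
    exact tendsto_of_tendsto_of_tendsto_of_le_of_le tendsto_const_nhds hl (fun _ => zero_le) hb
  · have hlin : ∀ᵐ ω ∂P, ∀ n, simpleIntegral M (simpleLinComb c₁ c₂ (F n) (G n)) ω =
        c₁ * simpleIntegral M (F n) ω + c₂ * simpleIntegral M (G n) ω :=
      ae_all_iff.2 fun n => hM.ae_simpleIntegral_linComb c₁ c₂ (hF n) (hG n)
    filter_upwards [hlin, hFae, hGae] with ω h1 h2 h3
    simp_rw [h1]
    exact (h2.const_mul c₁).add (h3.const_mul c₂)

theorem IsStableRandomMeasure.charFun_of_isStableIntegral [IsProbabilityMeasure P]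
    (hM : IsStableRandomMeasure P m a M) (ha : 1 < a) {f : E → ℝ} {X : Ω → ℝ}
    (hX : IsStableIntegral P m a M f X) (z : ℝ) :
    charFun (P.map X) z = Complex.exp (-∫ x, stableExponent a (z * f x) ∂m) := by
  have ha0 : 0 < a := by linarith
  have hp0 : ENNReal.ofReal a ≠ 0 := by simpa using ha0
  obtain ⟨F, hF, hFl, hFae⟩ := hX.exists_seq_tendsto_ae
  have hmem : ∀ n, MemLp (F n) (ENNReal.ofReal a) m := fun n =>
    (SimpleFunc.memLp_iff_finMeasSupp hp0 ENNReal.ofReal_ne_top).2 (hF n)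
  have h1 : Tendsto (fun n => charFun (P.map (simpleIntegral M (F n))) z) atTop
      (𝓝 (charFun (P.map X) z)) := by
    have e : ∀ {Y : Ω → ℝ}, Measurable Y →
        charFun (P.map Y) z = ∫ ω, Complex.exp (z * Y ω * Complex.I) ∂P := by
      intro Y hY
      rw [charFun_apply_real, integral_map hY.aemeasurable (by fun_prop)]
    rw [e hX.2.1]
    simp_rw [fun n => e (hM.measurable_simpleIntegral (hF n))]
    refine tendsto_integral_of_dominated_convergence (fun _ => 1) (fun n => ?_)
      (integrable_const _) (fun n => ae_of_all _ fun ω => ?_) ?_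
    · have := hM.measurable_simpleIntegral (hF n)
      exact Measurable.aestronglyMeasurable (by fun_prop)
    · rw [← Complex.ofReal_mul, Complex.norm_exp_ofReal_mul_I]
    · filter_upwards [hFae] with ω hω
      have hc : Continuous fun x : ℝ => Complex.exp (z * x * Complex.I) := by fun_prop
      exact (hc.tendsto _).comp hω
  have h2 : Tendsto (fun n => charFun (P.map (simpleIntegral M (F n))) z) atTop
      (𝓝 (Complex.exp (-∫ x, stableExponent a (z * f x) ∂m))) := by
    simp_rw [fun n => hM.charFun_simpleIntegral ha0 (hF n) z]
    refine (Complex.continuous_exp.tendsto _).comp (Tendsto.neg ?_)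
    refine tendsto_integral_stableExponent ha (fun n => (hmem n).const_mul z)
      (hX.1.const_mul z) ?_
    have e1 : ∀ n, eLpNorm (fun x => z * F n x - z * f x) (ENNReal.ofReal a) m =
        ‖z‖ₑ * eLpNorm (fun x => F n x - f x) (ENNReal.ofReal a) m := by
      intro n
      rw [← eLpNorm_const_smul]
      congr 1; funext x; simp; ring
    simp_rw [e1]
    simpa using ENNReal.Tendsto.const_mul hFl (Or.inr enorm_ne_top)
  exact tendsto_nhds_unique h1 h2

/-- The distinguished logarithm of the law of a stochastic integral at `1`. -/
theorem IsStableRandomMeasure.logE_eq [IsProbabilityMeasure P]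
    (hM : IsStableRandomMeasure P m a M) (ha : 1 < a) {f : E → ℝ} {X : Ω → ℝ}
    (hX : IsStableIntegral P m a M f X) :
    logE P X = -∫ x, stableExponent a (f x) ∂m := by
  have ha0 : 0 < a := by linarith
  have hlog : IsLogCharFun (P.map X) (fun z => -∫ x, stableExponent a (z * f x) ∂m) := by
    refine ⟨?_, by simp [stableExponent_zero ha0], hM.charFun_of_isStableIntegral ha hX⟩
    have e : ∀ z : ℝ, ∫ x, stableExponent a (z * f x) ∂m =
        ((max z 0 ^ a : ℝ) : ℂ) * ∫ x, stableExponent a (f x) ∂m +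
        ((max (-z) 0 ^ a : ℝ) : ℂ) * ∫ x, stableExponent a (-f x) ∂m := by
      intro z
      simp_rw [stableExponent_mul ha0 z]
      have hi : Integrable (fun x => stableExponent a (-f x)) m :=
        integrable_stableExponent ha0 hX.1.neg
      rw [integral_add ((integrable_stableExponent ha0 hX.1).const_mul _) (hi.const_mul _),
        integral_const_mul, integral_const_mul]
    simp_rw [e]
    have h1 : Continuous fun y : ℝ => max y 0 ^ a :=
      (continuous_id.max continuous_const).rpow_const fun _ => Or.inr ha0.le
    have h2 : Continuous fun y : ℝ => max (-y) 0 ^ a :=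
      (continuous_neg.max continuous_const).rpow_const fun _ => Or.inr ha0.le
    fun_prop
  rw [logE, hlog.logCharFun_eq]
  simp

/-- Every function in `L^a` has a stochastic integral: approximating simple functions can be
chosen so close to each other that their integrals converge almost surely, by the Borel–Cantelli
lemma. -/
theorem IsStableRandomMeasure.exists_isStableIntegral [IsProbabilityMeasure P]
    (hM : IsStableRandomMeasure P m a M) (ha : 1 < a) (ha2 : a ≤ 2) {f : E → ℝ}
    (hf : MemLp f (ENNReal.ofReal a) m) : ∃ X, IsStableIntegral P m a M f X := by
  have ha0 : 0 < a := by linarith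
  have hp0 : ENNReal.ofReal a ≠ 0 := by simpa using ha0
  have hp1 : 1 ≤ ENNReal.ofReal a := by simpa using ENNReal.ofReal_le_ofReal ha.le
  have hex : ∀ n : ℕ, ∃ g : SimpleFunc E ℝ,
      eLpNorm (f - ⇑g) (ENNReal.ofReal a) m < ENNReal.ofReal ((8:ℝ)⁻¹ ^ n) ∧
      MemLp g (ENNReal.ofReal a) m := fun n =>
    hf.exists_simpleFunc_eLpNorm_sub_lt ENNReal.ofReal_ne_top (by
      rw [Ne, ENNReal.ofReal_eq_zero, not_le]; positivity)
  choose F hFlt hFmem using hex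
  have hF : ∀ n, (F n).FinMeasSupp m := fun n =>
    (SimpleFunc.memLp_iff_finMeasSupp hp0 ENNReal.ofReal_ne_top).1 (hFmem n)
  have hFlt' : ∀ n, eLpNorm (fun x => F n x - f x) (ENNReal.ofReal a) m ≤
      ENNReal.ofReal ((8:ℝ)⁻¹ ^ n) := by
    intro n
    rw [← eLpNorm_neg]
    refine le_trans (le_of_eq ?_) (hFlt n).le
    congr 1; funext x; simp
  have hlim : Tendsto (fun n => eLpNorm (fun x => F n x - f x) (ENNReal.ofReal a) m) atTop
      (𝓝 0) := by
    refine tendsto_of_tendsto_of_tendsto_of_le_of_le tendsto_const_nhds ?_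
      (fun _ => zero_le) hFlt'
    simpa using ENNReal.tendsto_ofReal
      (tendsto_pow_atTop_nhds_zero_of_lt_one (r := (8:ℝ)⁻¹) (by norm_num) (by norm_num))
  let H : ℕ → SimpleFunc E ℝ := fun n => simpleLinComb 1 (-1) (F (n + 1)) (F n)
  have hH : ∀ n, (H n).FinMeasSupp m := fun n => finMeasSupp_simpleLinComb _ _ (hF _) (hF _)
  have hHmem : ∀ n, MemLp (H n) (ENNReal.ofReal a) m := fun n =>
    (SimpleFunc.memLp_iff_finMeasSupp hp0 ENNReal.ofReal_ne_top).2 (hH n)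
  have hHint : ∀ n, ∫ x, |H n x| ^ a ∂m ≤ (2 * (8:ℝ)⁻¹ ^ n) ^ a := by
    intro n
    have h1 : eLpNorm (H n) (ENNReal.ofReal a) m ≤ ENNReal.ofReal (2 * (8:ℝ)⁻¹ ^ n) := by
      have e1 : (⇑(H n) : E → ℝ) = (fun x => F (n + 1) x - f x) - fun x => F n x - f x := by
        funext x; simp [H]; ring
      rw [e1]
      refine (eLpNorm_sub_le ((F _).aestronglyMeasurable.sub hf.1)
        ((F _).aestronglyMeasurable.sub hf.1) hp1).trans ?_
      rw [two_mul, ENNReal.ofReal_add (by positivity) (by positivity)]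
      refine add_le_add ((hFlt' _).trans (ENNReal.ofReal_le_ofReal ?_)) (hFlt' n)
      exact pow_le_pow_of_le_one (by norm_num) (by norm_num) (Nat.le_succ n)
    rw [(hHmem n).eLpNorm_eq_integral_rpow_norm hp0 ENNReal.ofReal_ne_top,
      ENNReal.toReal_ofReal ha0.le, ENNReal.ofReal_le_ofReal_iff (by positivity)] at h1
    simp only [Real.norm_eq_abs] at h1
    have h0 : 0 ≤ ∫ x, |H n x| ^ a ∂m := integral_nonneg fun x => by positivity
    have h2 := Real.rpow_le_rpow (by positivity) h1 ha0.le
    rwa [← Real.rpow_mul h0, inv_mul_cancel₀ ha0.ne', Real.rpow_one] at h2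
  set K := 4 * (1 + |Real.tan (Real.pi / 2 * a)|) with hK
  have hK0 : 0 ≤ K := by positivity
  have htail : ∀ n : ℕ, P.real {ω | (2:ℝ)⁻¹ ^ n < |simpleIntegral M (H n) ω|} ≤
      K * 16 * (4:ℝ)⁻¹ ^ n := by
    intro n
    refine (hM.measureReal_simpleIntegral_gt_le ha0 (hH n) (by positivity)).trans ?_
    rw [← hK, mul_assoc K, mul_assoc K]
    refine mul_le_mul_of_nonneg_left ?_ hK0
    refine (mul_le_mul_of_nonneg_left (hHint n) (by positivity)).trans ?_
    rw [← Real.mul_rpow (by positivity) (by positivity)]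
    have e1 : 2 * ((2:ℝ)⁻¹ ^ n)⁻¹ * (2 * (8:ℝ)⁻¹ ^ n) = 4 * (4:ℝ)⁻¹ ^ n := by
      have : (8:ℝ)⁻¹ ^ n = (2:ℝ)⁻¹ ^ n * (4:ℝ)⁻¹ ^ n := by rw [← mul_pow]; norm_num
      rw [this]; field_simp; norm_num
    rw [e1, Real.mul_rpow (by positivity) (by positivity)]
    have e2 : (4:ℝ) ^ a ≤ 16 := by
      calc (4:ℝ) ^ a ≤ 4 ^ (2:ℝ) := Real.rpow_le_rpow_of_exponent_le (by norm_num) ha2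
        _ = 16 := by norm_num
    have e3 : ((4:ℝ)⁻¹ ^ n) ^ a ≤ (4:ℝ)⁻¹ ^ n := by
      have := Real.rpow_le_rpow_of_exponent_ge (x := (4:ℝ)⁻¹ ^ n) (by positivity)
        (pow_le_one₀ (by norm_num) (by norm_num)) ha.le
      rwa [Real.rpow_one] at this
    exact mul_le_mul e2 e3 (by positivity) (by norm_num)
  have hBC : ∀ᵐ ω ∂P, ∀ᶠ n in atTop, ω ∉ {ω | (2:ℝ)⁻¹ ^ n < |simpleIntegral M (H n) ω|} := by
    refine ae_eventually_notMem (ne_top_of_le_ne_top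
      (b := ∑' n : ℕ, ENNReal.ofReal (K * 16 * (4:ℝ)⁻¹ ^ n)) ?_
      (ENNReal.tsum_le_tsum fun n => ?_))
    · exact ((summable_geometric_of_lt_one (by norm_num) (by norm_num)).mul_left _).tsum_ofReal_ne_top
    · rw [← ofReal_measureReal]
      exact ENNReal.ofReal_le_ofReal (htail n)
  have hlin : ∀ᵐ ω ∂P, ∀ n, simpleIntegral M (H n) ω =
      1 * simpleIntegral M (F (n + 1)) ω + (-1) * simpleIntegral M (F n) ω :=
    ae_all_iff.2 fun n => hM.ae_simpleIntegral_linComb _ _ (hF _) (hF _)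
  have hconv : ∀ᵐ ω ∂P, ∃ l, Tendsto (fun n => simpleIntegral M (F n) ω) atTop (𝓝 l) := by
    filter_upwards [hBC, hlin] with ω h1 h2
    refine cauchySeq_tendsto_of_complete (cauchySeq_of_summable_dist ?_)
    refine Summable.of_norm_bounded_eventually_nat (g := fun n => (2:ℝ)⁻¹ ^ n)
      (summable_geometric_of_lt_one (by norm_num) (by norm_num)) ?_
    filter_upwards [h1] with n hn
    replace hn := not_lt.1 hn
    rw [h2 n] at hn
    rw [Real.norm_of_nonneg dist_nonneg, dist_comm, Real.dist_eq]
    convert! hn using 2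
    ring
  obtain ⟨X, hXm, hX⟩ := measurable_limit_of_tendsto_metrizable_ae
    (fun n => (hM.measurable_simpleIntegral (hF n)).aemeasurable) hconv
  exact ⟨X, hM.isStableIntegral_of_tendsto_ae hf hXm F hF hlim hX⟩

theorem IsStableRandomMeasure.isStableIntegral_stableIntegral [IsProbabilityMeasure P]
    (hM : IsStableRandomMeasure P m a M) (ha : 1 < a) (ha2 : a ≤ 2) {f : E → ℝ}
    (hf : MemLp f (ENNReal.ofReal a) m) :
    IsStableIntegral P m a M f (stableIntegral P m a M f) := by
  have h := hM.exists_isStableIntegral ha ha2 hf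
  rw [stableIntegral, dif_pos h]
  exact h.choose_spec

end StableIntegral

/-! ### Cosine transforms and functions of positive type -/

section CosTransform

variable {V : Type*} [NormedAddCommGroup V] [InnerProductSpace ℝ V] [FiniteDimensional ℝ V]
  [MeasurableSpace V] [BorelSpace V]

/-- The cosine transform `x ↦ ∫ cos⟨x, y⟩ g(y) dy` of a function on a Euclidean space. For even
`g` it is the Fourier transform, in the normalisation of characteristic functions. -/
noncomputable def cosTransform (g : V → ℝ) (x : V) : ℝ := ∫ y, Real.cos ⟪x, y⟫ * g y

theorem integrable_cos_mul {g : V → ℝ} (hg : Integrable g) (x : V) :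
    Integrable fun y => Real.cos ⟪x, y⟫ * g y := by
  refine hg.norm.mono' ?_ (ae_of_all _ fun y => ?_)
  · exact Continuous.aestronglyMeasurable (by fun_prop) |>.mul hg.1
  · rw [norm_mul]
    exact mul_le_of_le_one_left (norm_nonneg _) (Real.abs_cos_le_one _)

theorem continuous_cosTransform {g : V → ℝ} (hg : Integrable g) : Continuous (cosTransform g) := by
  refine continuous_of_dominated (bound := fun y => ‖g y‖)
    (fun x => (integrable_cos_mul hg x).1) (fun x => ae_of_all _ fun y => ?_) hg.norm
    (ae_of_all _ fun y => by fun_prop)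
  rw [norm_mul]
  exact mul_le_of_le_one_left (norm_nonneg _) (Real.abs_cos_le_one _)

theorem abs_cosTransform_le {g : V → ℝ} (hg : Integrable g) (x : V) :
    |cosTransform g x| ≤ ∫ y, |g y| := by
  rw [← Real.norm_eq_abs, cosTransform]
  refine norm_integral_le_of_norm_le hg.norm (ae_of_all _ fun y => ?_)
  rw [norm_mul]
  exact mul_le_of_le_one_left (norm_nonneg _) (Real.abs_cos_le_one _)

/-- The cosine transform of a product with a cosine transform is an average of shifted cosine
transforms, by `cos s cos t = (cos (s - t) + cos (s + t)) / 2`. -/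
theorem cosTransform_mul_cosTransform {g n : V → ℝ} (hg : Integrable g) (hn : Integrable n)
    (x : V) : cosTransform (fun θ => g θ * cosTransform n θ) x =
      ∫ y, n y * ((cosTransform g (x - y) + cosTransform g (x + y)) / 2) := by
  have hint : Integrable (Function.uncurry fun θ y : V =>
      Real.cos ⟪x, θ⟫ * Real.cos ⟪θ, y⟫ * (g θ * n y)) (volume.prod volume) := by
    have h1 : Integrable (fun p : V × V => g p.1 * n p.2) (volume.prod volume) := hg.mul_prod hn
    refine h1.norm.mono' ?_ (ae_of_all _ fun p => ?_)
    · exact (Continuous.aestronglyMeasurable (by fun_prop)).mul h1.1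
    · simp only [Function.uncurry]
      rw [norm_mul, norm_mul]
      refine mul_le_of_le_one_left (norm_nonneg _) ?_
      exact mul_le_one₀ (Real.abs_cos_le_one _) (norm_nonneg _) (Real.abs_cos_le_one _)
  calc cosTransform (fun θ => g θ * cosTransform n θ) x
      = ∫ θ, ∫ y, Real.cos ⟪x, θ⟫ * Real.cos ⟪θ, y⟫ * (g θ * n y) := by
        refine integral_congr_ae (ae_of_all _ fun θ => ?_)
        simp only [cosTransform]
        rw [← integral_const_mul, ← integral_const_mul]
        exact integral_congr_ae (ae_of_all _ fun y => by ring)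
    _ = ∫ y, ∫ θ, Real.cos ⟪x, θ⟫ * Real.cos ⟪θ, y⟫ * (g θ * n y) := integral_integral_swap hint
    _ = _ := by
        refine integral_congr_ae (ae_of_all _ fun y => ?_)
        simp only [cosTransform]
        rw [← integral_add (integrable_cos_mul hg _) (integrable_cos_mul hg _),
          ← integral_div, ← integral_const_mul]
        refine integral_congr_ae (ae_of_all _ fun θ => ?_)
        simp only [inner_sub_left, inner_add_left, Real.cos_sub, Real.cos_add,
          real_inner_comm θ y]
        ring

theorem integrable_exp_neg_mul_norm_sq {δ : ℝ} (hδ : 0 < δ) :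
    Integrable fun θ : V => Real.exp (-δ * ‖θ‖ ^ 2) := by
  have h := (GaussianFourier.integrable_cexp_neg_mul_sq_norm_add (V := V)
    (show 0 < (δ : ℂ).re from hδ) 0 0).norm
  refine h.congr (ae_of_all _ fun θ => ?_)
  simp only [Complex.norm_exp]
  congr 1
  simp [← Complex.ofReal_pow, ← Complex.ofReal_mul]

theorem cosTransform_gaussian {δ : ℝ} (hδ : 0 < δ) (x : V) :
    cosTransform (fun θ : V => Real.exp (-δ * ‖θ‖ ^ 2)) x =
      (Real.pi / δ) ^ (Module.finrank ℝ V / 2 : ℝ) * Real.exp (-‖x‖ ^ 2 / (4 * δ)) := by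
  have hb : 0 < (δ : ℂ).re := hδ
  have h := GaussianFourier.integral_cexp_neg_mul_sq_norm_add (V := V) hb Complex.I x
  have hi := GaussianFourier.integrable_cexp_neg_mul_sq_norm_add (V := V) hb Complex.I x
  have h1 := integral_re hi
  simp only [RCLike.re_eq_complex_re] at h1
  have e1 : ∀ θ : V, (Complex.exp (-(δ : ℂ) * (‖θ‖ : ℂ) ^ 2 + Complex.I * ((⟪x, θ⟫ : ℝ) : ℂ))).re =
      Real.cos ⟪x, θ⟫ * Real.exp (-δ * ‖θ‖ ^ 2) := by
    intro θ
    have e0 : -(δ : ℂ) * (‖θ‖ : ℂ) ^ 2 + Complex.I * ((⟪x, θ⟫ : ℝ) : ℂ) =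
        ((-δ * ‖θ‖ ^ 2 : ℝ) : ℂ) + ((⟪x, θ⟫ : ℝ) : ℂ) * Complex.I := by push_cast; ring
    rw [e0, Complex.exp_re]
    simp [mul_comm, -Complex.ofReal_mul, -Complex.ofReal_neg]
  have e2 : ((Real.pi : ℂ) / (δ : ℂ)) ^ ((Module.finrank ℝ V : ℂ) / 2) *
      Complex.exp (Complex.I ^ 2 * (‖x‖ : ℂ) ^ 2 / (4 * (δ : ℂ))) =
      (((Real.pi / δ) ^ (Module.finrank ℝ V / 2 : ℝ) * Real.exp (-‖x‖ ^ 2 / (4 * δ)) : ℝ) : ℂ) := by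
    rw [Complex.ofReal_mul, Complex.ofReal_cpow (by positivity), Complex.ofReal_exp]
    push_cast
    congr 3
    rw [Complex.I_sq]; ring
  unfold cosTransform
  simp_rw [← e1]
  rw [h1, h, e2, Complex.ofReal_re]

/-- A bounded measurable function `φ` is of positive type if its products with Gaussians have
nonnegative cosine transforms. This is a form of positive definiteness, for even functions, that
passes to bounded pointwise limits. -/
structure PosType (φ : V → ℝ) : Prop where
  measurable : Measurable φ
  bounded : ∃ C, ∀ θ, |φ θ| ≤ C
  nonneg : ∀ δ, 0 < δ → ∀ x, 0 ≤ cosTransform (fun θ => φ θ * Real.exp (-δ * ‖θ‖ ^ 2)) x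

namespace PosType

theorem integrable_mul_exp {φ : V → ℝ} (hφ : Measurable φ) {C : ℝ} (hC : ∀ θ, |φ θ| ≤ C)
    {δ : ℝ} (hδ : 0 < δ) : Integrable fun θ => φ θ * Real.exp (-δ * ‖θ‖ ^ 2) :=
  (integrable_exp_neg_mul_norm_sq hδ).bdd_mul hφ.aestronglyMeasurable (ae_of_all _ hC)

theorem one : PosType fun _ : V => (1 : ℝ) := by
  refine ⟨measurable_const, ⟨1, by simp⟩, fun δ hδ x => ?_⟩
  simp only [one_mul]
  rw [cosTransform_gaussian hδ]
  positivity

theorem zero : PosType fun _ : V => (0 : ℝ) :=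
  ⟨measurable_const, ⟨0, by simp⟩, fun δ hδ x => by simp [cosTransform]⟩

theorem add {φ ψ : V → ℝ} (hφ : PosType φ) (hψ : PosType ψ) : PosType fun θ => φ θ + ψ θ := by
  obtain ⟨C, hC⟩ := hφ.bounded
  obtain ⟨D, hD⟩ := hψ.bounded
  refine ⟨hφ.measurable.add hψ.measurable, ⟨C + D, fun θ => (abs_add_le _ _).trans
    (add_le_add (hC θ) (hD θ))⟩, fun δ hδ x => ?_⟩
  have h1 := hφ.nonneg δ hδ x
  have h2 := hψ.nonneg δ hδ x
  have : cosTransform (fun θ => (φ θ + ψ θ) * Real.exp (-δ * ‖θ‖ ^ 2)) x =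
      cosTransform (fun θ => φ θ * Real.exp (-δ * ‖θ‖ ^ 2)) x +
      cosTransform (fun θ => ψ θ * Real.exp (-δ * ‖θ‖ ^ 2)) x := by
    unfold cosTransform
    rw [← integral_add (integrable_cos_mul (integrable_mul_exp hφ.measurable hC hδ) x)
      (integrable_cos_mul (integrable_mul_exp hψ.measurable hD hδ) x)]
    exact integral_congr_ae (ae_of_all _ fun y => by ring)
  rw [this]; exact add_nonneg h1 h2

theorem mul_const {φ : V → ℝ} (hφ : PosType φ) {c : ℝ} (hc : 0 ≤ c) :
    PosType fun θ => φ θ * c := by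
  obtain ⟨C, hC⟩ := hφ.bounded
  refine ⟨hφ.measurable.mul_const c, ⟨C * c, fun θ => ?_⟩, fun δ hδ x => ?_⟩
  · rw [abs_mul, abs_of_nonneg hc]
    exact mul_le_mul_of_nonneg_right (hC θ) hc
  · have : cosTransform (fun θ => φ θ * c * Real.exp (-δ * ‖θ‖ ^ 2)) x =
        c * cosTransform (fun θ => φ θ * Real.exp (-δ * ‖θ‖ ^ 2)) x := by
      unfold cosTransform
      rw [← integral_const_mul]
      exact integral_congr_ae (ae_of_all _ fun y => by ring)
    rw [this]; exact mul_nonneg hc (hφ.nonneg δ hδ x)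

theorem mul_cosTransform {φ n : V → ℝ} (hφ : PosType φ) (hn : Integrable n) (hn0 : ∀ y, 0 ≤ n y) :
    PosType fun θ => φ θ * cosTransform n θ := by
  obtain ⟨C, hC⟩ := hφ.bounded
  refine ⟨hφ.measurable.mul (continuous_cosTransform hn).measurable, ⟨C * ∫ y, |n y|, fun θ => ?_⟩,
    fun δ hδ x => ?_⟩
  · rw [abs_mul]
    exact mul_le_mul (hC θ) (abs_cosTransform_le hn θ) (abs_nonneg _) ((abs_nonneg _).trans (hC θ))
  · have e : (fun θ => φ θ * cosTransform n θ * Real.exp (-δ * ‖θ‖ ^ 2)) =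
        fun θ => (φ θ * Real.exp (-δ * ‖θ‖ ^ 2)) * cosTransform n θ := by
      funext θ; ring
    rw [e, cosTransform_mul_cosTransform (integrable_mul_exp hφ.measurable hC hδ) hn]
    refine integral_nonneg fun y => mul_nonneg (hn0 y) ?_
    have h1 := hφ.nonneg δ hδ (x - y)
    have h2 := hφ.nonneg δ hδ (x + y)
    positivity

theorem of_tendsto {φ : ℕ → V → ℝ} {ψ : V → ℝ} (hφ : ∀ k, PosType (φ k)) {C : ℝ}
    (hC : ∀ k θ, |φ k θ| ≤ C) (hlim : ∀ θ, Tendsto (fun k => φ k θ) atTop (𝓝 (ψ θ))) :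
    PosType ψ := by
  have hm : Measurable ψ :=
    measurable_of_tendsto_metrizable (fun k => (hφ k).measurable) (tendsto_pi_nhds.2 hlim)
  refine ⟨hm, ⟨C, fun θ => le_of_tendsto (hlim θ).abs (Eventually.of_forall fun k => hC k θ)⟩,
    fun δ hδ x => ?_⟩
  refine ge_of_tendsto' (f := fun k => cosTransform (fun θ => φ k θ * Real.exp (-δ * ‖θ‖ ^ 2)) x)
    (x := atTop) ?_ (fun k => (hφ k).nonneg δ hδ x)
  refine tendsto_integral_of_dominated_convergence (fun θ => C * Real.exp (-δ * ‖θ‖ ^ 2))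
    (fun k => (integrable_cos_mul (integrable_mul_exp (hφ k).measurable (hC k) hδ) x).1)
    ((integrable_exp_neg_mul_norm_sq hδ).const_mul C) (fun k => ae_of_all _ fun θ => ?_)
    (ae_of_all _ fun θ => ((hlim θ).mul_const _).const_mul _)
  rw [norm_mul, norm_mul, Real.norm_of_nonneg (Real.exp_nonneg _)]
  refine (mul_le_of_le_one_left (by positivity) (Real.abs_cos_le_one _)).trans ?_
  exact mul_le_mul_of_nonneg_right (hC k θ) (Real.exp_nonneg _)

theorem cosTransform_nonneg {φ : V → ℝ} (hφ : PosType φ) (hi : Integrable φ) (x : V) :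
    0 ≤ cosTransform φ x := by
  refine ge_of_tendsto' (f := fun k : ℕ =>
      cosTransform (fun θ => φ θ * Real.exp (-(1 / ((k : ℝ) + 1)) * ‖θ‖ ^ 2)) x)
    (x := atTop) ?_ (fun k => hφ.nonneg _ (by positivity) x)
  have hexp : ∀ (k : ℕ) (θ : V), Real.exp (-(1 / ((k : ℝ) + 1)) * ‖θ‖ ^ 2) ≤ 1 := fun k θ =>
    Real.exp_le_one_iff.2 (by
      have : 0 ≤ 1 / ((k : ℝ) + 1) * ‖θ‖ ^ 2 := by positivity
      linarith)
  refine tendsto_integral_of_dominated_convergence (fun θ => ‖φ θ‖) (fun k => ?_) hi.norm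
    (fun k => ae_of_all _ fun θ => ?_) (ae_of_all _ fun θ => ?_)
  · exact (Continuous.aestronglyMeasurable (by fun_prop)).mul
      (hi.1.mul (Continuous.aestronglyMeasurable (by fun_prop)))
  · rw [norm_mul, norm_mul, Real.norm_of_nonneg (Real.exp_nonneg _)]
    refine (mul_le_of_le_one_left (by positivity) (Real.abs_cos_le_one _)).trans ?_
    exact mul_le_of_le_one_right (norm_nonneg _) (hexp k θ)
  · have h1 : Tendsto (fun k : ℕ => Real.exp (-(1 / ((k : ℝ) + 1)) * ‖θ‖ ^ 2)) atTop (𝓝 1) := by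
      have h2 := (tendsto_one_div_add_atTop_nhds_zero_nat (𝕜 := ℝ)).neg.mul_const (‖θ‖ ^ 2)
      rw [neg_zero, zero_mul] at h2
      simpa [Function.comp_def] using (Real.continuous_exp.tendsto _).comp h2
    have h3 := (h1.const_mul (φ θ)).const_mul (Real.cos ⟪x, θ⟫)
    rwa [mul_one] at h3

theorem mul_cosTransform_pow {φ n : V → ℝ} (hφ : PosType φ) (hn : Integrable n)
    (hn0 : ∀ y, 0 ≤ n y) (k : ℕ) : PosType fun θ => φ θ * cosTransform n θ ^ k := by
  induction k with
  | zero => simpa using hφ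
  | succ k ih =>
    have := ih.mul_cosTransform hn hn0
    simpa only [pow_succ, mul_assoc] using this

/-- The series of `exp`, with its linear term removed, preserves positive type. -/
theorem mul_exp_cosTransform_sub {φ n : V → ℝ} (hφ : PosType φ) (hn : Integrable n)
    (hn0 : ∀ y, 0 ≤ n y) :
    PosType fun θ => φ θ * (Real.exp (cosTransform n θ) - cosTransform n θ) := by
  obtain ⟨C, hC⟩ := hφ.bounded
  have hC0 : 0 ≤ C := (abs_nonneg _).trans (hC 0)
  set L := ∫ y, |n y| with hL
  have hexp : ∀ t : ℝ, HasSum (fun k : ℕ => t ^ k / (k.factorial : ℝ)) (Real.exp t) := by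
    intro t
    rw [Real.exp_eq_exp_ℝ]
    exact NormedSpace.expSeries_div_hasSum_exp t
  have hsum : ∀ N : ℕ, PosType fun θ =>
      φ θ * ∑ k ∈ (Finset.range N).erase 1, cosTransform n θ ^ k / (k.factorial : ℝ) := by
    intro N
    induction (Finset.range N).erase 1 using Finset.induction_on with
    | empty => simpa using zero
    | insert k s hk ih =>
      have h1 := ((hφ.mul_cosTransform_pow hn hn0 k).mul_const
        (c := ((k.factorial : ℝ))⁻¹) (by positivity)).add ih
      refine (congrArg PosType ?_).mp h1
      funext θ
      rw [Finset.sum_insert hk]; ring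
  refine of_tendsto (C := C * Real.exp L) hsum (fun N θ => ?_) (fun θ => ?_)
  · rw [abs_mul]
    refine mul_le_mul (hC θ) ?_ (abs_nonneg _) hC0
    calc |∑ k ∈ (Finset.range N).erase 1, cosTransform n θ ^ k / (k.factorial : ℝ)|
        ≤ ∑ k ∈ (Finset.range N).erase 1, |cosTransform n θ ^ k / (k.factorial : ℝ)| :=
          Finset.abs_sum_le_sum_abs _ _
      _ ≤ ∑ k ∈ (Finset.range N).erase 1, L ^ k / (k.factorial : ℝ) := by
          refine Finset.sum_le_sum fun k _ => ?_
          rw [abs_div, abs_pow, Nat.abs_cast]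
          gcongr
          exact abs_cosTransform_le hn θ
      _ ≤ Real.exp L := by
          have hL0 : 0 ≤ L := integral_nonneg fun y => abs_nonneg _
          exact sum_le_hasSum _ (fun k _ => by positivity) (hexp L)
  · refine Tendsto.const_mul _ ?_
    refine (((hexp (cosTransform n θ)).tendsto_sum_nat).sub_const (cosTransform n θ)).congr' ?_
    filter_upwards [eventually_ge_atTop 2] with N hN
    have h1 : 1 ∈ Finset.range N := Finset.mem_range.2 (by omega)
    rw [← Finset.sum_erase_add _ _ h1]
    simp

theorem mul_exp_cosTransform {φ n : V → ℝ} (hφ : PosType φ) (hn : Integrable n)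
    (hn0 : ∀ y, 0 ≤ n y) : PosType fun θ => φ θ * Real.exp (cosTransform n θ) := by
  have h := (hφ.mul_exp_cosTransform_sub hn hn0).add (hφ.mul_cosTransform hn hn0)
  refine (congrArg PosType ?_).mp h
  funext θ; ring

end PosType

end CosTransform

/-! ### The Lévy–Khintchine representation of `‖θ‖ ^ α` -/

section LevyKhintchine

variable {V : Type*} [NormedAddCommGroup V] [InnerProductSpace ℝ V] [FiniteDimensional ℝ V]
  [MeasurableSpace V] [BorelSpace V] [Nontrivial V]

variable (V) in
theorem integrable_min_mul_norm_rpow {η κ : ℝ} (hη : 0 < η) (hκ : η < κ) :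
    Integrable fun y : V => min 1 (‖y‖ ^ κ) * ‖y‖ ^ (-(Module.finrank ℝ V + η)) := by
  have hD : 1 ≤ Module.finrank ℝ V := Module.finrank_pos
  rw [integrable_fun_norm_addHaar volume
    (f := fun r : ℝ => min 1 (r ^ κ) * r ^ (-(Module.finrank ℝ V + η)))]
  have hpow : ∀ r : ℝ, 0 < r → r ^ (Module.finrank ℝ V - 1) = r ^ ((Module.finrank ℝ V : ℝ) - 1) := by
    intro r hr
    rw [← Real.rpow_natCast, Nat.cast_sub hD, Nat.cast_one]
  have hmeas : Measurable fun r : ℝ => r ^ (Module.finrank ℝ V - 1) •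
      (min 1 (r ^ κ) * r ^ (-(Module.finrank ℝ V + η))) := by fun_prop
  rw [← Set.Ioc_union_Ioi_eq_Ioi zero_le_one]
  refine IntegrableOn.union ?_ ?_
  · have h1 : IntegrableOn (fun r : ℝ => r ^ (κ - η - 1)) (Set.Ioc 0 1) :=
      (intervalIntegrable_iff_integrableOn_Ioc_of_le zero_le_one).1
        (intervalIntegral.intervalIntegrable_rpow' (by linarith))
    refine h1.mono' hmeas.aestronglyMeasurable ?_
    refine (ae_restrict_iff' measurableSet_Ioc).2 (ae_of_all _ fun r hr => ?_)
    have hr0 : 0 < r := hr.1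
    rw [smul_eq_mul, Real.norm_of_nonneg (by positivity), hpow r hr0]
    calc r ^ ((Module.finrank ℝ V : ℝ) - 1) * (min 1 (r ^ κ) * r ^ (-(Module.finrank ℝ V + η)))
        ≤ r ^ ((Module.finrank ℝ V : ℝ) - 1) * (r ^ κ * r ^ (-(Module.finrank ℝ V + η))) := by
          gcongr; exact min_le_right _ _
      _ = _ := by
          rw [← Real.rpow_add hr0, ← Real.rpow_add hr0]; congr 1; ring
  · refine (integrableOn_Ioi_rpow_of_lt (show -1 - η < -1 by linarith) zero_lt_one).mono'
      hmeas.aestronglyMeasurable ?_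
    refine (ae_restrict_iff' measurableSet_Ioi).2 (ae_of_all _ fun r hr => ?_)
    have hr0 : 0 < r := zero_lt_one.trans hr
    rw [smul_eq_mul, Real.norm_of_nonneg (by positivity), hpow r hr0]
    calc r ^ ((Module.finrank ℝ V : ℝ) - 1) * (min 1 (r ^ κ) * r ^ (-(Module.finrank ℝ V + η)))
        ≤ r ^ ((Module.finrank ℝ V : ℝ) - 1) * (1 * r ^ (-(Module.finrank ℝ V + η))) := by
          gcongr; exact min_le_left _ _
      _ = _ := by
          rw [one_mul, ← Real.rpow_add hr0]; congr 1; ring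

omit [FiniteDimensional ℝ V] [MeasurableSpace V] [BorelSpace V] [Nontrivial V] in
theorem one_sub_cos_inner_le (θ y : V) :
    1 - Real.cos ⟪θ, y⟫ ≤ (2 + ‖θ‖ ^ 2) * min 1 (‖y‖ ^ (2 : ℝ)) := by
  rw [Real.rpow_two]
  have h1 := Real.one_sub_sq_div_two_le_cos (x := ⟪θ, y⟫)
  have h2 := Real.neg_one_le_cos ⟪θ, y⟫
  have h3 : ⟪θ, y⟫ ^ 2 ≤ ‖θ‖ ^ 2 * ‖y‖ ^ 2 := by
    rw [← mul_pow, ← sq_abs]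
    exact pow_le_pow_left₀ (abs_nonneg _) (abs_real_inner_le_norm θ y) 2
  have h4 : 0 ≤ ‖θ‖ ^ 2 := sq_nonneg _
  have h5 : 0 ≤ ‖y‖ ^ 2 := sq_nonneg _
  rcases le_total 1 (‖y‖ ^ 2) with h | h
  · rw [min_eq_left h]; linarith
  · rw [min_eq_right h]; nlinarith

theorem integrable_one_sub_cos_mul {η : ℝ} (hη : 0 < η) (hη2 : η < 2) (θ : V) :
    Integrable fun y : V => (1 - Real.cos ⟪θ, y⟫) * ‖y‖ ^ (-(Module.finrank ℝ V + η)) := by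
  refine ((integrable_min_mul_norm_rpow V hη hη2).const_mul (2 + ‖θ‖ ^ 2)).mono'
    (Measurable.aestronglyMeasurable (by fun_prop)) (ae_of_all _ fun y => ?_)
  have h0 : 0 ≤ 1 - Real.cos ⟪θ, y⟫ := by linarith [Real.cos_le_one ⟪θ, y⟫]
  rw [Real.norm_of_nonneg (by positivity), ← mul_assoc]
  exact mul_le_mul_of_nonneg_right (one_sub_cos_inner_le θ y) (by positivity)

/-- The Lévy–Khintchine formula for `‖θ‖ ^ η`, from homogeneity and invariance under
reflections. -/
theorem exists_integral_one_sub_cos_eq {η : ℝ} (hη : 0 < η) (hη2 : η < 2) :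
    ∃ C : ℝ, 0 < C ∧ ∀ θ : V,
      ∫ y : V, (1 - Real.cos ⟪θ, y⟫) * ‖y‖ ^ (-(Module.finrank ℝ V + η)) = C * ‖θ‖ ^ η := by
  obtain ⟨e, he⟩ := exists_norm_eq V (zero_le_one (α := ℝ))
  set p : ℝ := -(Module.finrank ℝ V + η) with hp
  refine ⟨∫ y : V, (1 - Real.cos ⟪e, y⟫) * ‖y‖ ^ p, ?_, fun θ => ?_⟩
  · have h0 : ∀ y : V, 0 ≤ (1 - Real.cos ⟪e, y⟫) * ‖y‖ ^ p := fun y => by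
      have h0 : 0 ≤ 1 - Real.cos ⟪e, y⟫ := by linarith [Real.cos_le_one ⟪e, y⟫]
      positivity
    rw [integral_pos_iff_support_of_nonneg h0 (integrable_one_sub_cos_mul hη hη2 e)]
    refine (Metric.measure_ball_pos volume e (show (0:ℝ) < 1 / 2 by norm_num)).trans_le
      (measure_mono fun y hy => ?_)
    rw [Metric.mem_ball, dist_eq_norm] at hy
    have h1 : |⟪e, y⟫ - 1| < 1 / 2 := by
      have : ⟪e, y⟫ - 1 = ⟪e, y - e⟫ := by
        rw [inner_sub_right, real_inner_self_eq_norm_sq, he]; norm_num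
      rw [this]
      refine (abs_real_inner_le_norm _ _).trans_lt ?_
      rw [he, one_mul]; exact hy
    rw [abs_lt] at h1
    have hy0 : y ≠ 0 := by
      rintro rfl
      simp at h1; norm_num at h1
    have hc : Real.cos ⟪e, y⟫ ≠ 1 := by
      rw [Ne, Real.cos_eq_one_iff_of_lt_of_lt (by linarith [Real.pi_gt_three])
        (by linarith [Real.pi_gt_three])]
      linarith
    have hyp : ‖y‖ ^ p ≠ 0 := (Real.rpow_pos_of_pos (norm_pos_iff.2 hy0) _).ne'
    exact mul_ne_zero (sub_ne_zero.2 hc.symm) hyp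
  · rcases eq_or_ne θ 0 with rfl | hθ
    · simp [Real.zero_rpow hη.ne']
    have hr : 0 < ‖θ‖ := norm_pos_iff.2 hθ
    set u : V := ‖θ‖⁻¹ • θ with hu
    have hun : ‖u‖ = 1 := by rw [hu, norm_smul, norm_inv, norm_norm, inv_mul_cancel₀ hr.ne']
    have hθu : θ = ‖θ‖ • u := by rw [hu, smul_smul, mul_inv_cancel₀ hr.ne', one_smul]
    -- rotate `u` to `e`
    have hrot : ∫ y : V, (1 - Real.cos ⟪u, y⟫) * ‖y‖ ^ p =
        ∫ y : V, (1 - Real.cos ⟪e, y⟫) * ‖y‖ ^ p := by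
      have hR := Submodule.reflection_sub (hun.trans he.symm)
      set R := (ℝ ∙ (u - e))ᗮ.reflection with hRdef
      have h1 := R.measurePreserving.integral_comp R.toHomeomorph.measurableEmbedding
        (fun y : V => (1 - Real.cos ⟪e, y⟫) * ‖y‖ ^ p)
      rw [← h1]
      refine integral_congr_ae (ae_of_all _ fun y => ?_)
      simp only [R.norm_map]
      conv_rhs => rw [← hR, R.inner_map_map]
    -- scale by `‖θ‖`
    have hscale := Measure.integral_comp_smul (volume : Measure V)
      (fun y : V => (1 - Real.cos ⟪u, y⟫) * ‖y‖ ^ p) ‖θ‖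
    have h2 : ∀ y : V, (1 - Real.cos ⟪u, ‖θ‖ • y⟫) * ‖‖θ‖ • y‖ ^ p =
        ‖θ‖ ^ p * ((1 - Real.cos ⟪θ, y⟫) * ‖y‖ ^ p) := by
      intro y
      rw [norm_smul, norm_norm, Real.mul_rpow hr.le (norm_nonneg _), inner_smul_right]
      conv_rhs => rw [hθu, inner_smul_left]
      simp only [norm_smul, norm_norm, hun, mul_one, conj_trivial]
      ring
    simp_rw [h2] at hscale
    rw [integral_const_mul, hrot, smul_eq_mul, abs_of_pos (by positivity)] at hscale
    have h3 : ‖θ‖ ^ p = (‖θ‖ ^ Module.finrank ℝ V)⁻¹ * (‖θ‖ ^ η)⁻¹ := by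
      rw [hp, neg_add, Real.rpow_add hr, Real.rpow_neg hr.le, Real.rpow_neg hr.le,
        Real.rpow_natCast]
    rw [h3, mul_assoc] at hscale
    have h4 := mul_left_cancel₀ (by positivity) hscale
    rw [inv_mul_eq_iff_eq_mul₀ (by positivity)] at h4
    rw [h4, mul_comm]

/-- Splitting of the stable exponent `‖θ‖ ^ α`, `α < 2`, into the part `ψ` of the jumps of size at
most `1` and the compound Poisson part with jump intensity `n`. Both `exp (-ψ)` and the exponential
of the cosine transform of `n` are of positive type. -/
theorem exists_stable_decomposition {α : ℝ} (hα : 0 < α) (hα2 : α < 2) :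
    ∃ (ψ n : V → ℝ) (c : ℝ), 0 < c ∧ Integrable n ∧ (∀ y, 0 ≤ n y) ∧
      (∀ y, 1 < ‖y‖ → n y = c * ‖y‖ ^ (-(Module.finrank ℝ V + α))) ∧
      PosType (fun θ => Real.exp (-ψ θ)) ∧
      ∀ θ, ‖θ‖ ^ α = ψ θ + (∫ y, n y) - cosTransform n θ := by
  obtain ⟨C, hC, hform⟩ := exists_integral_one_sub_cos_eq (V := V) hα hα2
  set p : ℝ := -(Module.finrank ℝ V + α) with hp
  let ν : V → ℝ := fun y => C⁻¹ * ‖y‖ ^ p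
  have hν0 : ∀ y, 0 ≤ ν y := fun y => by positivity
  have hνm : Measurable ν := by fun_prop
  -- restrictions of `ν` to sets that avoid a neighbourhood of `0` are integrable
  have hint : ∀ (S : Set V), MeasurableSet S → ∀ ε : ℝ, 0 < ε → ε ≤ 1 → (∀ y ∈ S, ε < ‖y‖) →
      Integrable (S.indicator ν) := by
    intro S hS ε hε hε1 hSε
    refine ((integrable_min_mul_norm_rpow V hα hα2).const_mul (C⁻¹ * (ε ^ 2)⁻¹)).mono'
      (hνm.indicator hS).aestronglyMeasurable (ae_of_all _ fun y => ?_)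
    rw [Real.norm_of_nonneg (Set.indicator_nonneg (fun y _ => hν0 y) y)]
    by_cases hy : y ∈ S
    · rw [Set.indicator_of_mem hy]
      have h1 : ε ^ 2 ≤ min 1 (‖y‖ ^ (2:ℝ)) := by
        rw [Real.rpow_two]
        exact le_min (pow_le_one₀ hε.le hε1) (pow_le_pow_left₀ hε.le (hSε y hy).le 2)
      have h2 : 1 ≤ (ε ^ 2)⁻¹ * min 1 (‖y‖ ^ (2:ℝ)) := by
        rw [inv_mul_eq_div, one_le_div (by positivity)]; exact h1
      calc ν y = C⁻¹ * ‖y‖ ^ p * 1 := by simp [ν]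
        _ ≤ C⁻¹ * ‖y‖ ^ p * ((ε ^ 2)⁻¹ * min 1 (‖y‖ ^ (2:ℝ))) := by gcongr
        _ = _ := by rw [hp]; ring
    · rw [Set.indicator_of_notMem hy]; positivity
  have hone : ∀ (θ y : V), 0 ≤ 1 - Real.cos ⟪θ, y⟫ := fun θ y => by
    linarith [Real.cos_le_one ⟪θ, y⟫]
  have hsub : ∀ (n : V → ℝ), Integrable n → ∀ θ,
      ∫ y, (1 - Real.cos ⟪θ, y⟫) * n y = (∫ y, n y) - cosTransform n θ := by
    intro n hn θ
    rw [cosTransform, ← integral_sub hn (integrable_cos_mul hn θ)]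
    exact integral_congr_ae (ae_of_all _ fun y => by ring)
  have hfull : ∀ θ : V, Integrable fun y => (1 - Real.cos ⟪θ, y⟫) * ν y := fun θ => by
    refine ((integrable_one_sub_cos_mul hα hα2 θ).const_mul C⁻¹).congr (ae_of_all _ fun y => ?_)
    simp only [ν, hp]; ring
  let B : Set V := {y | 1 < ‖y‖}
  have hB : MeasurableSet B := measurableSet_lt measurable_const measurable_norm
  have hBint := hint B hB 1 one_pos le_rfl fun y hy => hy
  let A : ℕ → Set V := fun k => {y | 1 / ((k : ℝ) + 1) < ‖y‖ ∧ ‖y‖ ≤ 1}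
  have hA : ∀ k, MeasurableSet (A k) := fun k =>
    (measurableSet_lt measurable_const measurable_norm).inter
      (measurableSet_le measurable_norm measurable_const)
  have hAint : ∀ k, Integrable ((A k).indicator ν) := fun k =>
    hint (A k) (hA k) (1 / ((k : ℝ) + 1)) (by positivity)
      ((div_le_one (by positivity)).2 (by simp)) fun y hy => hy.1
  refine ⟨fun θ => ∫ y, (1 - Real.cos ⟪θ, y⟫) * Bᶜ.indicator ν y, B.indicator ν, C⁻¹,
    inv_pos.2 hC, hBint, fun y => Set.indicator_nonneg (fun y _ => hν0 y) y,
    fun y hy => Set.indicator_of_mem (s := B) hy ν, ?_, fun θ => ?_⟩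
  · refine PosType.of_tendsto (C := 1) (φ := fun k θ =>
      Real.exp (-∫ y, (1 - Real.cos ⟪θ, y⟫) * (A k).indicator ν y)) (fun k => ?_) (fun k θ => ?_)
      (fun θ => ?_)
    · have h1 := (PosType.one.mul_exp_cosTransform (hAint k)
        fun y => Set.indicator_nonneg (fun y _ => hν0 y) y).mul_const
        (c := Real.exp (-∫ y, (A k).indicator ν y)) (Real.exp_nonneg _)
      refine (congrArg PosType ?_).mp h1
      funext θ
      rw [hsub _ (hAint k), one_mul, ← Real.exp_add]
      congr 1; ring
    · rw [abs_of_nonneg (Real.exp_nonneg _)]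
      exact Real.exp_le_one_iff.2 (neg_nonpos.2 (integral_nonneg fun y =>
        mul_nonneg (hone θ y) (Set.indicator_nonneg (fun y _ => hν0 y) y)))
    · refine (Real.continuous_exp.tendsto _).comp (Tendsto.neg ?_)
      refine tendsto_integral_of_dominated_convergence (fun y => (1 - Real.cos ⟪θ, y⟫) * ν y)
        (fun k => (Measurable.aestronglyMeasurable (by
          have := hνm.indicator (hA k)
          fun_prop))) (hfull θ) (fun k => ae_of_all _ fun y => ?_) (ae_of_all _ fun y => ?_)
      · rw [Real.norm_of_nonneg (mul_nonneg (hone θ y)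
          (Set.indicator_nonneg (fun y _ => hν0 y) y))]
        exact mul_le_mul_of_nonneg_left (Set.indicator_le_self' (fun y _ => hν0 y) y) (hone θ y)
      · rcases eq_or_ne y 0 with rfl | hy
        · simp
        refine Tendsto.const_mul _ (tendsto_const_nhds.congr' ?_)
        have hlt := (tendsto_one_div_add_atTop_nhds_zero_nat (𝕜 := ℝ)).eventually
          (gt_mem_nhds (norm_pos_iff.2 hy))
        filter_upwards [hlt] with k hk
        by_cases hy1 : ‖y‖ ≤ 1
        · rw [Set.indicator_of_mem (show y ∈ Bᶜ from not_lt.2 hy1),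
            Set.indicator_of_mem (show y ∈ A k from ⟨hk, hy1⟩)]
        · rw [Set.indicator_of_notMem (show y ∉ Bᶜ from fun h => h (not_le.1 hy1)),
            Set.indicator_of_notMem (show y ∉ A k from fun h => hy1 h.2)]
  · have h1 : ∫ y, (1 - Real.cos ⟪θ, y⟫) * ν y = ‖θ‖ ^ α := by
      have : ∀ y, (1 - Real.cos ⟪θ, y⟫) * ν y = C⁻¹ * ((1 - Real.cos ⟪θ, y⟫) * ‖y‖ ^ p) := fun y => by
        simp only [ν]; ring
      simp_rw [this]
      rw [integral_const_mul, hform, ← mul_assoc, inv_mul_cancel₀ hC.ne', one_mul]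
    have hBi : Integrable fun y => (1 - Real.cos ⟪θ, y⟫) * B.indicator ν y :=
      ((hfull θ).indicator hB).congr (ae_of_all _ fun y => by
        by_cases hy : y ∈ B <;> simp [hy])
    have hBci : Integrable fun y => (1 - Real.cos ⟪θ, y⟫) * Bᶜ.indicator ν y :=
      ((hfull θ).indicator hB.compl).congr (ae_of_all _ fun y => by
        by_cases hy : y ∈ B <;> simp [hy])
    rw [add_sub_assoc, ← hsub _ hBint, ← integral_add hBci hBi, ← h1]
    refine integral_congr_ae (ae_of_all _ fun y => ?_)
    by_cases hy : y ∈ B <;> simp [hy]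

end LevyKhintchine

/-! ### Stable densities: positivity, moments and tails -/

theorem abs_exp_neg_norm_rpow_le {V : Type*} [NormedAddCommGroup V] {α : ℝ} (θ : V) :
    |Real.exp (-‖θ‖ ^ α)| ≤ 1 := by
  rw [abs_of_nonneg (Real.exp_nonneg _)]
  exact Real.exp_le_one_iff.2 (by have : 0 ≤ ‖θ‖ ^ α := by positivity
                                  linarith)

section StableTransform

variable {V : Type*} [NormedAddCommGroup V] [InnerProductSpace ℝ V] [FiniteDimensional ℝ V]
  [MeasurableSpace V] [BorelSpace V]

theorem cosTransform_add {f g : V → ℝ} (hf : Integrable f) (hg : Integrable g) (x : V) :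
    cosTransform f x + cosTransform g x = cosTransform (fun y => f y + g y) x := by
  unfold cosTransform
  rw [← integral_add (integrable_cos_mul hf x) (integrable_cos_mul hg x)]
  exact integral_congr_ae (ae_of_all _ fun y => by ring)

theorem const_mul_cosTransform (c : ℝ) (g : V → ℝ) (x : V) :
    c * cosTransform g x = cosTransform (fun y => c * g y) x := by
  unfold cosTransform
  rw [← integral_const_mul]
  exact integral_congr_ae (ae_of_all _ fun y => by ring)

theorem integral_mul_cosTransform {f g : V → ℝ} (hf : Integrable f) (hg : Integrable g) :
    ∫ x, f x * cosTransform g x = ∫ y, g y * cosTransform f y := by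
  have h := cosTransform_mul_cosTransform hf hg 0
  have hneg : ∀ y, cosTransform f (-y) = cosTransform f y := fun y => by simp [cosTransform]
  simpa [cosTransform, hneg] using h

/-- A nonnegative cosine transform of a bounded integrable function is integrable. -/
theorem integrable_cosTransform {g : V → ℝ} (hg : Integrable g) (hg1 : ∀ θ, |g θ| ≤ 1)
    (h0 : ∀ x, 0 ≤ cosTransform g x) : Integrable (cosTransform g) := by
  have hm : Measurable (cosTransform g) := (continuous_cosTransform hg).measurable
  let e : ℕ → V → ℝ := fun k x => Real.exp (-(1 / ((k : ℝ) + 1)) * ‖x‖ ^ 2)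
  set D : ℝ := Module.finrank ℝ V / 2 with hD
  have hbound : ∀ k, ∫ x, e k x * cosTransform g x ≤ (2 * Real.pi) ^ Module.finrank ℝ V := by
    intro k
    set ε : ℝ := 1 / ((k : ℝ) + 1) with hε
    have hε0 : 0 < ε := by positivity
    have hε4 : 0 < 1 / (4 * ε) := by positivity
    have hei : Integrable (e k) := integrable_exp_neg_mul_norm_sq hε0
    have hgauss : ∀ y : V, cosTransform (e k) y =
        (Real.pi / ε) ^ D * Real.exp (-(1 / (4 * ε)) * ‖y‖ ^ 2) := by
      intro y
      rw [show cosTransform (e k) y = _ from cosTransform_gaussian hε0 y]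
      congr 2; ring
    rw [integral_mul_cosTransform hei hg]
    simp_rw [hgauss]
    calc ∫ y, g y * ((Real.pi / ε) ^ D * Real.exp (-(1 / (4 * ε)) * ‖y‖ ^ 2))
        ≤ ∫ y : V, (Real.pi / ε) ^ D * Real.exp (-(1 / (4 * ε)) * ‖y‖ ^ 2) := by
          have hi : Integrable fun y : V =>
              (Real.pi / ε) ^ D * Real.exp (-(1 / (4 * ε)) * ‖y‖ ^ 2) :=
            (integrable_exp_neg_mul_norm_sq hε4).const_mul _
          refine integral_mono (hi.bdd_mul (c := 1) hg.1 (ae_of_all _ hg1)) hi fun y => ?_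
          exact mul_le_of_le_one_left (by positivity) ((le_abs_self _).trans (hg1 y))
      _ = (Real.pi / ε) ^ D * (Real.pi / (1 / (4 * ε))) ^ D := by
          rw [integral_const_mul, GaussianFourier.integral_rexp_neg_mul_sq_norm hε4]
      _ = (2 * Real.pi) ^ Module.finrank ℝ V := by
          rw [← Real.mul_rpow (by positivity) (by positivity)]
          have : Real.pi / ε * (Real.pi / (1 / (4 * ε))) = (2 * Real.pi) ^ (2 : ℝ) := by
            rw [Real.rpow_two]; field_simp; ring
          rw [this, ← Real.rpow_mul (by positivity), hD, mul_div_cancel₀ _ two_ne_zero,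
            Real.rpow_natCast]
  refine ⟨hm.aestronglyMeasurable, ?_⟩
  rw [hasFiniteIntegral_iff_ofReal (ae_of_all _ h0)]
  have hlim : ∀ x, Tendsto (fun k => ENNReal.ofReal (e k x * cosTransform g x)) atTop
      (𝓝 (ENNReal.ofReal (cosTransform g x))) := by
    intro x
    refine ENNReal.tendsto_ofReal ?_
    have h2 := (tendsto_one_div_add_atTop_nhds_zero_nat (𝕜 := ℝ)).neg.mul_const (‖x‖ ^ 2)
    rw [neg_zero, zero_mul] at h2
    have h3 := ((Real.continuous_exp.tendsto _).comp h2).mul_const (cosTransform g x)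
    simpa [Function.comp_def, e] using h3
  calc ∫⁻ x, ENNReal.ofReal (cosTransform g x)
      = ∫⁻ x, liminf (fun k => ENNReal.ofReal (e k x * cosTransform g x)) atTop :=
        lintegral_congr fun x => (hlim x).liminf_eq.symm
    _ ≤ liminf (fun k => ∫⁻ x, ENNReal.ofReal (e k x * cosTransform g x)) atTop :=
        lintegral_liminf_le fun k => by
          have : Measurable (e k) := by fun_prop
          fun_prop
    _ ≤ ENNReal.ofReal ((2 * Real.pi) ^ Module.finrank ℝ V) := by
        refine liminf_le_of_le (by isBoundedDefault) fun b hb => ?_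
        obtain ⟨k, hk⟩ := hb.exists
        refine hk.trans ?_
        rw [← ofReal_integral_eq_lintegral_ofReal]
        · exact ENNReal.ofReal_le_ofReal (hbound k)
        · have hei : Integrable (e k) := integrable_exp_neg_mul_norm_sq (by positivity)
          exact hei.mul_bdd (c := ∫ y, |g y|) hm.aestronglyMeasurable
            (ae_of_all _ (abs_cosTransform_le hg))
        · exact ae_of_all _ fun x => mul_nonneg (Real.exp_nonneg _) (h0 x)
    _ < ∞ := ENNReal.ofReal_lt_top

open scoped FourierTransform in
/-- Fourier inversion for the cosine transform of an even function. -/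
theorem cosTransform_cosTransform {g : V → ℝ} (hg : Integrable g) (hc : Continuous g)
    (heven : ∀ θ, g (-θ) = g θ) (hi : Integrable (cosTransform g)) (θ : V) :
    cosTransform (cosTransform g) θ = (2 * Real.pi) ^ Module.finrank ℝ V * g θ := by
  set D := Module.finrank ℝ V with hD
  have hpi : 0 < 2 * Real.pi := by positivity
  have hpD : 0 < (2 * Real.pi) ^ D := by positivity
  let f : V → ℂ := fun v => ((g ((2 * Real.pi) • v) : ℝ) : ℂ)
  have hfi : Integrable f := (hg.comp_smul hpi.ne').ofReal
  have hfc : Continuous f := by fun_prop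
  have hF : ∀ w, 𝓕 f w = ((((2 * Real.pi) ^ D)⁻¹ * cosTransform g w : ℝ) : ℂ) := by
    intro w
    rw [Real.fourier_eq']
    have h1 := Measure.integral_comp_smul (volume : Measure V)
      (fun v => Complex.exp (((-⟪v, w⟫ : ℝ) : ℂ) * Complex.I) • ((g v : ℝ) : ℂ)) (2 * Real.pi)
    rw [abs_of_pos (by positivity), ← hD] at h1
    have h2 : ∀ v : V, Complex.exp (((-2 * Real.pi * ⟪v, w⟫ : ℝ) : ℂ) * Complex.I) • f v =
        Complex.exp (((-⟪(2 * Real.pi) • v, w⟫ : ℝ) : ℂ) * Complex.I) •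
          ((g ((2 * Real.pi) • v) : ℝ) : ℂ) := by
      intro v
      rw [inner_smul_left]; simp only [f, conj_trivial]
      congr 4; ring
    simp_rw [h2]
    rw [h1, Complex.real_smul, Complex.ofReal_mul]
    congr 1
    -- the sine part vanishes because `g` is even
    have hcos := integrable_cos_mul hg w
    have hsin : Integrable fun v => Real.sin ⟪w, v⟫ * g v := by
      refine hg.norm.mono' ?_ (ae_of_all _ fun y => ?_)
      · exact (Continuous.aestronglyMeasurable (by fun_prop)).mul hg.1
      · rw [norm_mul]
        exact mul_le_of_le_one_left (norm_nonneg _) (Real.abs_sin_le_one _)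
    have hodd : ∫ v, Real.sin ⟪w, v⟫ * g v = 0 := by
      have h := integral_neg_eq_self (fun v => Real.sin ⟪w, v⟫ * g v) volume
      simp only [inner_neg_right, Real.sin_neg, heven, neg_mul] at h
      rw [integral_neg] at h
      linarith
    have h3 : ∀ v : V, Complex.exp (((-⟪v, w⟫ : ℝ) : ℂ) * Complex.I) • ((g v : ℝ) : ℂ) =
        ((Real.cos ⟪w, v⟫ * g v : ℝ) : ℂ) - ((Real.sin ⟪w, v⟫ * g v : ℝ) : ℂ) * Complex.I := by
      intro v
      rw [Complex.exp_mul_I, ← Complex.ofReal_cos, ← Complex.ofReal_sin, Real.cos_neg, Real.sin_neg,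
        real_inner_comm, smul_eq_mul]
      push_cast; ring
    simp_rw [h3]
    rw [integral_sub hcos.ofReal (hsin.ofReal.mul_const _), integral_mul_const,
      integral_complex_ofReal, integral_complex_ofReal, hodd]
    simp [cosTransform]
  have hFi : Integrable (𝓕 f) := by
    rw [funext hF]
    exact (hi.const_mul _).ofReal
  have hinv := congrFun (hfc.fourierInv_fourier_eq hfi hFi) ((2 * Real.pi)⁻¹ • θ)
  rw [Real.fourierInv_eq'] at hinv
  have h4 : ∀ v : V, Complex.exp (((2 * Real.pi * ⟪v, (2 * Real.pi)⁻¹ • θ⟫ : ℝ) : ℂ) * Complex.I) •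
      𝓕 f v = Complex.exp (((⟪v, θ⟫ : ℝ) : ℂ) * Complex.I) *
        ((((2 * Real.pi) ^ D)⁻¹ * cosTransform g v : ℝ) : ℂ) := by
    intro v
    rw [hF, smul_eq_mul, inner_smul_right, mul_inv_cancel_left₀ hpi.ne']
  simp_rw [h4] at hinv
  have hre := congrArg Complex.re hinv
  have hci : Integrable fun v => Complex.exp (((⟪v, θ⟫ : ℝ) : ℂ) * Complex.I) *
        ((((2 * Real.pi) ^ D)⁻¹ * cosTransform g v : ℝ) : ℂ) := by
    refine (hi.const_mul ((2 * Real.pi) ^ D)⁻¹).ofReal.bdd_mul (c := 1)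
      (Continuous.aestronglyMeasurable (by fun_prop)) (ae_of_all _ fun v => ?_)
    rw [Complex.norm_exp_ofReal_mul_I]
  have h5 := integral_re hci
  simp only [RCLike.re_eq_complex_re, Complex.re_mul_ofReal, Complex.exp_ofReal_mul_I_re] at h5
  rw [← h5] at hre
  simp only [f, Complex.ofReal_re, smul_inv_smul₀ hpi.ne'] at hre
  rw [← hre, ← integral_const_mul]
  refine integral_congr_ae (ae_of_all _ fun v => ?_)
  simp only [real_inner_comm θ v]
  field_simp

/-- The cosine transform of `exp (-‖θ‖ ^ α)`, which is `(2π)^dim` times the density at time `1` of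
the symmetric `α`-stable process. -/
noncomputable def stableTransform (α : ℝ) : V → ℝ :=
  cosTransform fun θ : V => Real.exp (-‖θ‖ ^ α)

theorem stableTransform_two (x : V) :
    stableTransform 2 x = Real.pi ^ (Module.finrank ℝ V / 2 : ℝ) * Real.exp (-(1 / 4) * ‖x‖ ^ 2) := by
  have h := cosTransform_gaussian (V := V) one_pos x
  have e : (fun θ : V => Real.exp (-‖θ‖ ^ (2:ℝ))) = fun θ : V => Real.exp (-1 * ‖θ‖ ^ 2) := by
    funext θ; rw [Real.rpow_two]; ring_nf
  rw [stableTransform, e, h, div_one]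
  congr 2; ring

variable [Nontrivial V]

theorem integrable_norm_rpow_mul_exp_neg {s b p : ℝ} (hs : 0 ≤ s) (hp : 0 < p) (hb : 0 < b) :
    Integrable fun θ : V => ‖θ‖ ^ s * Real.exp (-b * ‖θ‖ ^ p) := by
  have hD : 1 ≤ Module.finrank ℝ V := Module.finrank_pos
  rw [integrable_fun_norm_addHaar volume (f := fun r : ℝ => r ^ s * Real.exp (-b * r ^ p))]
  have hs' : -1 < (Module.finrank ℝ V : ℝ) - 1 + s := by
    have : (1 : ℝ) ≤ Module.finrank ℝ V := by exact_mod_cast hD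
    linarith
  refine (integrableOn_rpow_mul_exp_neg_mul_rpow hs' hp hb).congr_fun (fun r hr => ?_)
    measurableSet_Ioi
  have hr0 : 0 < r := hr
  simp only [smul_eq_mul]
  rw [Real.rpow_add hr0, ← Real.rpow_natCast, Nat.cast_sub hD, Nat.cast_one, mul_assoc]

theorem integrable_exp_neg_norm_rpow {α : ℝ} (hα : 0 < α) :
    Integrable fun θ : V => Real.exp (-‖θ‖ ^ α) := by
  simpa using integrable_norm_rpow_mul_exp_neg (V := V) (s := 0) (b := 1) le_rfl hα one_pos

theorem continuous_stableTransform {α : ℝ} (hα : 0 < α) :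
    Continuous (stableTransform α : V → ℝ) :=
  continuous_cosTransform (integrable_exp_neg_norm_rpow hα)

theorem stableTransform_le {α : ℝ} (hα : 0 < α) (x : V) :
    stableTransform α x ≤ stableTransform α (0 : V) := by
  have h := (le_abs_self _).trans (abs_cosTransform_le (integrable_exp_neg_norm_rpow (V := V) hα) x)
  simpa [stableTransform, cosTransform] using h

theorem stableTransform_zero_pos {α : ℝ} (hα : 0 < α) : 0 < stableTransform α (0 : V) := by
  have hi := integrable_exp_neg_norm_rpow (V := V) hα
  have : stableTransform α (0 : V) = ∫ θ : V, Real.exp (-‖θ‖ ^ α) := by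
    simp [stableTransform, cosTransform]
  rw [this]
  exact integral_exp_pos hi

theorem stableTransform_nonneg {α : ℝ} (hα : 0 < α) (hα2 : α ≤ 2) (x : V) :
    0 ≤ stableTransform α x := by
  rcases hα2.eq_or_lt with rfl | hα2
  · rw [stableTransform_two]; positivity
  obtain ⟨ψ, n, c, -, hn, hn0, -, hψ, hdec⟩ := exists_stable_decomposition (V := V) hα hα2
  have h1 := (hψ.mul_exp_cosTransform hn hn0).mul_const
    (c := Real.exp (-∫ y, n y)) (Real.exp_nonneg _)
  have e : (fun θ : V => Real.exp (-‖θ‖ ^ α)) = fun θ =>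
      Real.exp (-ψ θ) * Real.exp (cosTransform n θ) * Real.exp (-∫ y, n y) := by
    funext θ
    rw [hdec, ← Real.exp_add, ← Real.exp_add]
    congr 1; ring
  have hi := integrable_exp_neg_norm_rpow (V := V) hα
  rw [stableTransform]
  rw [e] at hi ⊢
  exact h1.cosTransform_nonneg hi x

theorem integrable_stableTransform {α : ℝ} (hα : 0 < α) (hα2 : α ≤ 2) :
    Integrable (stableTransform α : V → ℝ) :=
  integrable_cosTransform (integrable_exp_neg_norm_rpow hα) abs_exp_neg_norm_rpow_le
    (stableTransform_nonneg hα hα2)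

/-- Moments of order `η < α` of stable densities; for the Gaussian density, of all orders. For
`α < 2` the Lévy–Khintchine formula expresses `‖x‖ ^ η` as an average of `1 - cos⟨θ, x⟩`, whose
integral against the density is `1 - exp (-‖θ‖ ^ α)`. -/
theorem integrable_stableTransform_mul_norm_rpow {α η : ℝ} (hα : 0 < α) (hα2 : α ≤ 2) (hη : 0 < η)
    (h : α = 2 ∨ η < α) : Integrable fun x : V => stableTransform α x * ‖x‖ ^ η := by
  rcases hα2.eq_or_lt with rfl | hα2'
  · refine ((integrable_norm_rpow_mul_exp_neg (V := V) (s := η) (b := 1 / 4) (p := 2) hη.le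
      two_pos (by norm_num)).const_mul (Real.pi ^ (Module.finrank ℝ V / 2 : ℝ))).congr
      (ae_of_all _ fun x => ?_)
    simp only [stableTransform_two, Real.rpow_two]
    ring
  have hηα : η < α := h.resolve_left hα2'.ne
  obtain ⟨C, hC, hform⟩ := exists_integral_one_sub_cos_eq (V := V) hη (hηα.trans hα2')
  set p : ℝ := -(Module.finrank ℝ V + η) with hp
  have hG := integrable_stableTransform (V := V) hα hα2
  have hGm := (continuous_stableTransform (V := V) hα).measurable
  have hG0 := stableTransform_nonneg (V := V) hα hα2
  let F : V × V → ℝ := fun q => stableTransform α q.2 * (1 - Real.cos ⟪q.1, q.2⟫) * ‖q.1‖ ^ p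
  have hFm : Measurable F := by
    have h1 : Measurable fun q : V × V => stableTransform α q.2 := hGm.comp measurable_snd
    have h2 : Measurable fun q : V × V => 1 - Real.cos ⟪q.1, q.2⟫ :=
      Continuous.measurable (by fun_prop)
    exact (h1.mul h2).mul (by fun_prop)
  have hone : ∀ (θ y : V), 0 ≤ 1 - Real.cos ⟪θ, y⟫ := fun θ y => by
    linarith [Real.cos_le_one ⟪θ, y⟫]
  have hF0 : ∀ q, 0 ≤ F q := fun q =>
    mul_nonneg (mul_nonneg (hG0 _) (hone _ _)) (by positivity)
  have hGc : ∀ θ : V, Integrable fun x => stableTransform α x * (1 - Real.cos ⟪θ, x⟫) := fun θ =>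
    (hG.sub (integrable_cos_mul hG θ)).congr (ae_of_all _ fun x => by
      simp only [Pi.sub_apply]; ring)
  have hGint : ∀ θ : V, ∫ x, stableTransform α x * (1 - Real.cos ⟪θ, x⟫) =
      (2 * Real.pi) ^ Module.finrank ℝ V * (1 - Real.exp (-‖θ‖ ^ α)) := by
    intro θ
    have hinv := cosTransform_cosTransform (integrable_exp_neg_norm_rpow (V := V) hα)
      (by have : Continuous fun θ : V => ‖θ‖ ^ α :=
            continuous_norm.rpow_const fun _ => Or.inr hα.le
          fun_prop)
      (fun θ => by rw [norm_neg]) hG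
    have e1 : ∀ x, stableTransform α x * (1 - Real.cos ⟪θ, x⟫) =
        Real.cos ⟪(0 : V), x⟫ * stableTransform α x - Real.cos ⟪θ, x⟫ * stableTransform α x := by
      intro x; simp; ring
    simp_rw [e1]
    rw [integral_sub (integrable_cos_mul hG 0) (integrable_cos_mul hG θ)]
    have h1 := hinv 0
    have h2 := hinv θ
    unfold cosTransform at h1 h2
    simp only [stableTransform] at *
    unfold cosTransform
    rw [h1, h2, norm_zero, Real.zero_rpow hα.ne']
    simp; ring
  have hFint : Integrable F (volume.prod volume) := by
    rw [integrable_prod_iff hFm.aestronglyMeasurable]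
    refine ⟨ae_of_all _ fun θ => (hGc θ).mul_const (‖θ‖ ^ p), ?_⟩
    have e : ∀ θ : V, ∫ x, ‖F (θ, x)‖ =
        (2 * Real.pi) ^ Module.finrank ℝ V * (1 - Real.exp (-‖θ‖ ^ α)) * ‖θ‖ ^ p := by
      intro θ
      simp_rw [Real.norm_of_nonneg (hF0 _)]
      simp only [F]
      rw [integral_mul_const, hGint]
    simp_rw [e]
    refine ((integrable_min_mul_norm_rpow V hη hηα).const_mul
      ((2 * Real.pi) ^ Module.finrank ℝ V)).mono' (Measurable.aestronglyMeasurable (by fun_prop))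
      (ae_of_all _ fun θ => ?_)
    have h1 : 0 ≤ 1 - Real.exp (-‖θ‖ ^ α) := by
      have := (le_abs_self _).trans (abs_exp_neg_norm_rpow_le (α := α) θ)
      linarith
    rw [Real.norm_of_nonneg (by positivity), mul_assoc]
    refine mul_le_mul_of_nonneg_left (mul_le_mul_of_nonneg_right ?_ (by positivity)) (by positivity)
    refine le_min (by linarith [Real.exp_nonneg (-‖θ‖ ^ α)]) ?_
    linarith [Real.add_one_le_exp (-‖θ‖ ^ α)]
  have h2 := hFint.integral_prod_right
  refine (h2.const_mul C⁻¹).congr (ae_of_all _ fun x => ?_)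
  simp only [F]
  have e2 : ∀ θ : V, stableTransform α x * (1 - Real.cos ⟪θ, x⟫) * ‖θ‖ ^ p =
      stableTransform α x * ((1 - Real.cos ⟪x, θ⟫) * ‖θ‖ ^ p) := by
    intro θ; rw [real_inner_comm]; ring
  simp_rw [e2]
  rw [integral_const_mul, hform]
  field_simp

/-- Lower bound for the tails of stable densities with `α < 2`: the compound Poisson part
contributes at least the intensity of a single large jump. -/
theorem exists_le_stableTransform {α : ℝ} (hα : 0 < α) (hα2 : α < 2) :
    ∃ c : ℝ, 0 < c ∧ ∀ x : V, 2 ≤ ‖x‖ →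
      c * ‖x‖ ^ (-(Module.finrank ℝ V + α)) ≤ stableTransform α x := by
  obtain ⟨ψ, n, c, hc, hn, hn0, hnc, hψ, hdec⟩ := exists_stable_decomposition (V := V) hα hα2
  set p : ℝ := -(Module.finrank ℝ V + α) with hp
  have hp0 : p ≤ 0 := by rw [hp]; have : (0:ℝ) ≤ Module.finrank ℝ V := by positivity
                         linarith
  set L := ∫ y, n y with hL
  let g : V → ℝ := fun θ => Real.exp (-ψ θ)
  have hφ := integrable_exp_neg_norm_rpow (V := V) hα
  have hnm : Measurable (cosTransform n) := (continuous_cosTransform hn).measurable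
  have hge : ∀ θ, g θ = Real.exp (L - cosTransform n θ) * Real.exp (-‖θ‖ ^ α) := by
    intro θ
    rw [← Real.exp_add, hdec]
    simp only [g]
    congr 1; ring
  have hN : ∀ θ, |cosTransform n θ| ≤ L := fun θ =>
    (abs_cosTransform_le hn θ).trans (le_of_eq (integral_congr_ae (ae_of_all _ fun y =>
      abs_of_nonneg (hn0 y))))
  have hgi : Integrable g := by
    rw [funext hge]
    refine hφ.bdd_mul (c := Real.exp (2 * L)) (Measurable.aestronglyMeasurable (by fun_prop))
      (ae_of_all _ fun θ => ?_)
    rw [Real.norm_of_nonneg (Real.exp_nonneg _)]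
    exact Real.exp_le_exp.2 (by linarith [(abs_le.1 (hN θ)).1])
  have hg0 : ∀ x, 0 ≤ cosTransform g x := hψ.cosTransform_nonneg hgi
  have hgc := continuous_cosTransform hgi
  have hg00 : 0 < cosTransform g 0 := by
    have : cosTransform g 0 = ∫ θ, g θ := by simp [cosTransform]
    rw [this]
    exact integral_exp_pos hgi
  -- the transform of `g` is bounded below near the origin
  obtain ⟨ρ, hρ, hρg⟩ := Metric.eventually_nhds_iff_ball.1
    (hgc.continuousAt.eventually (lt_mem_nhds (half_lt_self hg00)))
  set r := min ρ 1 with hr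
  have hr0 : 0 < r := lt_min hρ one_pos
  set q := cosTransform g 0 / 2 with hq
  have hq0 : 0 < q := half_pos hg00
  -- discard all terms of the exponential series except the linear one
  have hmain : ∀ x, Real.exp (-L) * ∫ y, n y * ((cosTransform g (x - y) + cosTransform g (x + y)) / 2)
      ≤ stableTransform α x := by
    intro x
    have hi1 : Integrable fun θ => g θ * cosTransform n θ :=
      hgi.mul_bdd (c := L) hnm.aestronglyMeasurable (ae_of_all _ hN)
    have hi2 : Integrable fun θ => g θ * (Real.exp (cosTransform n θ) - cosTransform n θ) := by
      refine hgi.mul_bdd (c := Real.exp L + L) (Measurable.aestronglyMeasurable (by fun_prop))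
        (ae_of_all _ fun θ => (norm_sub_le _ _).trans (add_le_add ?_ (hN θ)))
      rw [Real.norm_of_nonneg (Real.exp_nonneg _)]
      exact Real.exp_le_exp.2 ((le_abs_self _).trans (hN θ))
    have h2 := (hψ.mul_exp_cosTransform_sub hn hn0).cosTransform_nonneg hi2 x
    rw [← cosTransform_mul_cosTransform hgi hn]
    have e : stableTransform α x = Real.exp (-L) * (cosTransform (fun θ => g θ * cosTransform n θ) x +
        cosTransform (fun θ => g θ * (Real.exp (cosTransform n θ) - cosTransform n θ)) x) := by
      rw [cosTransform_add hi1 hi2, const_mul_cosTransform, stableTransform]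
      congr 1
      funext θ
      have : Real.exp (-‖θ‖ ^ α) = Real.exp (-L) * (g θ * Real.exp (cosTransform n θ)) := by
        rw [← Real.exp_add, ← Real.exp_add, hdec]; congr 1; ring
      rw [this]; ring
    rw [e]
    exact mul_le_mul_of_nonneg_left (le_add_of_nonneg_right h2) (Real.exp_nonneg _)
  set v := volume.real (Metric.ball (0 : V) r) with hv
  have hv0 : 0 < v := by
    refine ENNReal.toReal_pos (Metric.measure_ball_pos volume _ hr0).ne' ?_
    exact measure_ball_lt_top.ne
  refine ⟨Real.exp (-L) * (c * 2 ^ p * (q / 2) * v), by positivity, fun x hx => ?_⟩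
  refine le_trans (le_trans (le_of_eq ?_) (mul_le_mul_of_nonneg_left
    (b := c * ‖x‖ ^ p * 2 ^ p * (q / 2) * v) ?_ (Real.exp_nonneg (-L)))) (hmain x)
  · ring
  have hvx : volume.real (Metric.ball x r) = v := by
    rw [hv, measureReal_def, measureReal_def, Measure.addHaar_ball_center]
  have hci : Integrable fun y => n y * ((cosTransform g (x - y) + cosTransform g (x + y)) / 2) := by
    have hm1 : Measurable fun y => (cosTransform g (x - y) + cosTransform g (x + y)) / 2 :=
      Continuous.measurable (by fun_prop)
    refine hn.mul_bdd (c := ∫ y, |g y|) hm1.aestronglyMeasurable (ae_of_all _ fun y => ?_)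
    have h1 := abs_cosTransform_le hgi (x - y)
    have h2 := abs_cosTransform_le hgi (x + y)
    rw [Real.norm_eq_abs, abs_div, abs_two]
    have h3 := abs_add_le (cosTransform g (x - y)) (cosTransform g (x + y))
    linarith
  have hnn : ∀ y, 0 ≤ n y * ((cosTransform g (x - y) + cosTransform g (x + y)) / 2) := fun y => by
    have := hn0 y
    have := hg0 (x - y)
    have := hg0 (x + y)
    positivity
  calc c * ‖x‖ ^ p * 2 ^ p * (q / 2) * v
      = ∫ _ in Metric.ball x r, c * ‖x‖ ^ p * 2 ^ p * (q / 2) := by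
        rw [setIntegral_const, hvx, smul_eq_mul, mul_comm]
    _ ≤ ∫ y in Metric.ball x r, n y * ((cosTransform g (x - y) + cosTransform g (x + y)) / 2) := by
        refine setIntegral_mono_on (integrableOn_const measure_ball_lt_top.ne) hci.integrableOn
          measurableSet_ball fun y hy => ?_
        rw [Metric.mem_ball, dist_eq_norm] at hy
        have hy1 : ‖y - x‖ < 1 := hy.trans_le (min_le_right _ _)
        have hyl : 1 < ‖y‖ := by
          have := norm_sub_norm_le x y
          rw [norm_sub_rev] at hy1
          linarith
        have hyu : ‖y‖ ≤ ‖x‖ * 2 := by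
          have := norm_sub_norm_le y x
          linarith
        have hgq : q ≤ cosTransform g (x - y) := by
          refine (hρg (x - y) ?_).le
          rw [Metric.mem_ball, dist_zero_right, norm_sub_rev]
          exact hy.trans_le (min_le_left _ _)
        have h1 : ‖x‖ ^ p * 2 ^ p ≤ ‖y‖ ^ p := by
          rw [← Real.mul_rpow (norm_nonneg _) two_pos.le]
          exact Real.rpow_le_rpow_of_nonpos (by linarith) hyu hp0
        rw [hnc y hyl, mul_assoc c]
        have h2 := hg0 (x + y)
        have h3 : q / 2 ≤ (cosTransform g (x - y) + cosTransform g (x + y)) / 2 := by linarith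
        exact mul_le_mul (mul_le_mul_of_nonneg_left h1 hc.le) h3 (by positivity) (by positivity)
    _ ≤ _ := setIntegral_le_integral hci (ae_of_all _ hnn)

end StableTransform

/-! ### The transition density -/

section Density

variable {d : ℕ} {α : ℝ}

theorem measurable_stableDensity (d : ℕ) {α : ℝ} (hα : 0 < α) :
    Measurable fun q : ℝ × EuclideanSpace ℝ (Fin d) => stableDensity d α q.1 q.2 := by
  have h : Continuous fun q : (ℝ × EuclideanSpace ℝ (Fin d)) × EuclideanSpace ℝ (Fin d) =>
      Real.cos ⟪q.1.2, q.2⟫ * Real.exp (-q.1.1 * ‖q.2‖ ^ α) := by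
    have : Continuous fun q : (ℝ × EuclideanSpace ℝ (Fin d)) × EuclideanSpace ℝ (Fin d) =>
        ‖q.2‖ ^ α := continuous_snd.norm.rpow_const fun _ => Or.inr hα.le
    fun_prop
  exact (h.stronglyMeasurable.integral_prod_right (ν := volume)).measurable.const_mul _

theorem measurable_stableDensity_left (hα : 0 < α) (x : EuclideanSpace ℝ (Fin d)) :
    Measurable fun w => stableDensity d α w x :=
  Measurable.of_uncurry_right (f := fun w x => stableDensity d α w x) (measurable_stableDensity d hα)

/-- Self-similarity of the stable densities. -/
theorem stableDensity_eq (hα : 0 < α) {t : ℝ} (ht : 0 < t) (x : EuclideanSpace ℝ (Fin d)) :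
    stableDensity d α t x = ((2 * Real.pi) ^ d)⁻¹ * t ^ (-(d / α)) *
      stableTransform α ((t ^ (1 / α))⁻¹ • x) := by
  set R : ℝ := t ^ (1 / α) with hR
  have hR0 : 0 < R := by positivity
  have h := Measure.integral_comp_smul (volume : Measure (EuclideanSpace ℝ (Fin d)))
    (fun θ => Real.cos ⟪R⁻¹ • x, θ⟫ * Real.exp (-‖θ‖ ^ α)) R
  have e : ∀ θ : EuclideanSpace ℝ (Fin d),
      Real.cos ⟪R⁻¹ • x, R • θ⟫ * Real.exp (-‖R • θ‖ ^ α) =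
      Real.cos ⟪x, θ⟫ * Real.exp (-t * ‖θ‖ ^ α) := by
    intro θ
    rw [inner_smul_left, inner_smul_right, norm_smul, Real.norm_of_nonneg hR0.le,
      Real.mul_rpow hR0.le (norm_nonneg _), hR, ← Real.rpow_mul ht.le, one_div_mul_cancel hα.ne',
      Real.rpow_one, ← hR]
    simp only [conj_trivial]
    rw [inv_mul_cancel_left₀ hR0.ne', neg_mul]
  simp_rw [e] at h
  have hRd : |(R ^ Module.finrank ℝ (EuclideanSpace ℝ (Fin d)))⁻¹| = t ^ (-(d / α)) := by
    rw [abs_of_pos (by positivity), finrank_euclideanSpace_fin, Real.rpow_neg ht.le, hR,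
      ← Real.rpow_natCast, ← Real.rpow_mul ht.le]
    congr 2; ring
  rw [stableDensity, h, hRd, smul_eq_mul, mul_assoc]
  rfl

variable [Nonempty (Fin d)]

theorem stableDensity_nonneg (hα : 0 < α) (hα2 : α ≤ 2) {t : ℝ} (ht : 0 < t)
    (x : EuclideanSpace ℝ (Fin d)) : 0 ≤ stableDensity d α t x := by
  rw [stableDensity_eq hα ht]
  have := stableTransform_nonneg hα hα2 ((t ^ (1 / α))⁻¹ • x)
  positivity

variable (d) in
theorem exists_stableDensity_le (hα : 0 < α) :
    ∃ C : ℝ, 0 < C ∧ ∀ t : ℝ, 0 < t → ∀ x, stableDensity d α t x ≤ C * t ^ (-(d / α)) := by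
  have h0 := stableTransform_zero_pos (V := EuclideanSpace ℝ (Fin d)) hα
  refine ⟨((2 * Real.pi) ^ d)⁻¹ * stableTransform α (0 : EuclideanSpace ℝ (Fin d)),
    by positivity, fun t ht x => ?_⟩
  rw [stableDensity_eq hα ht, mul_right_comm]
  have := stableTransform_le hα ((t ^ (1 / α))⁻¹ • x)
  gcongr

variable (d) in
theorem exists_le_stableDensity_of_norm_le (hα : 0 < α) :
    ∃ ε c : ℝ, 0 < ε ∧ 0 < c ∧ ∀ t : ℝ, 0 < t → ∀ x : EuclideanSpace ℝ (Fin d),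
      ‖x‖ ≤ ε * t ^ (1 / α) → c * t ^ (-(d / α)) ≤ stableDensity d α t x := by
  have h0 := stableTransform_zero_pos (V := EuclideanSpace ℝ (Fin d)) hα
  obtain ⟨ρ, hρ, hρg⟩ := Metric.eventually_nhds_iff_ball.1
    ((continuous_stableTransform (V := EuclideanSpace ℝ (Fin d)) hα).continuousAt.eventually
      (lt_mem_nhds (half_lt_self h0)))
  refine ⟨ρ / 2, ((2 * Real.pi) ^ d)⁻¹ * (stableTransform α (0 : EuclideanSpace ℝ (Fin d)) / 2),
    by positivity, by positivity, fun t ht x hx => ?_⟩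
  rw [stableDensity_eq hα ht, mul_right_comm]
  have hR : 0 < t ^ (1 / α) := by positivity
  have := (hρg ((t ^ (1 / α))⁻¹ • x) (by
    rw [Metric.mem_ball, dist_zero_right, norm_smul, norm_inv, Real.norm_of_nonneg hR.le,
      inv_mul_lt_iff₀ hR]
    nlinarith)).le
  gcongr

variable (d) in
theorem exists_le_stableDensity_of_le_norm (hα : 0 < α) (hα2 : α < 2) :
    ∃ c : ℝ, 0 < c ∧ ∀ t : ℝ, 0 < t → ∀ x : EuclideanSpace ℝ (Fin d),
      2 * t ^ (1 / α) ≤ ‖x‖ → c * t * ‖x‖ ^ (-(d + α)) ≤ stableDensity d α t x := by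
  obtain ⟨c, hc, h⟩ := exists_le_stableTransform (V := EuclideanSpace ℝ (Fin d)) hα hα2
  refine ⟨((2 * Real.pi) ^ d)⁻¹ * c, by positivity, fun t ht x hx => ?_⟩
  have hR : 0 < t ^ (1 / α) := by positivity
  have hn : ‖(t ^ (1 / α))⁻¹ • x‖ = (t ^ (1 / α))⁻¹ * ‖x‖ := by
    rw [norm_smul, norm_inv, Real.norm_of_nonneg hR.le]
  have h1 := h ((t ^ (1 / α))⁻¹ • x) (by
    rw [hn, inv_mul_eq_div, le_div_iff₀ hR]; exact hx)
  rw [finrank_euclideanSpace_fin, hn, Real.mul_rpow (by positivity) (norm_nonneg _),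
    Real.inv_rpow hR.le, Real.rpow_neg hR.le, inv_inv, ← Real.rpow_mul ht.le] at h1
  rw [stableDensity_eq hα ht]
  have e : t = t ^ (-(d / α)) * t ^ (1 / α * (d + α)) := by
    rw [← Real.rpow_add ht]
    have : -(d / α) + 1 / α * (d + α) = 1 := by field_simp; ring
    rw [this, Real.rpow_one]
  calc ((2 * Real.pi) ^ d)⁻¹ * c * t * ‖x‖ ^ (-((d:ℝ) + α))
      = ((2 * Real.pi) ^ d)⁻¹ * t ^ (-(d / α)) *
        (c * (t ^ (1 / α * (d + α)) * ‖x‖ ^ (-((d:ℝ) + α)))) := by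
        conv_lhs => rw [e]
        ring
    _ ≤ _ := by gcongr

variable (d) in
/-- Moments of the transition densities, uniformly on bounded time intervals. -/
theorem exists_lintegral_stableDensity_mul_le (hα : 0 < α) (hα2 : α ≤ 2) {η : ℝ} (hη : 0 < η)
    (h : α = 2 ∨ η < α) (τ : ℝ) :
    ∃ C : ℝ, ∀ t : ℝ, 0 < t → t ≤ τ →
      ∫⁻ x, ENNReal.ofReal (stableDensity d α t x) * ENNReal.ofReal ((1 + ‖x‖) ^ η) ≤
        ENNReal.ofReal C := by
  let H : EuclideanSpace ℝ (Fin d) → ℝ := fun x => stableTransform α x * (1 + ‖x‖) ^ η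
  have hG0 := stableTransform_nonneg (V := EuclideanSpace ℝ (Fin d)) hα hα2
  have hH0 : ∀ x, 0 ≤ H x := fun x => mul_nonneg (hG0 x) (by positivity)
  have hHi : Integrable H := by
    refine (((integrable_stableTransform hα hα2).add
      (integrable_stableTransform_mul_norm_rpow hα hα2 hη h)).const_mul (2 ^ η)).mono'
      (Measurable.aestronglyMeasurable ?_) (ae_of_all _ fun x => ?_)
    · have := (continuous_stableTransform (V := EuclideanSpace ℝ (Fin d)) hα).measurable
      fun_prop
    · rw [Real.norm_of_nonneg (hH0 x)]
      have h1 : (1 + ‖x‖) ^ η ≤ 2 ^ η * (1 + ‖x‖ ^ η) := by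
        rcases le_total ‖x‖ 1 with hx | hx
        · have h2 : (1 + ‖x‖) ^ η ≤ 2 ^ η :=
            Real.rpow_le_rpow (by positivity) (by linarith) hη.le
          have h3 : 0 ≤ ‖x‖ ^ η := by positivity
          have h4 : (0:ℝ) < 2 ^ η := by positivity
          nlinarith
        · have h2 : (1 + ‖x‖) ^ η ≤ (2 * ‖x‖) ^ η :=
            Real.rpow_le_rpow (by positivity) (by linarith) hη.le
          rw [Real.mul_rpow two_pos.le (norm_nonneg _)] at h2
          have h4 : (0:ℝ) < 2 ^ η := by positivity
          nlinarith
      have h2 := mul_le_mul_of_nonneg_left h1 (hG0 x)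
      simp only [Pi.add_apply, H]
      linarith
  refine ⟨((2 * Real.pi) ^ d)⁻¹ * ((1 + τ ^ (1 / α)) ^ η * ∫ x, H x), fun t ht htτ => ?_⟩
  set R : ℝ := t ^ (1 / α) with hR
  have hR0 : 0 < R := by positivity
  set K : ℝ := ((2 * Real.pi) ^ d)⁻¹ * t ^ (-(d / α)) * (1 + τ ^ (1 / α)) ^ η with hK
  have hτ0 : 0 < τ := ht.trans_le htτ
  have hK0 : 0 ≤ K := by positivity
  have hRτ : R ≤ τ ^ (1 / α) := Real.rpow_le_rpow ht.le htτ (by positivity)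
  have hle : ∀ x, stableDensity d α t x * (1 + ‖x‖) ^ η ≤ K * H (R⁻¹ • x) := by
    intro x
    rw [stableDensity_eq hα ht, ← hR]
    have hx : 1 + ‖x‖ ≤ (1 + τ ^ (1 / α)) * (1 + ‖R⁻¹ • x‖) := by
      have e1 : ‖x‖ = R * ‖R⁻¹ • x‖ := by
        rw [norm_smul, norm_inv, Real.norm_of_nonneg hR0.le, mul_inv_cancel_left₀ hR0.ne']
      have h0 : 0 ≤ ‖R⁻¹ • x‖ := norm_nonneg _
      have : 0 ≤ τ ^ (1 / α) := by positivity
      nlinarith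
    have h1 := Real.rpow_le_rpow (by positivity) hx hη.le
    rw [Real.mul_rpow (by positivity) (by positivity)] at h1
    have h2 := hG0 (R⁻¹ • x)
    calc _ ≤ ((2 * Real.pi) ^ d)⁻¹ * t ^ (-(d / α)) * stableTransform α (R⁻¹ • x) *
          ((1 + τ ^ (1 / α)) ^ η * (1 + ‖R⁻¹ • x‖) ^ η) := by gcongr
      _ = _ := by simp only [hK, H]; ring
  have hint := Measure.integral_comp_inv_smul (volume : Measure (EuclideanSpace ℝ (Fin d))) H R
  rw [finrank_euclideanSpace_fin, abs_of_pos (by positivity), smul_eq_mul] at hint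
  calc ∫⁻ x, ENNReal.ofReal (stableDensity d α t x) * ENNReal.ofReal ((1 + ‖x‖) ^ η)
      ≤ ∫⁻ x, ENNReal.ofReal (K * H (R⁻¹ • x)) := by
        refine lintegral_mono fun x => ?_
        rw [← ENNReal.ofReal_mul (stableDensity_nonneg hα hα2 ht x)]
        exact ENNReal.ofReal_le_ofReal (hle x)
    _ = ENNReal.ofReal (∫ x, K * H (R⁻¹ • x)) := by
        rw [ofReal_integral_eq_lintegral_ofReal ((hHi.comp_smul (inv_ne_zero hR0.ne')).const_mul K)
          (ae_of_all _ fun x => mul_nonneg hK0 (hH0 _))]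
    _ = _ := by
        rw [integral_const_mul, hint]
        congr 1
        have : t ^ (-(d / α)) * R ^ d = 1 := by
          rw [hR, ← Real.rpow_natCast, ← Real.rpow_mul ht.le, ← Real.rpow_add ht]
          have : -(d / α) + 1 / α * d = 0 := by ring
          rw [this, Real.rpow_zero]
        calc K * (R ^ d * ∫ x, H x) = ((2 * Real.pi) ^ d)⁻¹ * (t ^ (-(d / α)) * R ^ d) *
              (1 + τ ^ (1 / α)) ^ η * ∫ x, H x := by rw [hK]; ring
          _ = _ := by rw [this]; ring

/-! ### The potential of the transition density up to a finite time -/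

/-- The occupation density `Q_τ(x) = ∫_0^τ p_w(x) dw`, as an extended nonnegative number. -/
noncomputable def potential (d : ℕ) (α τ : ℝ) (x : EuclideanSpace ℝ (Fin d)) : ℝ≥0∞ :=
  ∫⁻ w in Set.Ioc 0 τ, ENNReal.ofReal (stableDensity d α w x)

omit [Nonempty (Fin d)] in
theorem measurable_potential (hα : 0 < α) (τ : ℝ) : Measurable (potential d α τ) := by
  have h := (measurable_stableDensity d hα).ennreal_ofReal
  exact Measurable.lintegral_prod_right' (h.comp measurable_swap)

omit [Nonempty (Fin d)] in
theorem lintegral_lintegral_Ioc_swap {F : ℝ × EuclideanSpace ℝ (Fin d) → ℝ≥0∞}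
    (hF : Measurable F) (τ : ℝ) :
    ∫⁻ x, ∫⁻ w in Set.Ioc 0 τ, F (w, x) = ∫⁻ w in Set.Ioc 0 τ, ∫⁻ x, F (w, x) :=
  lintegral_lintegral_swap (f := fun x w => F (w, x)) (hF.comp measurable_swap).aemeasurable

theorem lintegral_potential_mul_lt_top (hα : 0 < α) (hα2 : α ≤ 2) {η : ℝ} (hη : 0 < η)
    (h : α = 2 ∨ η < α) (τ : ℝ) :
    ∫⁻ x, potential d α τ x * ENNReal.ofReal ((1 + ‖x‖) ^ η) < ∞ := by
  obtain ⟨C, hC⟩ := exists_lintegral_stableDensity_mul_le d hα hα2 hη h τ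
  have hm := (measurable_stableDensity d hα).ennreal_ofReal
  have hmW : Measurable fun x : EuclideanSpace ℝ (Fin d) => ENNReal.ofReal ((1 + ‖x‖) ^ η) := by
    fun_prop
  calc ∫⁻ x, potential d α τ x * ENNReal.ofReal ((1 + ‖x‖) ^ η)
      = ∫⁻ x, ∫⁻ w in Set.Ioc 0 τ,
          ENNReal.ofReal (stableDensity d α w x) * ENNReal.ofReal ((1 + ‖x‖) ^ η) := by
        refine lintegral_congr fun x => ?_
        rw [potential, lintegral_mul_const _ (measurable_stableDensity_left hα x).ennreal_ofReal]
    _ = ∫⁻ w in Set.Ioc 0 τ, ∫⁻ x,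
          ENNReal.ofReal (stableDensity d α w x) * ENNReal.ofReal ((1 + ‖x‖) ^ η) :=
        lintegral_lintegral_Ioc_swap (F := fun q => ENNReal.ofReal (stableDensity d α q.1 q.2) *
          ENNReal.ofReal ((1 + ‖q.2‖) ^ η)) (hm.mul (hmW.comp measurable_snd)) τ
    _ ≤ ∫⁻ _ in Set.Ioc 0 τ, ENNReal.ofReal C :=
        setLIntegral_mono' measurableSet_Ioc fun w hw => hC w hw.1 hw.2
    _ < ∞ := by
        rw [setLIntegral_const]
        exact ENNReal.mul_lt_top ENNReal.ofReal_lt_top (by simp)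

theorem ae_potential_lt_top (hα : 0 < α) (hα2 : α ≤ 2) (τ : ℝ) :
    ∀ᵐ x, potential d α τ x < ∞ := by
  have h := lintegral_potential_mul_lt_top (d := d) hα hα2 (η := α / 2) (by linarith)
    (Or.inr (by linarith)) τ
  refine ae_lt_top (measurable_potential hα τ) (ne_top_of_le_ne_top h.ne (lintegral_mono fun x => ?_))
  refine le_mul_of_one_le_right zero_le ?_
  rw [ENNReal.one_le_ofReal]
  exact Real.one_le_rpow (by linarith [norm_nonneg x]) (by linarith)

/-- The potential is in `L^δ` for `δ > d / (d + α)`: by Young's inequality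
`Q ^ δ ≤ Q W + W ^ (-δ / (1 - δ))` with the weight `W = (1 + ‖x‖) ^ η`. -/
theorem lintegral_potential_rpow_lt_top (hα : 0 < α) (hα2 : α ≤ 2) {δ : ℝ} (hδ : 0 < δ)
    (hδ1 : δ < 1) (h : α = 2 ∨ (d : ℝ) / (d + α) < δ) (τ : ℝ) :
    ∫⁻ x, potential d α τ x ^ δ < ∞ := by
  have hd0 : (0:ℝ) ≤ d := by positivity
  have hη : ∃ η : ℝ, 0 < η ∧ (α = 2 ∨ η < α) ∧ (d : ℝ) < η * (δ / (1 - δ)) := by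
    have h1δ : 0 < 1 - δ := by linarith
    have hq : 0 < δ / (1 - δ) := by positivity
    rcases h with h | h
    · refine ⟨d / (δ / (1 - δ)) + 1, by positivity, Or.inl h, ?_⟩
      rw [add_mul, div_mul_cancel₀ _ hq.ne']; linarith
    · rw [div_lt_iff₀ (by positivity)] at h
      have h2 : d / (δ / (1 - δ)) < α := by
        rw [div_lt_iff₀ hq, ← mul_div_assoc, lt_div_iff₀ h1δ]; linarith
      refine ⟨(d / (δ / (1 - δ)) + α) / 2, by positivity, Or.inr (by linarith), ?_⟩
      rw [← div_lt_iff₀ hq]; linarith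
  obtain ⟨η, hη0, hηα, hηd⟩ := hη
  set s : ℝ := η * (δ / (1 - δ)) with hs
  have hpt : ∀ x : EuclideanSpace ℝ (Fin d), potential d α τ x ^ δ ≤
      potential d α τ x * ENNReal.ofReal ((1 + ‖x‖) ^ η) + ENNReal.ofReal ((1 + ‖x‖) ^ (-s)) := by
    intro x
    set Q := potential d α τ x
    have hx : 0 < 1 + ‖x‖ := by positivity
    set W := ENNReal.ofReal ((1 + ‖x‖) ^ η) with hW
    set U := ENNReal.ofReal ((1 + ‖x‖) ^ (-s)) with hU
    have hW0 : W ≠ 0 := by rw [hW, Ne, ENNReal.ofReal_eq_zero, not_le]; positivity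
    have hUW : W ^ δ * U ^ (1 - δ) = 1 := by
      have h1δ : 1 - δ ≠ 0 := by linarith
      rw [hW, hU, ENNReal.ofReal_rpow_of_pos (by positivity),
        ENNReal.ofReal_rpow_of_pos (by positivity), ← ENNReal.ofReal_mul (by positivity),
        ← Real.rpow_mul hx.le, ← Real.rpow_mul hx.le, ← Real.rpow_add hx]
      have : η * δ + -s * (1 - δ) = 0 := by rw [hs]; field_simp; ring
      rw [this, Real.rpow_zero, ENNReal.ofReal_one]
    calc Q ^ δ = (Q * W) ^ δ * U ^ (1 - δ) := by
          rw [ENNReal.mul_rpow_of_nonneg _ _ hδ.le, mul_assoc, hUW, mul_one]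
      _ ≤ (Q * W + U) ^ δ * (Q * W + U) ^ (1 - δ) := by
          have : 0 ≤ 1 - δ := by linarith
          gcongr
          · exact le_self_add
          · exact le_add_self
      _ = Q * W + U := by
          rw [← ENNReal.rpow_add_of_nonneg _ _ hδ.le (by linarith)]
          simp
  refine (lintegral_mono hpt).trans_lt ?_
  rw [lintegral_add_right _ (by fun_prop)]
  refine ENNReal.add_lt_top.2 ⟨lintegral_potential_mul_lt_top hα hα2 hη0 hηα τ, ?_⟩
  have hi := integrable_one_add_norm (E := EuclideanSpace ℝ (Fin d)) (μ := volume) (r := s)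
    (by rw [finrank_euclideanSpace_fin]; exact hηd)
  exact hi.lintegral_lt_top

/-- The potential is in `L^(1+β)` for `d < α (1 + β) / β`: Hölder's inequality in time with the
weights `w ^ σ`, `d / α - 1 / β < σ < 1`. -/
theorem lintegral_potential_rpow_one_add_lt_top (hα : 0 < α) (hα2 : α ≤ 2) {β : ℝ} (hβ : 0 < β)
    (hd : (d : ℝ) < α * (1 + β) / β) (τ : ℝ) :
    ∫⁻ x, potential d α τ x ^ (1 + β) < ∞ := by
  obtain ⟨C, hC, hCle⟩ := exists_stableDensity_le d hα
  obtain ⟨C', hC'⟩ := exists_lintegral_stableDensity_mul_le d hα hα2 (η := α / 2) (by linarith)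
    (Or.inr (by linarith)) τ
  set a := 1 + β with ha
  have ha1 : 1 < a := by linarith
  have ha0 : 0 < a := by linarith
  have hσ : (d : ℝ) / α - 1 / β < 1 := by
    rw [lt_div_iff₀ hβ] at hd
    rw [sub_lt_iff_lt_add, div_lt_iff₀ hα]
    have : (1 + 1 / β) * α * β = α * (1 + β) := by field_simp; ring
    nlinarith
  obtain ⟨σ, hσ1, hσ2⟩ := exists_between hσ
  have hq : a.HolderConjugate (a / (a - 1)) := Real.HolderConjugate.conjExponent ha1
  have haβ : a - 1 = β := by rw [ha]; ring
  -- `w ^ (σ β / a)` times the density, and the inverse weight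
  set e : ℝ := σ * β / a with he
  set I : ℝ≥0∞ := ∫⁻ w in Set.Ioc 0 τ, ENNReal.ofReal (w ^ (-σ)) with hI
  have hpow : ∀ ρ : ℝ, -1 < ρ → ∫⁻ w in Set.Ioc 0 τ, ENNReal.ofReal (w ^ ρ) < ∞ := by
    intro ρ hρ
    rcases le_total τ 0 with h | h
    · rw [Set.Ioc_eq_empty (not_lt.2 h)]; simp
    · exact Integrable.lintegral_lt_top ((intervalIntegrable_iff_integrableOn_Ioc_of_le h).1
        (intervalIntegral.intervalIntegrable_rpow' hρ))
  have hIlt : I < ∞ := hpow _ (by linarith)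
  have hm := (measurable_stableDensity d hα).ennreal_ofReal
  have hmx : ∀ x, Measurable fun w => ENNReal.ofReal (stableDensity d α w x) := fun x =>
    (measurable_stableDensity_left hα x).ennreal_ofReal
  have hpt : ∀ x, potential d α τ x ^ a ≤ I ^ β * ∫⁻ w in Set.Ioc 0 τ,
      ENNReal.ofReal (w ^ (σ * β)) * ENNReal.ofReal (stableDensity d α w x) ^ a := by
    intro x
    let f : ℝ → ℝ≥0∞ := fun w => ENNReal.ofReal (w ^ e) * ENNReal.ofReal (stableDensity d α w x)
    let g : ℝ → ℝ≥0∞ := fun w => ENNReal.ofReal (w ^ (-e))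
    have h1 : potential d α τ x = ∫⁻ w in Set.Ioc 0 τ, (f * g) w := by
      refine setLIntegral_congr_fun measurableSet_Ioc fun w hw => ?_
      simp only [Pi.mul_apply, f, g]
      rw [mul_right_comm, ← ENNReal.ofReal_mul (Real.rpow_nonneg hw.1.le _), ← Real.rpow_add hw.1,
        add_neg_cancel, Real.rpow_zero, ENNReal.ofReal_one, one_mul]
    have hf : AEMeasurable f (volume.restrict (Set.Ioc 0 τ)) := by
      have := hmx x
      fun_prop
    have hg : AEMeasurable g (volume.restrict (Set.Ioc 0 τ)) := by fun_prop
    have h2 := ENNReal.lintegral_mul_le_Lp_mul_Lq (volume.restrict (Set.Ioc 0 τ)) hq hf hg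
    rw [← h1] at h2
    have h3 := ENNReal.rpow_le_rpow h2 ha0.le
    rw [ENNReal.mul_rpow_of_nonneg _ _ ha0.le, ← ENNReal.rpow_mul, ← ENNReal.rpow_mul,
      one_div_mul_cancel ha0.ne', ENNReal.rpow_one, haβ] at h3
    refine h3.trans (le_of_eq ?_)
    rw [mul_comm]
    congr 1
    · have : 1 / (a / β) * a = β := by field_simp
      rw [this, hI]
      congr 1
      refine setLIntegral_congr_fun measurableSet_Ioc fun w hw => ?_
      simp only [g]
      rw [ENNReal.ofReal_rpow_of_pos (Real.rpow_pos_of_pos hw.1 _), ← Real.rpow_mul hw.1.le]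
      congr 2
      rw [he]; field_simp
    · refine setLIntegral_congr_fun measurableSet_Ioc fun w hw => ?_
      simp only [f]
      rw [ENNReal.mul_rpow_of_nonneg _ _ ha0.le,
        ENNReal.ofReal_rpow_of_pos (Real.rpow_pos_of_pos hw.1 _), ← Real.rpow_mul hw.1.le]
      congr 3
      rw [he]; field_simp
  have hma : Measurable fun q : ℝ × EuclideanSpace ℝ (Fin d) =>
      ENNReal.ofReal (q.1 ^ (σ * β)) * ENNReal.ofReal (stableDensity d α q.1 q.2) ^ a :=
    Measurable.mul (by fun_prop) (hm.pow_const a)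
  have hexp : -1 < σ * β + -(d / α) * β := by
    have : (d / α - σ) * β < 1 := by
      rw [← lt_div_iff₀ hβ]; linarith
    linarith
  calc ∫⁻ x, potential d α τ x ^ a
      ≤ ∫⁻ x, I ^ β * ∫⁻ w in Set.Ioc 0 τ,
          ENNReal.ofReal (w ^ (σ * β)) * ENNReal.ofReal (stableDensity d α w x) ^ a :=
        lintegral_mono hpt
    _ = I ^ β * ∫⁻ w in Set.Ioc 0 τ, ∫⁻ x,
          ENNReal.ofReal (w ^ (σ * β)) * ENNReal.ofReal (stableDensity d α w x) ^ a := by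
        rw [lintegral_const_mul' _ _ (ENNReal.rpow_ne_top_of_nonneg hβ.le hIlt.ne)]
        congr 1
        exact lintegral_lintegral_Ioc_swap hma τ
    _ ≤ I ^ β * ∫⁻ w in Set.Ioc 0 τ, ENNReal.ofReal (C ^ β * C') *
          ENNReal.ofReal (w ^ (σ * β + -(d / α) * β)) := by
        refine mul_le_mul_right (setLIntegral_mono' measurableSet_Ioc fun w hw => ?_) _
        have hw0 := hw.1
        -- one factor of the density is integrated, the power `β` is estimated by the maximum
        have h1 : ∀ x, ENNReal.ofReal (w ^ (σ * β)) * ENNReal.ofReal (stableDensity d α w x) ^ a ≤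
            ENNReal.ofReal (w ^ (σ * β)) * ENNReal.ofReal ((C * w ^ (-(d / α))) ^ β) *
            (ENNReal.ofReal (stableDensity d α w x) * ENNReal.ofReal ((1 + ‖x‖) ^ (α / 2))) := by
          intro x
          rw [mul_assoc]
          refine mul_le_mul_right ?_ _
          rw [ha, ENNReal.rpow_add_of_nonneg _ _ zero_le_one hβ.le, ENNReal.rpow_one, mul_comm]
          refine mul_le_mul' ?_ (le_mul_of_one_le_right zero_le ?_)
          · rw [← ENNReal.ofReal_rpow_of_nonneg (by positivity) hβ.le]
            exact ENNReal.rpow_le_rpow (ENNReal.ofReal_le_ofReal (hCle w hw0 x)) hβ.le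
          · rw [ENNReal.one_le_ofReal]
            exact Real.one_le_rpow (by linarith [norm_nonneg x]) (by linarith)
        refine (lintegral_mono h1).trans ?_
        rw [lintegral_const_mul' _ _ (ENNReal.mul_ne_top ENNReal.ofReal_ne_top ENNReal.ofReal_ne_top)]
        refine (mul_le_mul_right (hC' w hw0 hw.2) _).trans (le_of_eq ?_)
        rw [Real.mul_rpow hC.le (by positivity), ← Real.rpow_mul hw0.le, Real.rpow_add hw0,
          ENNReal.ofReal_mul (by positivity), ENNReal.ofReal_mul (by positivity),
          ENNReal.ofReal_mul (by positivity)]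
        ring
    _ < ∞ := by
        rw [lintegral_const_mul' _ _ ENNReal.ofReal_ne_top]
        exact ENNReal.mul_lt_top (ENNReal.rpow_lt_top_of_nonneg hβ.le hIlt.ne)
          (ENNReal.mul_lt_top ENNReal.ofReal_lt_top (hpow _ hexp))

end Density

/-! ### The integrands of the process and of its increments -/

section Kernel

variable {d : ℕ} {α : ℝ}

theorem kernel_eq (t : ℝ) (y : ℝ × EuclideanSpace ℝ (Fin d)) :
    kernel d α t y =
      (Set.Icc 0 t).indicator (fun r => ∫ w in (0:ℝ)..(t - r), stableDensity d α w y.2) y.1 := by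
  unfold kernel
  congr 1
  funext r
  rw [intervalIntegral.integral_comp_sub_right (fun w => stableDensity d α w y.2), sub_self]

theorem measurable_kernel (hα : 0 < α) (t : ℝ) : Measurable (kernel d α t) := by
  have h1 : Measurable fun q : (ℝ × EuclideanSpace ℝ (Fin d)) × ℝ =>
      {q : (ℝ × EuclideanSpace ℝ (Fin d)) × ℝ | 0 < q.2 ∧ q.2 ≤ t - q.1.1}.indicator
        (fun q => stableDensity d α q.2 q.1.2) q := by
    refine Measurable.indicator ?_ ?_
    · exact (measurable_stableDensity d hα).comp
        (measurable_snd.prodMk (measurable_snd.comp measurable_fst))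
    · exact (measurableSet_lt measurable_const measurable_snd).inter
        (measurableSet_le measurable_snd (by fun_prop))
  have h2 := (StronglyMeasurable.integral_prod_right' (ν := volume) h1.stronglyMeasurable).measurable
  have h3 := h2.indicator (measurableSet_Icc.preimage
    (measurable_fst (α := ℝ) (β := EuclideanSpace ℝ (Fin d))) :
      MeasurableSet (Prod.fst ⁻¹' Set.Icc 0 t))
  refine (congrArg Measurable ?_).mp h3
  funext y
  rw [kernel_eq]
  by_cases hy : y.1 ∈ Set.Icc 0 t
  · rw [Set.indicator_of_mem hy, Set.indicator_of_mem (show y ∈ Prod.fst ⁻¹' Set.Icc 0 t from hy),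
      intervalIntegral.integral_of_le (by linarith [hy.2]), ← integral_indicator measurableSet_Ioc]
    rfl
  · rw [Set.indicator_of_notMem hy,
      Set.indicator_of_notMem (show y ∉ Prod.fst ⁻¹' Set.Icc 0 t from hy)]

variable [Nonempty (Fin d)]

theorem enorm_kernel_le (hα : 0 < α) (hα2 : α ≤ 2) (t : ℝ) (y : ℝ × EuclideanSpace ℝ (Fin d)) :
    ‖kernel d α t y‖ₑ ≤ (Set.Icc 0 t).indicator 1 y.1 * potential d α t y.2 := by
  rw [kernel_eq]
  by_cases hy : y.1 ∈ Set.Icc 0 t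
  · rw [Set.indicator_of_mem hy, Set.indicator_of_mem hy, Pi.one_apply, one_mul,
      intervalIntegral.integral_of_le (by linarith [hy.2])]
    refine (enorm_integral_le_lintegral_enorm _).trans ?_
    refine (lintegral_mono_set (Set.Ioc_subset_Ioc_right (sub_le_self t hy.1))).trans ?_
    refine (setLIntegral_congr_fun measurableSet_Ioc fun w hw => ?_).le
    exact Real.enorm_of_nonneg (stableDensity_nonneg hα hα2 hw.1 _)
  · rw [Set.indicator_of_notMem hy]; simp

/-- The integrand of the increment of the process over `[s, t]`. -/
noncomputable def incrementKernel (d : ℕ) (α s t : ℝ) (y : ℝ × EuclideanSpace ℝ (Fin d)) : ℝ :=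
  kernel d α t y - kernel d α s y

theorem enorm_incrementKernel_le (hα : 0 < α) (hα2 : α ≤ 2) {s t : ℝ} (hst : s ≤ t)
    (y : ℝ × EuclideanSpace ℝ (Fin d)) :
    ‖incrementKernel d α s t y‖ₑ ≤ (Set.Icc 0 t).indicator 1 y.1 * (2 * potential d α t y.2) := by
  refine enorm_sub_le.trans ((add_le_add (enorm_kernel_le hα hα2 t y)
    (enorm_kernel_le hα hα2 s y)).trans ?_)
  rw [two_mul, mul_add]
  refine add_le_add le_rfl (mul_le_mul' ?_ ?_)
  · exact Set.indicator_le_indicator_of_subset (Set.Icc_subset_Icc_right hst) (fun _ => zero_le) _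
  · exact lintegral_mono_set (Set.Ioc_subset_Ioc_right hst)

omit [Nonempty (Fin d)] in
theorem lintegral_enorm_rpow_lt_top (hα : 0 < α) {g : ℝ × EuclideanSpace ℝ (Fin d) → ℝ}
    {c : ℝ≥0∞} (hc : c ≠ ∞) {t δ : ℝ} (hδ : 0 < δ)
    (hg : ∀ y, ‖g y‖ₑ ≤ (Set.Icc 0 t).indicator 1 y.1 * (c * potential d α t y.2))
    (h : ∫⁻ x, potential d α t x ^ δ < ∞) : ∫⁻ y, ‖g y‖ₑ ^ δ < ∞ := by
  calc ∫⁻ y, ‖g y‖ₑ ^ δ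
      ≤ ∫⁻ y : ℝ × EuclideanSpace ℝ (Fin d),
          (Set.Icc 0 t).indicator 1 y.1 * (c ^ δ * potential d α t y.2 ^ δ) := by
        refine lintegral_mono fun y => ?_
        refine (ENNReal.rpow_le_rpow (hg y) hδ.le).trans ?_
        rw [ENNReal.mul_rpow_of_nonneg _ _ hδ.le, ENNReal.mul_rpow_of_nonneg _ _ hδ.le]
        refine mul_le_mul' ?_ le_rfl
        by_cases hy : y.1 ∈ Set.Icc 0 t
        · rw [Set.indicator_of_mem hy, Pi.one_apply, ENNReal.one_rpow]
        · rw [Set.indicator_of_notMem hy, ENNReal.zero_rpow_of_pos hδ]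
    _ = (∫⁻ r, (Set.Icc 0 t).indicator 1 r) * ∫⁻ x, c ^ δ * potential d α t x ^ δ := by
        rw [Measure.volume_eq_prod]
        exact lintegral_prod_mul (measurable_one.indicator measurableSet_Icc).aemeasurable
          (((measurable_potential hα t).pow_const δ).const_mul _).aemeasurable
    _ < ∞ := by
        rw [lintegral_indicator_one measurableSet_Icc,
          lintegral_const_mul' _ _ (ENNReal.rpow_ne_top_of_nonneg hδ.le hc)]
        exact ENNReal.mul_lt_top (by simp)
          (ENNReal.mul_lt_top (ENNReal.rpow_lt_top_of_nonneg hδ.le hc) h)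

theorem memLp_kernel (hα : 0 < α) (hα2 : α ≤ 2) {β : ℝ} (hβ : 0 < β)
    (hd : (d : ℝ) < α * (1 + β) / β) (t : ℝ) :
    MemLp (kernel d α t) (ENNReal.ofReal (1 + β)) volume := by
  have ha : 0 < 1 + β := by linarith
  refine ⟨(measurable_kernel hα t).aestronglyMeasurable, ?_⟩
  rw [eLpNorm_lt_top_iff_lintegral_rpow_enorm_lt_top (by simpa using ha) ENNReal.ofReal_ne_top,
    ENNReal.toReal_ofReal ha.le]
  exact lintegral_enorm_rpow_lt_top hα ENNReal.one_ne_top ha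
    (fun y => by rw [one_mul]; exact enorm_kernel_le hα hα2 t y)
    (lintegral_potential_rpow_one_add_lt_top hα hα2 hβ hd t)

theorem integrable_abs_incrementKernel_rpow (hα : 0 < α) (hα2 : α ≤ 2) {s t δ : ℝ} (hst : s ≤ t)
    (hδ : 0 < δ) (hδ1 : δ < 1) (h : α = 2 ∨ (d : ℝ) / (d + α) < δ) :
    Integrable fun y => |incrementKernel d α s t y| ^ δ := by
  have hm : Measurable (incrementKernel d α s t) :=
    (measurable_kernel hα t).sub (measurable_kernel hα s)
  refine ⟨(hm.abs.pow_const δ).aestronglyMeasurable, ?_⟩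
  rw [hasFiniteIntegral_iff_ofReal (ae_of_all _ fun y => by positivity)]
  refine lt_of_le_of_lt (lintegral_mono fun y => ?_) (lintegral_enorm_rpow_lt_top hα
    ENNReal.ofNat_ne_top hδ (enorm_incrementKernel_le hα hα2 hst)
    (lintegral_potential_rpow_lt_top hα hα2 hδ hδ1 h t))
  rw [← ENNReal.ofReal_rpow_of_nonneg (abs_nonneg _) hδ.le, Real.enorm_eq_ofReal_abs]

/-- For almost every `x` the density is integrable in time near `0`. (At `x = 0` it is not, when
`d ≥ α`.) -/
theorem ae_integrableOn_stableDensity (hα : 0 < α) (hα2 : α ≤ 2) :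
    ∀ᵐ y : ℝ × EuclideanSpace ℝ (Fin d), ∀ τ : ℝ,
      IntegrableOn (fun w => stableDensity d α w y.2) (Set.Ioc 0 τ) := by
  have h1 : ∀ᵐ x : EuclideanSpace ℝ (Fin d), ∀ n : ℕ, potential d α n x < ∞ :=
    ae_all_iff.2 fun n => ae_potential_lt_top hα hα2 n
  have h2 : ∀ᵐ y : ℝ × EuclideanSpace ℝ (Fin d), ∀ n : ℕ, potential d α n y.2 < ∞ :=
    (Measure.quasiMeasurePreserving_snd (μ := (volume : Measure ℝ))
      (ν := (volume : Measure (EuclideanSpace ℝ (Fin d))))).ae h1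
  filter_upwards [h2] with y hy τ
  obtain ⟨n, hn⟩ := exists_nat_ge τ
  refine IntegrableOn.mono_set (t := Set.Ioc 0 (n : ℝ)) ⟨?_, ?_⟩ (Set.Ioc_subset_Ioc_right hn)
  · exact (measurable_stableDensity_left hα _).aestronglyMeasurable
  · rw [hasFiniteIntegral_iff_ofReal]
    · exact hy n
    · exact (ae_restrict_iff' measurableSet_Ioc).2
        (ae_of_all _ fun w hw => stableDensity_nonneg hα hα2 hw.1 _)

omit [Nonempty (Fin d)] in
theorem incrementKernel_eq_integral {s t : ℝ} (hst : s ≤ t) {y : ℝ × EuclideanSpace ℝ (Fin d)}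
    (hy : ∀ τ : ℝ, IntegrableOn (fun w => stableDensity d α w y.2) (Set.Ioc 0 τ))
    (h0 : 0 ≤ y.1) (hs : y.1 ≤ s) :
    incrementKernel d α s t y = ∫ w in (s - y.1)..(t - y.1), stableDensity d α w y.2 := by
  have hi : ∀ τ : ℝ, 0 ≤ τ → IntervalIntegrable (fun w => stableDensity d α w y.2) volume 0 τ :=
    fun τ hτ => (intervalIntegrable_iff_integrableOn_Ioc_of_le hτ).2 (hy τ)
  rw [incrementKernel, kernel_eq, kernel_eq,
    Set.indicator_of_mem (show y.1 ∈ Set.Icc 0 t from ⟨h0, hs.trans hst⟩),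
    Set.indicator_of_mem (show y.1 ∈ Set.Icc 0 s from ⟨h0, hs⟩)]
  exact intervalIntegral.integral_interval_sub_left (hi _ (by linarith)) (hi _ (by linarith))

theorem incrementKernel_nonneg (hα : 0 < α) (hα2 : α ≤ 2) {s t : ℝ} (hst : s ≤ t)
    {y : ℝ × EuclideanSpace ℝ (Fin d)}
    (hy : ∀ τ : ℝ, IntegrableOn (fun w => stableDensity d α w y.2) (Set.Ioc 0 τ)) :
    0 ≤ incrementKernel d α s t y := by
  have hpos : ∀ b : ℝ, ∀ a : ℝ, 0 ≤ a → a ≤ b → 0 ≤ ∫ w in a..b, stableDensity d α w y.2 := by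
    intro b a ha hab
    rw [intervalIntegral.integral_of_le hab]
    exact setIntegral_nonneg measurableSet_Ioc fun w hw =>
      stableDensity_nonneg hα hα2 (ha.trans_lt hw.1) _
  by_cases h0 : 0 ≤ y.1
  · by_cases hs : y.1 ≤ s
    · rw [incrementKernel_eq_integral hst hy h0 hs]
      exact hpos _ _ (by linarith) (by linarith)
    · rw [incrementKernel, kernel_eq s, Set.indicator_of_notMem (fun h => hs h.2), sub_zero, kernel_eq]
      refine Set.indicator_nonneg (fun r hr => hpos _ _ le_rfl ?_) _
      linarith [hr.2]
  · rw [incrementKernel, kernel_eq, kernel_eq, Set.indicator_of_notMem (fun h => h0 h.1),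
      Set.indicator_of_notMem (fun h => h0 h.1), sub_zero]

omit [Nonempty (Fin d)] in
theorem incrementKernel_eq_zero {s t : ℝ} (hst : s ≤ t) {y : ℝ × EuclideanSpace ℝ (Fin d)}
    (hy : y.1 ∉ Set.Icc 0 t) : incrementKernel d α s t y = 0 := by
  rw [incrementKernel, kernel_eq, kernel_eq, Set.indicator_of_notMem hy,
    Set.indicator_of_notMem fun h => hy ⟨h.1, h.2.trans hst⟩, sub_zero]

theorem abs_incrementKernel_le (hα : 0 < α) (hα2 : α ≤ 2) {C : ℝ} (hC : 0 < C)
    (hCle : ∀ t : ℝ, 0 < t → ∀ x, stableDensity d α t x ≤ C * t ^ (-((d : ℝ) / α))) {v s t : ℝ}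
    (hvs : v < s) (hst : s ≤ t) {y : ℝ × EuclideanSpace ℝ (Fin d)}
    (hy : ∀ τ : ℝ, IntegrableOn (fun w => stableDensity d α w y.2) (Set.Ioc 0 τ))
    (h0 : 0 ≤ y.1) (hv : y.1 ≤ v) :
    |incrementKernel d α s t y| ≤ C * (t - s) * (s - v) ^ (-((d : ℝ) / α)) := by
  rw [incrementKernel_eq_integral hst hy h0 (hv.trans hvs.le), ← Real.norm_eq_abs]
  refine (intervalIntegral.norm_integral_le_of_norm_le_const
    (C := C * (s - v) ^ (-((d : ℝ) / α))) fun w hw => ?_).trans (le_of_eq ?_)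
  · rw [Set.uIoc_of_le (by linarith)] at hw
    have hw0 : 0 < w := by linarith [hw.1]
    rw [Real.norm_of_nonneg (stableDensity_nonneg hα hα2 hw0 _)]
    refine (hCle w hw0 _).trans (mul_le_mul_of_nonneg_left ?_ hC.le)
    refine Real.rpow_le_rpow_of_nonpos (by linarith) (by linarith [hw.1]) ?_
    have : 0 ≤ (d : ℝ) / α := by positivity
    linarith
  · rw [sub_sub_sub_cancel_right, abs_of_nonneg (by linarith)]; ring

omit [Nonempty (Fin d)] in
theorem le_incrementKernel {m s t : ℝ} (hst : s ≤ t)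
    {y : ℝ × EuclideanSpace ℝ (Fin d)}
    (hy : ∀ τ : ℝ, IntegrableOn (fun w => stableDensity d α w y.2) (Set.Ioc 0 τ))
    (h0 : 0 ≤ y.1) (hs : y.1 ≤ s)
    (hm : ∀ w ∈ Set.Icc (s - y.1) (t - y.1), m ≤ stableDensity d α w y.2) :
    m * (t - s) ≤ incrementKernel d α s t y := by
  rw [incrementKernel_eq_integral hst hy h0 hs]
  have hle : s - y.1 ≤ t - y.1 := by linarith
  have hi : IntervalIntegrable (fun w => stableDensity d α w y.2) volume (s - y.1) (t - y.1) :=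
    (intervalIntegrable_iff_integrableOn_Ioc_of_le hle).2
      ((hy _).mono_set (Set.Ioc_subset_Ioc_left (by linarith)))
  have h := intervalIntegral.integral_mono_on hle intervalIntegrable_const hi hm
  rw [intervalIntegral.integral_const, smul_eq_mul] at h
  linarith

end Kernel

/-! ### Decay rates on the scale of powers -/

theorem isLittleO_rpow_rpow_of_lt {p q : ℝ} (h : p < q) :
    (fun T : ℝ => T ^ p) =o[atTop] fun T : ℝ => T ^ q := by
  refine (isLittleO_iff_tendsto' ?_).2 ?_
  · filter_upwards [eventually_gt_atTop 0] with T hT h0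
    exact absurd h0 (Real.rpow_pos_of_pos hT q).ne'
  · refine (tendsto_rpow_neg_atTop (sub_pos.2 h)).congr' ?_
    filter_upwards [eventually_gt_atTop 0] with T hT
    rw [neg_sub, Real.rpow_sub hT]

theorem ofReal_le_sSup_isLittleO {D : ℝ → ℝ} {κ : ℝ}
    (h : ∀ γ < κ, ∃ κ' > γ, ∃ C, ∀ T : ℝ, 0 < T → |D T| ≤ C * T ^ (-κ')) :
    ENNReal.ofReal κ ≤
      sSup (ENNReal.ofReal '' {γ : ℝ | 0 < γ ∧ D =o[atTop] fun T : ℝ => T ^ (-γ)}) := by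
  by_contra! hlt
  set S := sSup (ENNReal.ofReal '' {γ : ℝ | 0 < γ ∧ D =o[atTop] fun T : ℝ => T ^ (-γ)}) with hS
  have hSt : S ≠ ∞ := (hlt.trans ENNReal.ofReal_lt_top).ne
  have hSκ : S.toReal < κ := (ENNReal.lt_ofReal_iff_toReal_lt hSt).1 hlt
  obtain ⟨γ, hγ, hγκ⟩ := exists_between hSκ
  have hγ0 : 0 < γ := ENNReal.toReal_nonneg.trans_lt hγ
  obtain ⟨κ', hκ', C, hC⟩ := h γ hγκ
  have hO : D =O[atTop] fun T : ℝ => T ^ (-κ') := by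
    refine IsBigO.of_bound C ((eventually_gt_atTop 0).mono fun T hT => ?_)
    rw [Real.norm_eq_abs, Real.norm_of_nonneg (Real.rpow_nonneg hT.le _)]
    exact hC T hT
  have ho : D =o[atTop] fun T : ℝ => T ^ (-γ) :=
    hO.trans_isLittleO (isLittleO_rpow_rpow_of_lt (by linarith))
  have hle : ENNReal.ofReal γ ≤ S := le_sSup ⟨γ, ⟨hγ0, ho⟩, rfl⟩
  exact hγ.not_ge ((ENNReal.ofReal_le_iff_le_toReal hSt).1 hle)

theorem sSup_isLittleO_le_ofReal {D : ℝ → ℝ} {κ c : ℝ} (hc : 0 < c)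
    (h : ∀ᶠ T : ℝ in atTop, c * T ^ (-κ) ≤ D T) :
    sSup (ENNReal.ofReal '' {γ : ℝ | 0 < γ ∧ D =o[atTop] fun T : ℝ => T ^ (-γ)}) ≤
      ENNReal.ofReal κ := by
  refine sSup_le ?_
  rintro _ ⟨γ, ⟨-, ho⟩, rfl⟩
  refine ENNReal.ofReal_le_ofReal ?_
  by_contra! hlt
  have h1 : (fun T : ℝ => T ^ (-κ)) =O[atTop] D := by
    refine IsBigO.of_bound c⁻¹ ((h.and (eventually_gt_atTop 0)).mono fun T hT => ?_)
    rw [Real.norm_of_nonneg (Real.rpow_nonneg hT.2.le _), inv_mul_eq_div, le_div_iff₀ hc, mul_comm]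
    exact hT.1.trans (le_abs_self _)
  have h2 : (fun T : ℝ => T ^ (-γ)) =O[atTop] fun T : ℝ => T ^ (-κ) :=
    (isLittleO_rpow_rpow_of_lt (by linarith)).isBigO
  refine isLittleO_irrefl (Eventually.frequently ?_) ((h1.trans_isLittleO ho).trans_isBigO h2)
  exact (eventually_gt_atTop 0).mono fun T hT => (Real.rpow_pos_of_pos hT _).ne'

/-! ### The codifference of the increments -/

section Codifference

variable {d : ℕ} {α β : ℝ} [Nonempty (Fin d)] {Ω : Type*} [MeasurableSpace Ω] {P : Measure Ω}
  [IsProbabilityMeasure P] {M : Set (ℝ × EuclideanSpace ℝ (Fin d)) → Ω → ℝ}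

theorem memLp_incrementKernel (hα : 0 < α) (hα2 : α ≤ 2) (hβ : 0 < β)
    (hd : (d : ℝ) < α * (1 + β) / β) (z s t : ℝ) :
    MemLp (fun y => z * incrementKernel d α s t y) (ENNReal.ofReal (1 + β)) volume :=
  ((memLp_kernel hα hα2 hβ hd t).sub (memLp_kernel hα hα2 hβ hd s)).const_mul z

theorem integrable_exponentDefect_incrementKernel (hα : 0 < α) (hα2 : α ≤ 2) (hβ : 0 < β)
    (hd : (d : ℝ) < α * (1 + β) / β) (z₁ z₂ u v s t : ℝ) :
    Integrable fun y => exponentDefect (1 + β) (z₁ * incrementKernel d α u v y)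
      (z₂ * incrementKernel d α s t y) := by
  have ha : 0 < 1 + β := by linarith
  have h1 := memLp_incrementKernel hα hα2 hβ hd z₁ u v
  have h2 := memLp_incrementKernel hα hα2 hβ hd z₂ s t
  exact ((integrable_stableExponent ha (h1.add h2)).sub (integrable_stableExponent ha h1)).sub
    (integrable_stableExponent ha h2)

theorem isStableIntegral_increment (hα : 0 < α) (hα2 : α ≤ 2) (hβ : 0 < β) (hβ1 : β < 1)
    (hd : (d : ℝ) < α * (1 + β) / β) (hM : IsStableRandomMeasure P volume (1 + β) M) (z s t : ℝ) :
    IsStableIntegral P volume (1 + β) M (fun y => z * incrementKernel d α s t y)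
      (fun ω => z * (subfracStable P d α β M t ω - subfracStable P d α β M s ω)) := by
  have hX := fun τ : ℝ => hM.isStableIntegral_stableIntegral (by linarith) (by linarith)
    (memLp_kernel hα hα2 hβ hd τ)
  have h := hM.isStableIntegral_linComb (by linarith) (hX t) (hX s) z (-z)
  have e1 : (fun y => z * kernel d α t y + -z * kernel d α s y) =
      fun y => z * incrementKernel d α s t y := by
    funext y; rw [incrementKernel]; ring
  have e2 : (fun ω => z * stableIntegral P volume (1 + β) M (kernel d α t) ω +
      -z * stableIntegral P volume (1 + β) M (kernel d α s) ω) =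
      fun ω => z * (subfracStable P d α β M t ω - subfracStable P d α β M s ω) := by
    funext ω; rw [subfracStable, subfracStable]; ring
  rwa [e1, e2] at h

theorem codiff_subfracStable (hα : 0 < α) (hα2 : α ≤ 2) (hβ : 0 < β) (hβ1 : β < 1)
    (hd : (d : ℝ) < α * (1 + β) / β) (hM : IsStableRandomMeasure P volume (1 + β) M)
    (z₁ z₂ u v s t T : ℝ) :
    codiff P (subfracStable P d α β M) z₁ z₂ u v s t T =
      ‖∫ y, exponentDefect (1 + β) (z₁ * incrementKernel d α u v y)
        (z₂ * incrementKernel d α (T + s) (T + t) y)‖ := by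
  have ha : 1 < 1 + β := by linarith
  have h1 := isStableIntegral_increment hα hα2 hβ hβ1 hd hM z₁ u v
  have h2 := isStableIntegral_increment hα hα2 hβ hβ1 hd hM z₂ (T + s) (T + t)
  have h12 := hM.isStableIntegral_linComb ha h1 h2 1 1
  simp only [one_mul] at h12
  have i1 := integrable_stableExponent (by linarith) h1.1
  have i2 := integrable_stableExponent (by linarith) h2.1
  have i12 := integrable_stableExponent (by linarith) h12.1
  rw [codiff, hM.logE_eq ha h1, hM.logE_eq ha h2, hM.logE_eq ha h12, ← norm_neg]
  congr 1
  simp only [exponentDefect]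
  have e1 := integral_sub i12 i1
  have e2 := integral_sub (i12.sub i1) i2
  simp only [Pi.sub_apply] at e1 e2
  rw [e2, e1]
  ring

/-- The upper bound for the codifference. The exponent `δ` of integrability of the first increment
kernel trades against the uniform decay `T ^ (-d/α)` of the second one. -/
theorem exists_codiff_le (hα : 0 < α) (hα2 : α ≤ 2) (hβ : 0 < β) (hβ1 : β < 1)
    (hd : (d : ℝ) < α * (1 + β) / β) (hM : IsStableRandomMeasure P volume (1 + β) M)
    (z₁ z₂ : ℝ) {u v s t δ : ℝ} (huv : u < v) (hvs : v < s) (hst : s < t)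
    (hβδ : β ≤ δ) (hδ1 : δ < 1) (h : α = 2 ∨ (d : ℝ) / (d + α) < δ) :
    ∃ C, ∀ T : ℝ, 0 < T → codiff P (subfracStable P d α β M) z₁ z₂ u v s t T ≤
      C * T ^ (-((d : ℝ) / α * (1 + β - δ))) := by
  have hδ : 0 < δ := hβ.trans_le hβδ
  obtain ⟨C, hC, hCle⟩ := exists_stableDensity_le d hα
  set K : ℝ := 9 * (1 + |Real.tan (Real.pi / 2 * (1 + β))|) * (1 + β) with hK
  have hK0 : 0 ≤ K := by positivity
  refine ⟨K * (∫ y, |z₁ * incrementKernel d α u v y| ^ δ) *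
    (|z₂| * (C * (t - s))) ^ (1 + β - δ), fun T hT => ?_⟩
  set H : ℝ := |z₂| * (C * (t - s) * T ^ (-((d : ℝ) / α))) with hH
  have hts : 0 < t - s := by linarith
  have hH0 : 0 ≤ H := by positivity
  have hint : Integrable fun y => |z₁ * incrementKernel d α u v y| ^ δ := by
    have h1 := (integrable_abs_incrementKernel_rpow hα hα2 huv.le hδ hδ1 h).const_mul (|z₁| ^ δ)
    refine h1.congr (ae_of_all _ fun y => ?_)
    simp only [abs_mul, Real.mul_rpow (abs_nonneg z₁) (abs_nonneg _)]
  rw [codiff_subfracStable hα hα2 hβ hβ1 hd hM]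
  refine (norm_integral_le_of_norm_le
    (g := fun y => K * (|z₁ * incrementKernel d α u v y| ^ δ * H ^ (1 + β - δ)))
    ((hint.mul_const _).const_mul _) ?_).trans (le_of_eq ?_)
  · filter_upwards [ae_integrableOn_stableDensity hα hα2] with y hy
    refine (norm_exponentDefect_le (by linarith) (by linarith) (by linarith) hδ1.le _ _).trans ?_
    refine mul_le_mul_of_nonneg_left ?_ hK0
    by_cases hyv : y.1 ∈ Set.Icc 0 v
    · refine mul_le_mul_of_nonneg_left ?_ (by positivity)
      refine Real.rpow_le_rpow (abs_nonneg _) ?_ (by linarith)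
      rw [abs_mul]
      refine mul_le_mul_of_nonneg_left ?_ (abs_nonneg _)
      have h1 := abs_incrementKernel_le hα hα2 hC hCle (v := v) (s := T + s) (t := T + t)
        (by linarith) (by linarith) hy hyv.1 hyv.2
      rw [add_sub_add_left_eq_sub] at h1
      refine h1.trans (mul_le_mul_of_nonneg_left ?_ (by positivity))
      refine Real.rpow_le_rpow_of_nonpos hT (by linarith) ?_
      have : 0 ≤ (d : ℝ) / α := by positivity
      linarith
    · rw [incrementKernel_eq_zero huv.le hyv, mul_zero, abs_zero, Real.zero_rpow hδ.ne', zero_mul,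
        zero_mul]
  · rw [integral_const_mul, integral_mul_const, hH, ← mul_assoc |z₂|,
      Real.mul_rpow (by positivity) (by positivity), ← Real.rpow_mul hT.le]
    ring_nf

/-- A lower bound for the codifference of the increments over `[1, 2]` and `[T + 3, T + 4]`, by
the contribution of the noise in `[0, 1/2] × B`. -/
theorem le_codiff (hα : 0 < α) (hα2 : α ≤ 2) (hβ : 0 < β) (hβ1 : β < 1)
    (hd : (d : ℝ) < α * (1 + β) / β) (hM : IsStableRandomMeasure P volume (1 + β) M)
    {B : Set (EuclideanSpace ℝ (Fin d))} (hB : MeasurableSet B) (hB' : volume B ≠ ∞)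
    {m₁ m₂ T : ℝ} (hT : 0 ≤ T) (hm₂ : 0 ≤ m₂) (hm : m₂ ≤ m₁)
    (h₁ : ∀ x ∈ B, ∀ w ∈ Set.Icc (1 / 2 : ℝ) 2, m₁ ≤ stableDensity d α w x)
    (h₂ : ∀ x ∈ B, ∀ w ∈ Set.Icc (T + 2) (T + 4), m₂ ≤ stableDensity d α w x) :
    1 / 2 * volume.real B * (β * (m₂ * m₁ ^ β)) ≤
      codiff P (subfracStable P d α β M) 1 1 1 2 3 4 T := by
  rw [codiff_subfracStable hα hα2 hβ hβ1 hd hM]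
  have hint := integrable_exponentDefect_incrementKernel hα hα2 hβ hd 1 1 1 2 (T + 3) (T + 4)
  simp only [one_mul] at hint ⊢
  refine le_trans ?_ (Complex.re_le_norm _)
  have hre := Complex.reCLM.integral_comp_comm hint
  simp only [Complex.reCLM_apply] at hre
  rw [← hre]
  set S : Set (ℝ × EuclideanSpace ℝ (Fin d)) := Set.Icc 0 (1 / 2) ×ˢ B with hS
  have hSm : MeasurableSet S := measurableSet_Icc.prod hB
  have hSv : volume S = ENNReal.ofReal (1 / 2) * volume B := by
    rw [hS, Measure.volume_eq_prod, Measure.prod_prod, Real.volume_Icc, sub_zero]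
  have hSf : volume S ≠ ∞ := by
    rw [hSv]; exact ENNReal.mul_ne_top ENNReal.ofReal_ne_top hB'
  have hSr : volume.real S = 1 / 2 * volume.real B := by
    rw [measureReal_def, hSv, ENNReal.toReal_mul, ENNReal.toReal_ofReal (by norm_num),
      measureReal_def]
  rw [← hSr, ← smul_eq_mul, ← integral_indicator_const _ hSm]
  refine integral_mono_ae
    ((integrableOn_const hSf).integrable_indicator hSm) hint.re ?_
  filter_upwards [ae_integrableOn_stableDensity hα hα2] with y hy
  by_cases hyS : y ∈ S
  · rw [Set.indicator_of_mem hyS]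
    obtain ⟨⟨h0, h12⟩, hyB⟩ := hyS
    have hβ' : (1 + β) - 1 = β := by ring
    have h := le_exponentDefect_re (a := 1 + β) (x := incrementKernel d α 1 2 y)
      (y := incrementKernel d α (T + 3) (T + 4) y) (by linarith) hm₂ hm ?_ ?_
    · rwa [hβ'] at h
    · have := le_incrementKernel (s := 1) (t := 2) (by norm_num) hy h0 (by linarith)
        (fun w hw => h₁ y.2 hyB w ⟨by linarith [hw.1], by linarith [hw.2]⟩)
      linarith
    · have := le_incrementKernel (s := T + 3) (t := T + 4) (by linarith) hy h0 (by linarith)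
        (fun w hw => h₂ y.2 hyB w ⟨by linarith [hw.1], by linarith [hw.2]⟩)
      linarith
  · rw [Set.indicator_of_notMem hyS]
    exact exponentDefect_re_nonneg (by linarith)
      (incrementKernel_nonneg hα hα2 (by norm_num) hy)
      (incrementKernel_nonneg hα hα2 (by linarith) hy)

/-- The lower bound for the dependence exponent in both regimes: `δ₀ = β` or
`δ₀ = d / (d + α)`. -/
theorem ofReal_le_dependenceExponent (hα : 0 < α) (hα2 : α ≤ 2) (hβ : 0 < β) (hβ1 : β < 1)
    (hd : (d : ℝ) < α * (1 + β) / β) (hM : IsStableRandomMeasure P volume (1 + β) M)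
    {δ₀ : ℝ} (hδ₀ : δ₀ < 1) (hβδ : β ≤ δ₀) (h : α = 2 ∨ (d : ℝ) / (d + α) ≤ δ₀) :
    ENNReal.ofReal ((d : ℝ) / α * (1 + β - δ₀)) ≤
      dependenceExponent P (subfracStable P d α β M) := by
  have hd0 : (0 : ℝ) < d := by exact_mod_cast Fin.pos_iff_nonempty.2 ‹_›
  have hdα : 0 < (d : ℝ) / α := by positivity
  refine le_iInf₂ fun z₁ z₂ => le_iInf₂ fun u v => le_iInf₂ fun s t =>
    le_iInf fun ⟨_, huv, hvs, hst⟩ => ?_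
  refine ofReal_le_sSup_isLittleO fun γ hγ => ?_
  have hδ₀' : δ₀ < 1 + β - γ / (d / α) := by
    have : γ / (d / α) < 1 + β - δ₀ := by rw [div_lt_iff₀ hdα]; linarith
    linarith
  obtain ⟨δ, hδ, hδ'⟩ := exists_between (lt_min hδ₀ hδ₀')
  obtain ⟨C, hC⟩ := exists_codiff_le hα hα2 hβ hβ1 hd hM z₁ z₂ huv hvs hst (hβδ.trans hδ.le)
    (hδ'.trans_le (min_le_left _ _)) (h.imp_right fun h => h.trans_lt hδ)
  refine ⟨(d : ℝ) / α * (1 + β - δ), ?_, C, fun T hT => ?_⟩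
  · have h1 : γ / (d / α) < 1 + β - δ := by linarith [hδ'.trans_le (min_le_right _ _)]
    rw [div_lt_iff₀ hdα] at h1
    linarith
  · rw [codiff, abs_norm]
    exact hC T hT

theorem dependenceExponent_le_ofReal {P : Measure Ω} {η : ℝ → Ω → ℝ} {κ c : ℝ} (hc : 0 < c)
    (h : ∀ᶠ T : ℝ in atTop, c * T ^ (-κ) ≤ codiff P η 1 1 1 2 3 4 T) :
    dependenceExponent P η ≤ ENNReal.ofReal κ :=
  (iInf₂_le_of_le 1 1 <| iInf₂_le_of_le 1 2 <| iInf₂_le_of_le 3 4 <|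
    iInf_le_of_le (by norm_num) le_rfl).trans (sSup_isLittleO_le_ofReal hc h)

/-- The upper bound for the dependence exponent by the noise close to the origin. -/
theorem dependenceExponent_le_of_ball (hα : 0 < α) (hα2 : α ≤ 2) (hβ : 0 < β) (hβ1 : β < 1)
    (hd : (d : ℝ) < α * (1 + β) / β) (hM : IsStableRandomMeasure P volume (1 + β) M) :
    dependenceExponent P (subfracStable P d α β M) ≤ ENNReal.ofReal ((d : ℝ) / α) := by
  obtain ⟨ε, c, hε, hc, hle⟩ := exists_le_stableDensity_of_norm_le d hα
  have hdα : 0 ≤ (d : ℝ) / α := by positivity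
  set ρ : ℝ := ε * (1 / 2 : ℝ) ^ (1 / α) with hρ
  have hρ0 : 0 < ρ := by positivity
  set B : Set (EuclideanSpace ℝ (Fin d)) := Metric.closedBall 0 ρ with hB
  have hBtop : volume B ≠ ∞ := measure_closedBall_lt_top.ne
  have hB0 : 0 < volume.real B :=
    ENNReal.toReal_pos (Metric.measure_closedBall_pos volume _ hρ0).ne' hBtop
  set m₁ : ℝ := c * 2 ^ (-((d : ℝ) / α)) with hm₁
  have hm₁0 : 0 < m₁ := by positivity
  have key : ∀ x ∈ B, ∀ w b : ℝ, 1 / 2 ≤ w → w ≤ b →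
      c * b ^ (-((d : ℝ) / α)) ≤ stableDensity d α w x := fun x hx w b hw hwb => by
    have hw0 : 0 < w := by linarith
    refine le_trans ?_ (hle w hw0 x ?_)
    · exact mul_le_mul_of_nonneg_left
        (Real.rpow_le_rpow_of_nonpos hw0 hwb (by linarith)) hc.le
    · rw [hB, mem_closedBall_zero_iff] at hx
      exact hx.trans (mul_le_mul_of_nonneg_left
        (Real.rpow_le_rpow (by norm_num) hw (by positivity)) hε.le)
  refine dependenceExponent_le_ofReal
    (c := 1 / 2 * volume.real B * (β * (c * 5 ^ (-((d : ℝ) / α)) * m₁ ^ β))) (by positivity) ?_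
  filter_upwards [eventually_ge_atTop 1] with T hT
  have h5 : (5 * T) ^ (-((d : ℝ) / α)) ≤ 2 ^ (-((d : ℝ) / α)) :=
    Real.rpow_le_rpow_of_nonpos (by norm_num) (by linarith) (by linarith)
  have h := le_codiff hα hα2 hβ hβ1 hd hM (B := B) (m₁ := m₁)
    (m₂ := c * (5 * T) ^ (-((d : ℝ) / α))) (T := T) Metric.isClosed_closedBall.measurableSet hBtop
    (by linarith) (by positivity)
    (mul_le_mul_of_nonneg_left h5 hc.le)
    (fun x hx w hw => key x hx w 2 hw.1 hw.2)
    (fun x hx w hw => key x hx w _ (by linarith [hw.1]) (by linarith [hw.2]))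
  refine (le_of_eq ?_).trans h
  rw [Real.mul_rpow (x := 5) (by norm_num) (by linarith)]
  ring

/-- The upper bound for the dependence exponent by the noise at distance of order
`T ^ (d / (α (d + α)))` from the origin. This is the distance at which the tail `‖x‖ ^ (-(d + α))`
of the density at times of order `1` meets the density `T ^ (-d/α)` at times of order `T`. -/
theorem dependenceExponent_le_of_annulus (hα : 0 < α) (hα2 : α < 2) (hβ : 0 < β) (hβ1 : β < 1)
    (hd : (d : ℝ) < α * (1 + β) / β) (hM : IsStableRandomMeasure P volume (1 + β) M) :
    dependenceExponent P (subfracStable P d α β M) ≤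
      ENNReal.ofReal ((d : ℝ) / α * (1 + β - d / (d + α))) := by
  obtain ⟨ε, c, hε, hc, hle⟩ := exists_le_stableDensity_of_norm_le d hα
  obtain ⟨c', hc', hle'⟩ := exists_le_stableDensity_of_le_norm d hα hα2
  have hd0 : (0 : ℝ) < d := by exact_mod_cast Fin.pos_iff_nonempty.2 ‹_›
  have hdα : 0 ≤ (d : ℝ) / α := by positivity
  have hda : 0 < (d : ℝ) + α := by positivity
  set q : ℝ := d / (α * (d + α)) with hq
  have hq0 : 0 < q := by positivity
  have hq1 : q < 1 / α := by
    rw [hq, div_lt_div_iff₀ (by positivity) hα]; nlinarith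
  set k : ℝ := min (c' * (1 / 2) * 2 ^ (-((d : ℝ) + α))) (c * 5 ^ (-((d : ℝ) / α))) with hk
  have hk0 : 0 < k := by positivity
  set b : ℝ := volume.real (Metric.ball (0 : EuclideanSpace ℝ (Fin d)) 1) with hb
  have hb0 : 0 < b :=
    ENNReal.toReal_pos (Metric.measure_ball_pos volume _ one_pos).ne' measure_ball_lt_top.ne
  refine dependenceExponent_le_ofReal
    (c := 1 / 2 * ((1 / 2) ^ d * b) * (β * (k * k ^ β))) (by positivity) ?_
  have ev1 : ∀ᶠ T : ℝ in atTop, 2 * 2 ^ (1 / α) ≤ T ^ q :=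
    (tendsto_rpow_atTop hq0).eventually_ge_atTop _
  have ev2 : ∀ᶠ T : ℝ in atTop, 2 / ε ≤ T ^ (1 / α - q) :=
    (tendsto_rpow_atTop (sub_pos.2 hq1)).eventually_ge_atTop _
  filter_upwards [eventually_ge_atTop 1, ev1, ev2] with T hT hT1 hT2
  have hT0 : 0 < T := by linarith
  set R : ℝ := T ^ q with hR
  have hR0 : 0 < R := Real.rpow_pos_of_pos hT0 _
  have hRε : 2 * R ≤ ε * T ^ (1 / α) := by
    rw [Real.rpow_sub hT0, div_le_div_iff₀ hε hR0] at hT2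
    linarith
  let i : Fin d := Classical.arbitrary _
  set x₀ : EuclideanSpace ℝ (Fin d) := EuclideanSpace.single i (3 / 2 * R) with hx₀
  have hx₀n : ‖x₀‖ = 3 / 2 * R := by
    rw [hx₀, PiLp.norm_single, Real.norm_of_nonneg (by positivity)]
  -- A ball of radius `R / 2` inside the annulus `R ≤ ‖x‖ ≤ 2 * R`.
  set B : Set (EuclideanSpace ℝ (Fin d)) := Metric.closedBall x₀ (R / 2) with hB
  have hBn : ∀ x ∈ B, R ≤ ‖x‖ ∧ ‖x‖ ≤ 2 * R := fun x hx => by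
    rw [hB, mem_closedBall_iff_norm] at hx
    have h1 := norm_le_norm_add_norm_sub' x x₀
    have h2 := norm_le_norm_add_norm_sub x x₀
    exact ⟨by linarith, by linarith⟩
  have hBv : volume.real B = (R / 2) ^ d * b := by
    rw [hB, measureReal_def, Measure.addHaar_closedBall _ _ (by positivity), ENNReal.toReal_mul,
      ENNReal.toReal_ofReal (by positivity), finrank_euclideanSpace_fin, hb, measureReal_def]
  have hm₁ : ∀ x ∈ B, ∀ w ∈ Set.Icc (1 / 2 : ℝ) 2,
      k * T ^ (-((d : ℝ) / α)) ≤ stableDensity d α w x := fun x hx w hw => by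
    have hw0 : 0 < w := by linarith [hw.1]
    have hxR := hBn x hx
    refine le_trans ?_ (hle' w hw0 x ?_)
    · calc k * T ^ (-((d : ℝ) / α))
          ≤ c' * (1 / 2) * 2 ^ (-((d : ℝ) + α)) * T ^ (-((d : ℝ) / α)) :=
            mul_le_mul_of_nonneg_right (min_le_left _ _) (by positivity)
        _ = c' * (1 / 2) * (2 * R) ^ (-((d : ℝ) + α)) := by
            rw [Real.mul_rpow (by norm_num) hR0.le, hR, ← Real.rpow_mul hT0.le,
              show q * -((d : ℝ) + α) = -((d : ℝ) / α) by rw [hq]; field_simp]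
            ring
        _ ≤ c' * w * ‖x‖ ^ (-((d : ℝ) + α)) := by
            refine mul_le_mul (mul_le_mul_of_nonneg_left hw.1 hc'.le)
              (Real.rpow_le_rpow_of_nonpos (hR0.trans_le hxR.1) hxR.2 (by linarith))
              (by positivity) (by positivity)
    · refine le_trans ?_ (hT1.trans hxR.1)
      exact mul_le_mul_of_nonneg_left
        (Real.rpow_le_rpow hw0.le hw.2 (by positivity)) (by norm_num)
  have hm₂ : ∀ x ∈ B, ∀ w ∈ Set.Icc (T + 2) (T + 4),
      k * T ^ (-((d : ℝ) / α)) ≤ stableDensity d α w x := fun x hx w hw => by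
    have hw0 : 0 < w := by linarith [hw.1]
    refine le_trans ?_ (hle w hw0 x ?_)
    · calc k * T ^ (-((d : ℝ) / α))
          ≤ c * 5 ^ (-((d : ℝ) / α)) * T ^ (-((d : ℝ) / α)) :=
            mul_le_mul_of_nonneg_right (min_le_right _ _) (by positivity)
        _ = c * (5 * T) ^ (-((d : ℝ) / α)) := by
            rw [Real.mul_rpow (by norm_num) hT0.le, mul_assoc]
        _ ≤ c * w ^ (-((d : ℝ) / α)) := mul_le_mul_of_nonneg_left
            (Real.rpow_le_rpow_of_nonpos hw0 (by linarith [hw.2]) (by linarith)) hc.le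
    · refine (hBn x hx).2.trans (hRε.trans (mul_le_mul_of_nonneg_left ?_ hε.le))
      exact Real.rpow_le_rpow hT0.le (by linarith [hw.1]) (by positivity)
  have h := le_codiff hα hα2.le hβ hβ1 hd hM (B := B) Metric.isClosed_closedBall.measurableSet
    measure_closedBall_lt_top.ne hT0.le (by positivity) le_rfl hm₁ hm₂
  refine (le_of_eq ?_).trans h
  have e1 : T ^ (-((d : ℝ) / α * (1 + β - d / (d + α)))) =
      R ^ d * (T ^ (-((d : ℝ) / α)) * (T ^ (-((d : ℝ) / α))) ^ β) := by
    rw [hR, ← Real.rpow_natCast, ← Real.rpow_mul hT0.le, ← Real.rpow_mul hT0.le,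
      ← Real.rpow_add hT0, ← Real.rpow_add hT0]
    congr 1
    rw [hq]
    field_simp
    ring
  rw [hBv, e1, Real.mul_rpow hk0.le (by positivity), div_pow R, div_pow 1, one_pow]
  ring

end Codifference

end SubfractionalStable

open SubfractionalStable in
theorem theorem2p7 (d : ℕ) (α β : ℝ) (hα0 : 0 < α) (hα2 : α ≤ 2) (hβ0 : 0 < β) (hβ1 : β < 1)
    (hd : α / β < d) (hd' : (d : ℝ) < α * (1 + β) / β)
    {Ω : Type*} [MeasurableSpace Ω] (P : Measure Ω) [IsProbabilityMeasure P]
    (M : Set (ℝ × EuclideanSpace ℝ (Fin d)) → Ω → ℝ)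
    (hM : IsStableRandomMeasure P (volume : Measure (ℝ × EuclideanSpace ℝ (Fin d))) (1 + β) M) :
    ((α = 2 ∨ (α < 2 ∧ (d : ℝ) / (d + α) < β)) →
      dependenceExponent P (subfracStable P d α β M) = ENNReal.ofReal (d / α)) ∧
    ((α < 2 ∧ β ≤ (d : ℝ) / (d + α)) →
      dependenceExponent P (subfracStable P d α β M) =
        ENNReal.ofReal (d / α * (1 + β - d / (d + α)))) := by
  have hd0 : (0 : ℝ) < d := (div_pos hα0 hβ0).trans hd
  have : Nonempty (Fin d) := Fin.pos_iff_nonempty.1 (by exact_mod_cast hd0)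
  refine ⟨fun h => le_antisymm (dependenceExponent_le_of_ball hα0 hα2 hβ0 hβ1 hd' hM) ?_,
    fun h => le_antisymm (dependenceExponent_le_of_annulus hα0 h.1 hβ0 hβ1 hd' hM) ?_⟩
  · have h1 := ofReal_le_dependenceExponent hα0 hα2 hβ0 hβ1 hd' hM hβ1 le_rfl
      (h.imp_right fun h => h.2.le)
    rwa [add_sub_cancel_right, mul_one] at h1
  · exact ofReal_le_dependenceExponent hα0 hα2 hβ0 hβ1 hd' hM
      ((div_lt_one (by linarith)).2 (by linarith)) h.2 (Or.inr le_rfl)
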